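/- **Conventions.** Let $M$ be a smooth manifold of odd dimension. For a bivector $P$ and a 2-form $\sigma$ on $M$ let $P^\sharp:T^*M\to TM$ and $\sigma^\flat:TM\to T^*M$ be given by $\beta(P^\sharp\alpha)=P(\alpha,\beta)$ and $\sigma^\flat(X)(Y)=\sigma(X,Y)$; for a bundle map $F:TM\to TM$ let $F^*\alpha=\alpha\circ F$. The Courant bracket on sections of $TM\oplus T^*M$ is $$[\![X+\alpha,Y+\beta]\!]=[X,Y]+L_X\beta-L_Y\alpha-\tfrac12 d(\beta(X)-\alpha(Y)).$$ A *generalized almost para-contact structure* on $M$ consists of smooth tensor fields $(F,P,\sigma,Z,\xi)$, where $F:TM\to TM$ is a bundle map, $P$ a bivector, $\sigma$ a 2-form, $Z$ a vector field and $\xi$ a 1-form, such that the (skew) bundle map $\mathcal F=\begin{pmatrix}F&P^\sharp\\ \sigma^\flat&-F^*\end{pmatrix}$ of $TM\oplus T^*M$ satisfies $\xi(Z)=1$, $\mathcal F(\xi)=0$, $\mathcal F(Z)=0$ and $\mathcal F^2(X+\alpha)=X+\alpha-\xi(X)Z-\alpha(Z)\xi$. Its $M$-adapted generalized almost para-complex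 structure on $M\times\mathbb R$ (with coordinate $t$ on $\mathbb R$) is $$\mathcal J=\begin{pmatrix}F&\pi^\sharp\\ \theta^\flat&-F^*\end{pmatrix},\qquad \pi=P-Z\wedge\tfrac{d}{dt},\quad \theta=\sigma+\xi\wedge dt,$$ where $F$ is extended by $F(\frac{d}{dt})=0$; it is skew for the natural pairing and $\mathcal J^2=I$. (The choice $\pi=P+Z\wedge\frac{d}{dt}$, $\theta=\sigma-\xi\wedge dt$ differs from it by the diffeomorphism $t\mapsto -t$.) The structure $(F,P,\sigma,Z,\xi)$ is *normal* if $\mathcal J$ is integrable, i.e. $[\![\mathcal Je_1,\mathcal Je_2]\!]-\mathcal J([\![\mathcal Je_1,e_2]\!]+[\![e_1,\mathcal Je_2]\!])+[\![e_1,e_2]\!]=0$ for all smooth sections $e_1,e_2$ of $T(M\times\mathbb R)\oplus T^*(M\times\mathbb R)$. Put $[\alpha,\beta]_P=L_{P^\sharp\alpha}\beta-L_{P^\sharp\beta}\alpha-d(P(\alpha,\beta))$, $N_F(X,Y)=[FX,FY]+F^2[X,Y]-F[FX,Y]-F[X,FY]$, $\sigma_F(X,Y)=\sigma(FX,Y)$,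 $i_{X\wedge Y}d\sigma=d\sigma(X,Y,\cdot)$ and $d\xi(X,Y)=X(\xi(Y))-Y(\xi(X))-\xi([X,Y])$. **Theorem 3.1.** A generalized almost para-contact structure $(F,P,\sigma,Z,\xi)$ on $M$ is normal if and only if the following conditions hold for all smooth vector fields $X,Y,W$ and 1-forms $\alpha,\beta$ on $M$: - (A1) $[P^\sharp\alpha,P^\sharp\beta]=P^\sharp([\alpha,\beta]_P)$. - (A2) $FP^\sharp=P^\sharp F^*$ and $F^*([\alpha,\beta]_P)=L_{P^\sharp\alpha}F^*\beta-L_{P^\sharp\beta}F^*\alpha+d(P(\beta,F^*\alpha))$. - (A3) $i_Z\sigma=0$, $i_\xi P=0$, $F^2=\mathrm{Id}-P^\sharp\sigma^\flat-Z\otimes\xi$, and $N_F(X,Y)=P^\sharp(i_{X\wedge Y}d\sigma)+d\xi(X,Y)\,Z$. - (A4) $F(Z)=0$, $\xi\circ F=0$, $(L_{FX}\xi)(Y)-(L_{FY}\xi)(X)=0$, and $d\sigma_F(X,Y,W)=d\sigma(FX,Y,W)+d\sigma(X,FY,W)+d\sigma(X,Y,FW)$. - (A5) $L_Z\xi=0$,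 $L_ZP=0$, $L_ZF=0$, $L_Z\sigma^\flat=0$, and $L_{P^\sharp\alpha}\xi=0$. -/

import Mathlib

open scoped Manifold ContDiff
open VectorField

noncomputable section

namespace ParaContact

section Calculus

variable {E : Type*} [NormedAddCommGroup E] [NormedSpace ℝ E]
  {H : Type*} [TopologicalSpace H] (I : ModelWithCorners ℝ E H)
  {M : Type*} [TopologicalSpace M] [ChartedSpace H M]

/-- The cotangent space `T*ₓM`. -/
abbrev Cotangent (x : M) : Type _ := TangentSpace I x →L[ℝ] ℝ

/-- The fibre at `x` of the big tangent bundle `TM ⊕ T*M`. -/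
abbrev BigTangent (x : M) : Type _ := TangentSpace I x × Cotangent I x

/-! ### Smooth sections -/

section Smooth

variable [IsManifold I ∞ M]

/-- `X` is a smooth vector field. -/
def SmoothVectorField (X : Π x : M, TangentSpace I x) : Prop :=
  ContMDiff I (I.prod 𝓘(ℝ, E)) ∞
    (fun x ↦ Bundle.TotalSpace.mk' E (E := fun x : M ↦ TangentSpace I x) x (X x))

/-- `α` is a smooth 1-form: a smooth section of the bundle `Hom(TM, ℝ)`. -/
def SmoothOneForm (α : Π x : M, Cotangent I x) : Prop :=
  ContMDiff I (I.prod 𝓘(ℝ, E →L[ℝ] ℝ)) ∞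
    (fun x ↦ Bundle.TotalSpace.mk' (E →L[ℝ] ℝ) (E := fun x : M ↦ TangentSpace I x →L[ℝ] ℝ) x (α x))

/-- `F` is a smooth bundle map `TM → TM`. -/
def SmoothEndomorphism (F : Π x : M, TangentSpace I x →L[ℝ] TangentSpace I x) : Prop :=
  ContMDiff I (I.prod 𝓘(ℝ, E →L[ℝ] E)) ∞
    (fun x ↦ Bundle.TotalSpace.mk' (E →L[ℝ] E)
      (E := fun x : M ↦ TangentSpace I x →L[ℝ] TangentSpace I x) x (F x))

/-- `P` is a smooth bundle map `T*M → TM`. -/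
def SmoothSharp (P : Π x : M, Cotangent I x →L[ℝ] TangentSpace I x) : Prop :=
  ContMDiff I (I.prod 𝓘(ℝ, (E →L[ℝ] ℝ) →L[ℝ] E)) ∞
    (fun x ↦ Bundle.TotalSpace.mk' ((E →L[ℝ] ℝ) →L[ℝ] E)
      (E := fun x : M ↦ (TangentSpace I x →L[ℝ] ℝ) →L[ℝ] TangentSpace I x) x (P x))

/-- `σ` is a smooth bundle map `TM → T*M`. -/
def SmoothFlat (σ : Π x : M, TangentSpace I x →L[ℝ] Cotangent I x) : Prop :=
  ContMDiff I (I.prod 𝓘(ℝ, E →L[ℝ] E →L[ℝ] ℝ)) ∞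
    (fun x ↦ Bundle.TotalSpace.mk' (E →L[ℝ] E →L[ℝ] ℝ)
      (E := fun x : M ↦ TangentSpace I x →L[ℝ] TangentSpace I x →L[ℝ] ℝ) x (σ x))

/-- `e = (X, α)` is a smooth section of `TM ⊕ T*M`. -/
def SmoothSection (e : Π x : M, BigTangent I x) : Prop :=
  SmoothVectorField I (fun x ↦ (e x).1) ∧ SmoothOneForm I (fun x ↦ (e x).2)

end Smooth

/-! ### Exterior derivative and Lie derivative

The differential of a function `f` is Mathlib's `mvfderiv I f`, the Lie bracket of vector fields is
`mlieBracket I`.  The exterior derivatives of 1-forms and 2-forms are computed in the preferred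
chart `φ` at the point: pull the form back by `φ⁻¹`, differentiate and antisymmetrize in the model
space, and pull back by `φ`. -/

/-- The differential at `x` of the preferred chart at `x`. -/
def chartDeriv (x : M) : TangentSpace I x →L[ℝ] E :=
  mfderiv I 𝓘(ℝ, E) (extChartAt I x) x

/-- The differential at `y : E` of the inverse of the preferred chart at `x₀`. -/
def chartSymmDeriv (x₀ : M) (y : E) : E →L[ℝ] TangentSpace I ((extChartAt I x₀).symm y) :=
  mfderivWithin 𝓘(ℝ, E) I (extChartAt I x₀).symm (Set.range I) y

/-- The 1-form `α` read in the preferred chart at `x₀`. -/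
def chartOneForm (α : Π x : M, Cotangent I x) (x₀ : M) (y : E) : E →L[ℝ] ℝ :=
  (α ((extChartAt I x₀).symm y)).comp (chartSymmDeriv I x₀ y)

/-- The bilinear form `b` read in the preferred chart at `x₀`. -/
def chartTwoForm (b : Π x : M, TangentSpace I x →L[ℝ] Cotangent I x) (x₀ : M) (y : E) :
    E →L[ℝ] E →L[ℝ] ℝ :=
  (ContinuousLinearMap.precomp ℝ (chartSymmDeriv I x₀ y)).comp
    ((b ((extChartAt I x₀).symm y)).comp (chartSymmDeriv I x₀ y))

/-- The contracted exterior derivative of a 1-form: `extDerivOne I α x u` is the covector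
`dα(u, ·)` at `x`, where `dα(u, v) = ∂_u α(v) - ∂_v α(u)` in a chart. -/
def extDerivOne (α : Π x : M, Cotangent I x) (x : M) (u : TangentSpace I x) : Cotangent I x :=
  let D : E →L[ℝ] E →L[ℝ] ℝ :=
    fderivWithin ℝ (chartOneForm I α x) (Set.range I) (extChartAt I x x)
  (D (chartDeriv I x u) - D.flip (chartDeriv I x u)).comp (chartDeriv I x)

/-- The contracted exterior derivative of a 2-form: `extDerivTwo I σ x u v` is the covector
`dσ(u, v, ·)` at `x` (also written `i_{u ∧ v} dσ`), where
`dσ(u, v, w) = ∂_u σ(v, w) + ∂_v σ(w, u) + ∂_w σ(u, v)` in a chart. -/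
def extDerivTwo (σ : Π x : M, TangentSpace I x →L[ℝ] Cotangent I x) (x : M)
    (u v : TangentSpace I x) : Cotangent I x :=
  let D : E →L[ℝ] E →L[ℝ] E →L[ℝ] ℝ :=
    fderivWithin ℝ (chartTwoForm I σ x) (Set.range I) (extChartAt I x x)
  let u' : E := chartDeriv I x u
  let v' : E := chartDeriv I x v
  (D u' v' + (D v').flip u' + (D.flip u').flip v').comp (chartDeriv I x)

/-- The Lie derivative of a 1-form, `L_X α = i_X dα + d(i_X α)`. -/
def lieOneForm (X : Π x : M, TangentSpace I x) (α : Π x : M, Cotangent I x) (x : M) :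
    Cotangent I x :=
  extDerivOne I α x (X x) + mvfderiv I (fun y ↦ α y (X y)) x

/-! ### The pairing, the Courant bracket and integrability -/

/-- The pairing `⟨X + α, Y + β⟩ = (β(X) + α(Y)) / 2`. -/
def pairing {x : M} (e₁ e₂ : BigTangent I x) : ℝ := (1 / 2) * (e₂.2 e₁.1 + e₁.2 e₂.1)

/-- The Courant bracket
`⟦X + α, Y + β⟧ = [X, Y] + L_X β - L_Y α - (1/2) d(β(X) - α(Y))`. -/
def courantBracket (e₁ e₂ : Π x : M, BigTangent I x) (x : M) : BigTangent I x :=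
  (mlieBracket I (fun y ↦ (e₁ y).1) (fun y ↦ (e₂ y).1) x,
    lieOneForm I (fun y ↦ (e₁ y).1) (fun y ↦ (e₂ y).2) x
      - lieOneForm I (fun y ↦ (e₂ y).1) (fun y ↦ (e₁ y).2) x
      - (1 / 2 : ℝ) • mvfderiv I (fun y ↦ (e₂ y).2 (e₁ y).1 - (e₁ y).2 (e₂ y).1) x)

/-- Courant-integrability of an (almost para-complex) bundle map `J` of `TM ⊕ T*M`:
`⟦J e₁, J e₂⟧ - J (⟦J e₁, e₂⟧ + ⟦e₁, J e₂⟧) + ⟦e₁, e₂⟧ = 0` for all smooth sections. -/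
def CourantIntegrable [IsManifold I ∞ M] (J : Π x : M, BigTangent I x →L[ℝ] BigTangent I x) : Prop :=
  ∀ e₁ e₂ : Π x : M, BigTangent I x, SmoothSection I e₁ → SmoothSection I e₂ → ∀ x : M,
    courantBracket I (fun y ↦ J y (e₁ y)) (fun y ↦ J y (e₂ y)) x
      - J x (courantBracket I (fun y ↦ J y (e₁ y)) e₂ x
          + courantBracket I e₁ (fun y ↦ J y (e₂ y)) x)
      + courantBracket I e₁ e₂ x = 0

/-- The endomorphism with block matrix `(F, P♯; σ♭, -F*)` of `TₓM ⊕ T*ₓM`, that is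
`(X, α) ↦ (F X + P♯ α, σ♭ X - F* α)` with `F* α = α ∘ F`. -/
def blockMap {x : M} (F : TangentSpace I x →L[ℝ] TangentSpace I x)
    (P : Cotangent I x →L[ℝ] TangentSpace I x) (σ : TangentSpace I x →L[ℝ] Cotangent I x) :
    BigTangent I x →L[ℝ] BigTangent I x :=
  (F.coprod P).prod (σ.coprod (-(ContinuousLinearMap.precomp ℝ F)))

@[simp] lemma blockMap_apply {x : M} (F : TangentSpace I x →L[ℝ] TangentSpace I x)
    (P : Cotangent I x →L[ℝ] TangentSpace I x) (σ : TangentSpace I x →L[ℝ] Cotangent I x)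
    (e : BigTangent I x) :
    blockMap I F P σ e = (F e.1 + P e.2, σ e.1 - e.2.comp F) := by
  rw [sub_eq_add_neg]
  rfl

/-- If `P` and `σ` are skew, the block map is skew for the pairing. -/
lemma blockMap_skew {x : M} (F : TangentSpace I x →L[ℝ] TangentSpace I x)
    (P : Cotangent I x →L[ℝ] TangentSpace I x) (σ : TangentSpace I x →L[ℝ] Cotangent I x)
    (hP : ∀ α β : Cotangent I x, β (P α) = -α (P β))
    (hσ : ∀ u v : TangentSpace I x, σ u v = -σ v u) (e₁ e₂ : BigTangent I x) :
    pairing I (blockMap I F P σ e₁) e₂ + pairing I e₁ (blockMap I F P σ e₂) = 0 := by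
  simp only [pairing, blockMap_apply, map_add, sub_apply,
    ContinuousLinearMap.comp_apply]
  rw [hP e₁.2 e₂.2, hσ e₁.1 e₂.1]
  ring

/-- The bracket of 1-forms `[α, β]_P = L_{P♯α} β - L_{P♯β} α - d(P(α, β))`,
where `P(α, β) = β(P♯ α)`. -/
def formBracket (P : Π x : M, Cotangent I x →L[ℝ] TangentSpace I x)
    (α β : Π x : M, Cotangent I x) (x : M) : Cotangent I x :=
  lieOneForm I (fun y ↦ P y (α y)) β x - lieOneForm I (fun y ↦ P y (β y)) α x
    - mvfderiv I (fun y ↦ β y (P y (α y))) x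

/-- The Nijenhuis tensor `N_F(X, Y) = [FX, FY] + F²[X, Y] - F[FX, Y] - F[X, FY]`. -/
def nijenhuis (F : Π x : M, TangentSpace I x →L[ℝ] TangentSpace I x)
    (X Y : Π x : M, TangentSpace I x) (x : M) : TangentSpace I x :=
  mlieBracket I (fun y ↦ F y (X y)) (fun y ↦ F y (Y y)) x + F x (F x (mlieBracket I X Y x))
    - F x (mlieBracket I (fun y ↦ F y (X y)) Y x) - F x (mlieBracket I X (fun y ↦ F y (Y y)) x)

/-- The Lie derivative of a bivector:
`(L_Z P)(α, β) = Z(P(α, β)) - P(L_Z α, β) - P(α, L_Z β)`, where `P(α, β) = β(P♯ α)`. -/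
def lieBivector (Z : Π x : M, TangentSpace I x)
    (P : Π x : M, Cotangent I x →L[ℝ] TangentSpace I x) (α β : Π x : M, Cotangent I x) (x : M) : ℝ :=
  mvfderiv I (fun y ↦ β y (P y (α y))) x (Z x) - β x (P x (lieOneForm I Z α x))
    - lieOneForm I Z β x (P x (α x))

/-- The Lie derivative of a bundle map `TM → TM`: `(L_Z F) X = [Z, F X] - F [Z, X]`. -/
def lieEndomorphism (Z : Π x : M, TangentSpace I x)
    (F : Π x : M, TangentSpace I x →L[ℝ] TangentSpace I x) (X : Π x : M, TangentSpace I x) (x : M) :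
    TangentSpace I x :=
  mlieBracket I Z (fun y ↦ F y (X y)) x - F x (mlieBracket I Z X x)

/-- The Lie derivative of a bundle map `TM → T*M`: `(L_Z σ♭) X = L_Z (σ♭ X) - σ♭ [Z, X]`. -/
def lieFlat (Z : Π x : M, TangentSpace I x)
    (σ : Π x : M, TangentSpace I x →L[ℝ] Cotangent I x) (X : Π x : M, TangentSpace I x) (x : M) :
    Cotangent I x :=
  lieOneForm I Z (fun y ↦ σ y (X y)) x - σ x (mlieBracket I Z X x)

/-- Evaluation of covectors at `u`. -/
def evalAt {x : M} (u : TangentSpace I x) : Cotangent I x →L[ℝ] ℝ where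
  toFun α := α u
  map_add' _ _ := rfl
  map_smul' _ _ := rfl
  cont := continuous_eval_const u

/-- The map `(u ∧ v)♯ α = α(u) v - α(v) u` of the bivector `u ∧ v`. -/
def wedgeSharp {x : M} (u v : TangentSpace I x) : Cotangent I x →L[ℝ] TangentSpace I x :=
  (evalAt I u).smulRight v - (evalAt I v).smulRight u

/-- The map `(α ∧ β)♭ u = α(u) β - β(u) α` of the 2-form `α ∧ β`. -/
def wedgeFlat {x : M} (α β : Cotangent I x) : TangentSpace I x →L[ℝ] Cotangent I x :=
  α.smulRight β - β.smulRight α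

end Calculus

/-! ### The product `M × ℝ` -/

section Product

variable {E : Type*} [NormedAddCommGroup E] [NormedSpace ℝ E]
  {H : Type*} [TopologicalSpace H] {I : ModelWithCorners ℝ E H}
  {M : Type*} [TopologicalSpace M] [ChartedSpace H M]

/-- The differential of the projection `M × ℝ → M`. -/
def projM (I : ModelWithCorners ℝ E H) (p : M × ℝ) :
    TangentSpace (I.prod 𝓘(ℝ, ℝ)) p →L[ℝ] TangentSpace I p.1 :=
  mfderiv (I.prod 𝓘(ℝ, ℝ)) I (Prod.fst : M × ℝ → M) p

/-- The differential of the inclusion `x ↦ (x, t)` of `M` in `M × ℝ`. -/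
def inclM (I : ModelWithCorners ℝ E H) (p : M × ℝ) :
    TangentSpace I p.1 →L[ℝ] TangentSpace (I.prod 𝓘(ℝ, ℝ)) p :=
  mfderiv I (I.prod 𝓘(ℝ, ℝ)) (fun x : M ↦ (x, p.2)) p.1

/-- The 1-form `dt` on `M × ℝ`. -/
def dt (I : ModelWithCorners ℝ E H) (p : M × ℝ) : Cotangent (I.prod 𝓘(ℝ, ℝ)) p :=
  mvfderiv (I.prod 𝓘(ℝ, ℝ)) (Prod.snd : M × ℝ → ℝ) p

/-- The vector field `d/dt` on `M × ℝ`. -/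
def ddt (I : ModelWithCorners ℝ E H) (p : M × ℝ) : TangentSpace (I.prod 𝓘(ℝ, ℝ)) p :=
  (mfderiv 𝓘(ℝ, ℝ) (I.prod 𝓘(ℝ, ℝ)) (fun t : ℝ ↦ (p.1, t)) p.2 :
    ℝ →L[ℝ] TangentSpace (I.prod 𝓘(ℝ, ℝ)) p) 1

@[simp] lemma projM_apply (p : M × ℝ) (v : TangentSpace (I.prod 𝓘(ℝ, ℝ)) p) :
    projM I p v = v.1 := by
  unfold projM; rw [mfderiv_fst]; rfl

@[simp] lemma inclM_apply (p : M × ℝ) (u : TangentSpace I p.1) :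
    inclM I p u = ((u, 0) : E × ℝ) := by
  unfold inclM; rw [mfderiv_prod_left]; rfl

@[simp] lemma dt_apply (p : M × ℝ) (v : TangentSpace (I.prod 𝓘(ℝ, ℝ)) p) :
    dt I p v = v.2 := by
  unfold dt mvfderiv; rw [mfderiv_snd]; rfl

lemma ddt_eq (p : M × ℝ) : ddt I p = ((0, 1) : E × ℝ) := by
  unfold ddt; rw [mfderiv_prod_right]; rfl

lemma projM_inclM (p : M × ℝ) (u : TangentSpace I p.1) : projM I p (inclM I p u) = u := by
  rw [projM_apply, inclM_apply]

lemma projM_ddt (p : M × ℝ) : projM I p (ddt I p) = 0 := by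
  rw [projM_apply, ddt_eq]; rfl

lemma dt_inclM (p : M × ℝ) (u : TangentSpace I p.1) : dt I p (inclM I p u) = 0 := by
  rw [dt_apply, inclM_apply]

lemma dt_ddt (p : M × ℝ) : dt I p (ddt I p) = 1 := by
  rw [dt_apply, ddt_eq]

lemma decomp (p : M × ℝ) (v : TangentSpace (I.prod 𝓘(ℝ, ℝ)) p) :
    v = inclM I p (projM I p v) + dt I p v • ddt I p := by
  rw [inclM_apply, dt_apply, ddt_eq, projM_apply]
  change (v : E × ℝ) = ((v : E × ℝ).1, (0:ℝ)) + (v : E × ℝ).2 • ((0 : E), (1:ℝ))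
  refine Prod.ext ?_ ?_ <;> simp

end Product

/-! ### Generalized almost para-contact structures -/

/-- A generalized almost para-contact structure `(F, P, σ, Z, ξ)`.  The bivector `P` is given by
`P♯ : T*M → TM` with `β(P♯ α) = P(α, β)`, the 2-form `σ` by `σ♭ : TM → T*M` with
`σ♭(X)(Y) = σ(X, Y)`.  Skewness of `P` and `σ` makes the block map `𝓕 = (F, P♯; σ♭, -F*)` skew for
the pairing, that is `𝓕 + 𝓕* = 0`; see `blockMap_skew`. -/
structure GenAlmostParaContact {E : Type*} [NormedAddCommGroup E] [NormedSpace ℝ E]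
    {H : Type*} [TopologicalSpace H] (I : ModelWithCorners ℝ E H)
    (M : Type*) [TopologicalSpace M] [ChartedSpace H M] [IsManifold I ∞ M] where
  F : Π x : M, TangentSpace I x →L[ℝ] TangentSpace I x
  P : Π x : M, Cotangent I x →L[ℝ] TangentSpace I x
  σ : Π x : M, TangentSpace I x →L[ℝ] Cotangent I x
  Z : Π x : M, TangentSpace I x
  ξ : Π x : M, Cotangent I x
  smooth_F : SmoothEndomorphism I F
  smooth_P : SmoothSharp I P
  smooth_σ : SmoothFlat I σ
  smooth_Z : SmoothVectorField I Z
  smooth_ξ : SmoothOneForm I ξ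
  P_skew : ∀ (x : M) (α β : Cotangent I x), β (P x α) = -α (P x β)
  σ_skew : ∀ (x : M) (u v : TangentSpace I x), σ x u v = -σ x v u
  ξ_Z : ∀ x : M, ξ x (Z x) = 1
  map_ξ : ∀ x : M, blockMap I (F x) (P x) (σ x) (0, ξ x) = 0
  map_Z : ∀ x : M, blockMap I (F x) (P x) (σ x) (Z x, 0) = 0
  sq : ∀ (x : M) (e : BigTangent I x),
    blockMap I (F x) (P x) (σ x) (blockMap I (F x) (P x) (σ x) e)
      = e - (ξ x e.1 • Z x, e.2 (Z x) • ξ x)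

namespace GenAlmostParaContact

variable {E : Type*} [NormedAddCommGroup E] [NormedSpace ℝ E]
  {H : Type*} [TopologicalSpace H] {I : ModelWithCorners ℝ E H}
  {M : Type*} [TopologicalSpace M] [ChartedSpace H M] [IsManifold I ∞ M]

/-- The `M`-adapted structure on `M × ℝ` of a generalized almost para-contact structure: the bundle
map `J = (a, π♯; θ♭, -a*)` with `a = F`, `π = P - Z ∧ d/dt`, `θ = σ + ξ ∧ dt`.  Explicitly
`J(X + α + f d/dt + g dt) = 𝓕(X + α) + g Z - f ξ - α(Z) d/dt + ξ(X) dt`. -/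
def adapted (S : GenAlmostParaContact I M) (p : M × ℝ) :
    BigTangent (I.prod 𝓘(ℝ, ℝ)) p →L[ℝ] BigTangent (I.prod 𝓘(ℝ, ℝ)) p :=
  blockMap (I.prod 𝓘(ℝ, ℝ))
    ((inclM I p).comp ((S.F p.1).comp (projM I p)))
    ((inclM I p).comp ((S.P p.1).comp (ContinuousLinearMap.precomp ℝ (inclM I p)))
      - wedgeSharp (I.prod 𝓘(ℝ, ℝ)) (inclM I p (S.Z p.1)) (ddt I p))
    ((ContinuousLinearMap.precomp ℝ (projM I p)).comp ((S.σ p.1).comp (projM I p))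
      + wedgeFlat (I.prod 𝓘(ℝ, ℝ)) ((S.ξ p.1).comp (projM I p)) (dt I p))

lemma adapted_apply (S : GenAlmostParaContact I M) (p : M × ℝ)
    (e : BigTangent (I.prod 𝓘(ℝ, ℝ)) p) :
    S.adapted p e =
      (inclM I p (S.F p.1 (projM I p e.1) + S.P p.1 (e.2.comp (inclM I p))
          + e.2 (ddt I p) • S.Z p.1) - e.2 (inclM I p (S.Z p.1)) • ddt I p,
        (S.σ p.1 (projM I p e.1) - (e.2.comp (inclM I p)).comp (S.F p.1)
          - dt I p e.1 • S.ξ p.1).comp (projM I p) + S.ξ p.1 (projM I p e.1) • dt I p) := by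
  unfold adapted
  rw [blockMap_apply]
  refine Prod.ext ?_ ?_
  · change inclM I p (S.F p.1 (projM I p e.1)) + (inclM I p (S.P p.1 (e.2.comp (inclM I p)))
      - (e.2 (inclM I p (S.Z p.1)) • ddt I p - e.2 (ddt I p) • inclM I p (S.Z p.1))) = _
    simp only [map_add, map_smul]
    abel
  · ext w
    change S.σ p.1 (projM I p e.1) (projM I p w)
      + (S.ξ p.1 (projM I p e.1) * dt I p w - dt I p e.1 * S.ξ p.1 (projM I p w))
      - e.2 (inclM I p (S.F p.1 (projM I p w)))
      = S.σ p.1 (projM I p e.1) (projM I p w) - e.2 (inclM I p (S.F p.1 (projM I p w)))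
        - dt I p e.1 * S.ξ p.1 (projM I p w) + S.ξ p.1 (projM I p e.1) * dt I p w
    ring

/-- The adapted structure satisfies `J² = 1`. -/
lemma adapted_adapted (S : GenAlmostParaContact I M) (p : M × ℝ)
    (e : BigTangent (I.prod 𝓘(ℝ, ℝ)) p) : S.adapted p (S.adapted p e) = e := by
  obtain ⟨v, γ⟩ := e
  set X := projM I p v with hX
  set α : Cotangent I p.1 := γ.comp (inclM I p) with hα
  have h1 := S.map_ξ p.1
  have h2 := S.map_Z p.1
  have h3 := S.sq p.1 (X, α)
  simp only [blockMap_apply, Prod.mk_eq_zero, map_zero, zero_add, zero_sub, neg_eq_zero, add_zero,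
    sub_zero, ContinuousLinearMap.zero_comp] at h1 h2
  simp only [blockMap_apply, Prod.ext_iff, Prod.fst_sub, Prod.snd_sub] at h3
  obtain ⟨h3a, h3b⟩ := h3
  have hσξ : ∀ u, S.σ p.1 u (S.Z p.1) = 0 := fun u ↦ by
    rw [S.σ_skew, h2.2]; simp
  have hξP : ∀ β, S.ξ p.1 (S.P p.1 β) = 0 := fun β ↦ by
    rw [S.P_skew, h1.1]; simp
  have hξF : ∀ u, S.ξ p.1 (S.F p.1 u) = 0 := fun u ↦ by
    simpa using congrArg (fun q ↦ q u) h1.2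
  have hγ : ∀ u, γ (inclM I p u) = α u := fun u ↦ rfl
  have e1 : projM I p (inclM I p (S.F p.1 X + S.P p.1 α + γ (ddt I p) • S.Z p.1)
      - γ (inclM I p (S.Z p.1)) • ddt I p) = S.F p.1 X + S.P p.1 α + γ (ddt I p) • S.Z p.1 := by
    rw [map_sub, map_smul, projM_inclM, projM_ddt, smul_zero, sub_zero]
  have e2 : dt I p (inclM I p (S.F p.1 X + S.P p.1 α + γ (ddt I p) • S.Z p.1)
      - γ (inclM I p (S.Z p.1)) • ddt I p) = - α (S.Z p.1) := by
    rw [map_sub, map_smul, dt_inclM, dt_ddt, hγ]; simp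
  have e3 : ∀ (β : Cotangent I p.1) (c : ℝ),
      (β.comp (projM I p) + c • dt I p).comp (inclM I p) = β := fun β c ↦ by
    ext u
    change β (projM I p (inclM I p u)) + c * dt I p (inclM I p u) = β u
    rw [projM_inclM, dt_inclM, mul_zero, add_zero]
  have e4 : ∀ (β : Cotangent I p.1) (c : ℝ),
      (β.comp (projM I p) + c • dt I p) (ddt I p) = c := fun β c ↦ by
    change β (projM I p (ddt I p)) + c * dt I p (ddt I p) = c
    rw [projM_ddt, dt_ddt, map_zero, zero_add, mul_one]
  have e5 : ∀ (β : Cotangent I p.1) (c : ℝ) (u : TangentSpace I p.1),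
      (β.comp (projM I p) + c • dt I p) (inclM I p u) = β u := fun β c u ↦
    congrArg (fun q ↦ q u) (e3 β c)
  rw [adapted_apply, adapted_apply]
  simp only [← hX, ← hα]
  rw [e1, e2, e3, e4, e5]
  refine Prod.ext ?_ ?_
  · have : S.F p.1 (S.F p.1 X + S.P p.1 α + γ (ddt I p) • S.Z p.1)
        + S.P p.1 (S.σ p.1 X - α.comp (S.F p.1) - dt I p v • S.ξ p.1)
        + S.ξ p.1 X • S.Z p.1 = X := by
      rw [map_add _ _ (γ (ddt I p) • S.Z p.1), map_smul, h2.1, map_sub _ _ (dt I p v • S.ξ p.1),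
        map_smul, h1.1, smul_zero, smul_zero, add_zero, sub_zero, h3a]
      abel
    rw [this]
    have h6 : (S.σ p.1 X - α.comp (S.F p.1) - dt I p v • S.ξ p.1) (S.Z p.1) = - dt I p v := by
      change S.σ p.1 X (S.Z p.1) - α (S.F p.1 (S.Z p.1)) - dt I p v * S.ξ p.1 (S.Z p.1) = _
      rw [hσξ, h2.1, S.ξ_Z, map_zero]; ring
    rw [h6, neg_smul, sub_neg_eq_add]
    exact (decomp p v).symm
  · have h7 : S.ξ p.1 (S.F p.1 X + S.P p.1 α + γ (ddt I p) • S.Z p.1) = γ (ddt I p) := by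
      rw [map_add, map_add, map_smul, hξF, hξP, S.ξ_Z]; simp
    rw [h7]
    ext w
    have h8 := congrArg (fun q ↦ q (projM I p w)) h3b
    have hσZ : S.σ p.1 (γ (ddt I p) • S.Z p.1) = 0 := by rw [map_smul, h2.2, smul_zero]
    rw [map_add (S.σ p.1) (_ + _), hσZ]
    conv_rhs => rw [decomp p w]
    simp only [map_add, map_smul, hγ, smul_eq_mul, sub_apply, add_apply, smul_apply,
      ContinuousLinearMap.comp_apply, hξF, add_zero, mul_zero, sub_zero, neg_mul,
      sub_neg_eq_add] at h8 ⊢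
    linarith

/-- The adapted structure is skew for the pairing. -/
lemma adapted_skew (S : GenAlmostParaContact I M) (p : M × ℝ)
    (e₁ e₂ : BigTangent (I.prod 𝓘(ℝ, ℝ)) p) :
    pairing (I.prod 𝓘(ℝ, ℝ)) (S.adapted p e₁) e₂
      + pairing (I.prod 𝓘(ℝ, ℝ)) e₁ (S.adapted p e₂) = 0 := by
  refine blockMap_skew _ _ _ _ (fun α β ↦ ?_) (fun u v ↦ ?_) _ _
  · change β (inclM I p (S.P p.1 (α.comp (inclM I p)))
        - (α (inclM I p (S.Z p.1)) • ddt I p - α (ddt I p) • inclM I p (S.Z p.1)))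
      = -α (inclM I p (S.P p.1 (β.comp (inclM I p)))
        - (β (inclM I p (S.Z p.1)) • ddt I p - β (ddt I p) • inclM I p (S.Z p.1)))
    have h := S.P_skew p.1 (α.comp (inclM I p)) (β.comp (inclM I p))
    simp only [map_sub, map_smul, smul_eq_mul, ContinuousLinearMap.comp_apply] at h ⊢
    rw [h]
    ring
  · change S.σ p.1 (projM I p u) (projM I p v)
        + (S.ξ p.1 (projM I p u) * dt I p v - dt I p u * S.ξ p.1 (projM I p v))
      = -(S.σ p.1 (projM I p v) (projM I p u)
        + (S.ξ p.1 (projM I p v) * dt I p u - dt I p v * S.ξ p.1 (projM I p u)))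
    rw [S.σ_skew]
    ring

/-- A generalized almost para-contact structure is normal if the corresponding `M`-adapted
generalized almost para-complex structure on `M × ℝ` is Courant-integrable. -/
def IsNormal (S : GenAlmostParaContact I M) : Prop :=
  CourantIntegrable (I.prod 𝓘(ℝ, ℝ)) S.adapted

end GenAlmostParaContact

end ParaContact

end

/-! The Courant bracket is not tensorial, but the Courant-Nijenhuis torsion of an endomorphism `J`
that is skew for the pairing and satisfies `J² = 1` is: in a chart every derivative of the two
sections cancels, and what remains, paired with a third vector, is a sum of six terms `⟨(D_a J) b,
c⟩` with one entry moved by `J` (`courantForm_torsion`). Since vectors extend to smooth sections and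
the pairing is nondegenerate, integrability is the pointwise vanishing of this trilinear form
(`courantIntegrable_iff_torsionForm_eq_zero`).

For the adapted structure on `M × ℝ`, nothing depends on `t`, so the form at `(x, t)` is a
polynomial in the values and first derivatives at `x` of `(F, P, σ, Z, ξ)` (`torsionForm_adapted`).
Differentiating skewness and `J² = 1` shows that it is totally skew (`torsion_cyclic`,
`torsion_swap`). It therefore vanishes exactly when its components on `TM ⊕ T*M ⊕ ℝ d/dt ⊕ ℝ dt` do.
Two components vanish identically, and the other ten are, up to sign, the ten differential
conditions (`torsion_eq_zero_iff`): three covectors give `CondA1`; two covectors and a vector,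
`CondA2`; two vectors and a covector, `CondA3`; three vectors, `CondA4σ`; `d/dt` with two vectors
gives `CondA4ξ`, with a vector and a covector `CondA5Pξ`, with `dt` and a vector `CondA5ξ`; `dt`
with two vectors gives `CondA5σ`, with a vector and a covector `CondA5F`, with two covectors
`CondA5P`.

It remains to compute each condition of the theorem in a chart: the derivatives of the test fields
cancel, and the pointwise condition on the jet is left. The purely algebraic conditions hold for
every structure, being the blocks of `𝓕(ξ) = 0`, `𝓕(Z) = 0` and the formula for `𝓕²`. -/

open scoped Manifold ContDiff
open VectorField

noncomputable section

namespace ParaContact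

/-! ### Algebra of the torsion of the adapted structure at a point. -/

section Jet

variable (E : Type*) [NormedAddCommGroup E] [NormedSpace ℝ E]

/-- Generalized tangent vectors of `E × ℝ`: `((X, f), (α, g))` stands for
`X + f d/dt + α + g dt`. -/
abbrev SplitVector : Type _ := (E × ℝ) × ((E →L[ℝ] ℝ) × ℝ)

/-- The values and first derivatives at a point, in a chart, of the tensors `(F, P, σ, Z, ξ)`. -/
structure TensorJet where
  F : E →L[ℝ] E
  P : (E →L[ℝ] ℝ) →L[ℝ] E
  σ : E →L[ℝ] E →L[ℝ] ℝ
  Z : E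
  ξ : E →L[ℝ] ℝ
  DF : E →L[ℝ] E →L[ℝ] E
  DP : E →L[ℝ] (E →L[ℝ] ℝ) →L[ℝ] E
  Dσ : E →L[ℝ] E →L[ℝ] E →L[ℝ] ℝ
  DZ : E →L[ℝ] E
  Dξ : E →L[ℝ] E →L[ℝ] ℝ

variable {E}

namespace TensorJet

variable (j : TensorJet E)

/-- The adapted structure on `E × ℝ`. -/
def adaptedMap (a : SplitVector E) : SplitVector E :=
  ((j.F a.1.1 + j.P a.2.1 + a.2.2 • j.Z, -a.2.1 j.Z),
    (j.σ a.1.1 - a.2.1.comp j.F - a.1.2 • j.ξ, j.ξ a.1.1))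

/-- The covariant 3-tensor `(a, b, c) ↦ 2⟨(D_a J) b, c⟩`, with `J` the adapted structure. -/
def derivForm (a b c : SplitVector E) : ℝ :=
  c.2.1 (j.DF a.1.1 b.1.1) + c.2.1 (j.DP a.1.1 b.2.1) + b.2.2 * c.2.1 (j.DZ a.1.1)
    - c.2.2 * b.2.1 (j.DZ a.1.1) + j.Dσ a.1.1 b.1.1 c.1.1 - b.2.1 (j.DF a.1.1 c.1.1)
    - b.1.2 * j.Dξ a.1.1 c.1.1 + c.1.2 * j.Dξ a.1.1 b.1.1

/-- The covariant form of the Courant-Nijenhuis torsion of the adapted structure. -/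
def torsion (a b c : SplitVector E) : ℝ :=
  j.derivForm (j.adaptedMap a) b c + j.derivForm (j.adaptedMap b) c a
    + j.derivForm (j.adaptedMap c) a b + j.derivForm a b (j.adaptedMap c)
    + j.derivForm b (j.adaptedMap c) a + j.derivForm c (j.adaptedMap a) b

/-- The algebraic identities of a generalized almost para-contact structure, and the differentiated
ones. -/
structure IsParaContact : Prop where
  P_skew : ∀ α β : E →L[ℝ] ℝ, β (j.P α) = -α (j.P β)
  σ_skew : ∀ u v, j.σ u v = -j.σ v u
  ξ_Z : j.ξ j.Z = 1
  F_Z : j.F j.Z = 0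
  ξ_F : ∀ u, j.ξ (j.F u) = 0
  P_ξ : j.P j.ξ = 0
  σ_Z : j.σ j.Z = 0
  F_P : ∀ α, j.F (j.P α) = j.P (α.comp j.F)
  σ_F : ∀ u v, j.σ (j.F u) v = j.σ u (j.F v)
  F_F : ∀ u, j.F (j.F u) = u - j.P (j.σ u) - j.ξ u • j.Z
  DP_skew : ∀ (w : E) (α β : E →L[ℝ] ℝ), β (j.DP w α) = -α (j.DP w β)
  Dσ_skew : ∀ w u v, j.Dσ w u v = -j.Dσ w v u
  anticomm : ∀ a b c, j.derivForm a (j.adaptedMap b) c = j.derivForm a b (j.adaptedMap c)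

/-- This and the next nine definitions are what remains of the differential conditions at a point
once the derivatives of the test fields have cancelled. Given skewness of `DP`, `CondA1` is the
cyclic sum expressing the Jacobi identity for `P`. -/
def CondA1 : Prop := ∀ α β γ : E →L[ℝ] ℝ,
  γ (j.DP (j.P α) β) - γ (j.DP (j.P β) α) + β (j.DP (j.P γ) α) = 0

def CondA2 : Prop := ∀ (α β : E →L[ℝ] ℝ) (u : E),
  β (j.DP (j.F u) α) = β (j.DF (j.P α) u) + β (j.F (j.DP u α)) - α (j.DF (j.P β) u)
    + α (j.DF u (j.P β))

def CondA3 : Prop := ∀ (X Y : E) (γ : E →L[ℝ] ℝ),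
  γ (j.DF (j.F X) Y) - γ (j.DF (j.F Y) X) + γ (j.F (j.DF Y X)) - γ (j.F (j.DF X Y))
    = -(j.Dσ X Y (j.P γ) + j.Dσ Y (j.P γ) X + j.Dσ (j.P γ) X Y)
      + (j.Dξ X Y - j.Dξ Y X) * γ j.Z

def CondA4ξ : Prop := ∀ X Y : E,
  j.Dξ (j.F X) Y + j.ξ (j.DF Y X) - (j.Dξ (j.F Y) X + j.ξ (j.DF X Y)) = 0

def CondA4σ : Prop := ∀ u v w : E,
  (j.Dσ u (j.F v) w + j.σ (j.DF u v) w) + (j.Dσ v (j.F w) u + j.σ (j.DF v w) u)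
      + (j.Dσ w (j.F u) v + j.σ (j.DF w u) v)
    = (j.Dσ (j.F u) v w + j.Dσ v w (j.F u) + j.Dσ w (j.F u) v)
      + (j.Dσ u (j.F v) w + j.Dσ (j.F v) w u + j.Dσ w u (j.F v))
      + (j.Dσ u v (j.F w) + j.Dσ v (j.F w) u + j.Dσ (j.F w) u v)

def CondA5ξ : Prop := ∀ u : E, j.Dξ j.Z u + j.ξ (j.DZ u) = 0

def CondA5P : Prop := ∀ α β : E →L[ℝ] ℝ,
  β (j.DP j.Z α) + α (j.DZ (j.P β)) - β (j.DZ (j.P α)) = 0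

def CondA5F : Prop := ∀ u : E, j.DF j.Z u - j.DZ (j.F u) + j.F (j.DZ u) = 0

def CondA5σ : Prop := ∀ u v : E, j.Dσ j.Z u v + j.σ u (j.DZ v) + j.σ (j.DZ u) v = 0

def CondA5Pξ : Prop := ∀ (α : E →L[ℝ] ℝ) (u : E), j.Dξ (j.P α) u + j.ξ (j.DP u α) = 0

variable {j}

lemma derivForm_add_left (a a' b c : SplitVector E) :
    j.derivForm (a + a') b c = j.derivForm a b c + j.derivForm a' b c := by
  simp [derivForm]
  ring

lemma derivForm_add_mid (a b b' c : SplitVector E) :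
    j.derivForm a (b + b') c = j.derivForm a b c + j.derivForm a b' c := by
  simp [derivForm]
  ring

lemma derivForm_add_right (a b c c' : SplitVector E) :
    j.derivForm a b (c + c') = j.derivForm a b c + j.derivForm a b c' := by
  simp [derivForm]
  ring

lemma adaptedMap_add (a a' : SplitVector E) :
    j.adaptedMap (a + a') = j.adaptedMap a + j.adaptedMap a' := by
  ext <;> simp [adaptedMap, add_smul] <;> abel_nf

lemma torsion_add_left (a a' b c : SplitVector E) :
    j.torsion (a + a') b c = j.torsion a b c + j.torsion a' b c := by
  simp only [torsion, adaptedMap_add, derivForm_add_left, derivForm_add_mid, derivForm_add_right]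
  ring

/-- Homogeneity is needed only along `d/dt` and `dt`, which are tested on one generator each; the
vector and covector summands are tested on all their elements. -/
lemma torsion_ddt_smul_left (f : ℝ) (b c : SplitVector E) :
    j.torsion ((0, f), 0) b c = f * j.torsion ((0, 1), 0) b c := by
  simp [torsion, derivForm, adaptedMap]
  ring

lemma torsion_dt_smul_left (f : ℝ) (b c : SplitVector E) :
    j.torsion (0, (0, f)) b c = f * j.torsion (0, (0, 1)) b c := by
  simp [torsion, derivForm, adaptedMap]
  ring

namespace IsParaContact

lemma derivForm_skew (h : j.IsParaContact) (a b c : SplitVector E) :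
    j.derivForm a b c = -j.derivForm a c b := by
  simp only [derivForm]
  rw [h.DP_skew a.1.1 b.2.1 c.2.1, h.Dσ_skew a.1.1 b.1.1 c.1.1]
  ring

/-- The first three terms of the torsion are cyclic as they stand. In the other three, `anticomm`
moves `J` between the last two slots of `derivForm`, which matches them with their cyclic shift. -/
lemma torsion_cyclic (h : j.IsParaContact) (a b c : SplitVector E) :
    j.torsion a b c = j.torsion b c a := by
  simp only [torsion]
  linear_combination -h.anticomm a b c + h.anticomm b c a

lemma torsion_swap (h : j.IsParaContact) (a b c : SplitVector E) :
    j.torsion a b c = -j.torsion b a c := by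
  simp only [torsion]
  linear_combination h.derivForm_skew (j.adaptedMap a) b c + h.derivForm_skew (j.adaptedMap b) c a
    + h.derivForm_skew (j.adaptedMap c) a b + h.derivForm_skew a b (j.adaptedMap c)
    + h.derivForm_skew b (j.adaptedMap c) a + h.derivForm_skew c (j.adaptedMap a) b
    + h.anticomm c b a

/-- Here and in the next four lemmas an algebraic identity (`σ Z = 0`, `ξ ∘ F = 0`, `P ξ = 0`,
`σ(F·, ·) = σ(·, F·)`, `F P = P F*`) is differentiated. Each is one block of `anticomm`, reached by
inserting a vector, a covector, `dt` (with `J dt = Z`) or `d/dt` (with `J d/dt = -ξ`). -/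
lemma Dσ_Z (h : j.IsParaContact) (w u : E) : j.Dσ w j.Z u = j.σ u (j.DZ w) := by
  have := h.anticomm ((w, 0), 0) (0, (0, 1)) ((u, 0), 0)
  simp [derivForm, adaptedMap] at this
  linarith

lemma ξ_DF (h : j.IsParaContact) (w u : E) : j.ξ (j.DF w u) = -j.Dξ w (j.F u) := by
  have := h.anticomm ((w, 0), 0) ((0, 1), 0) ((u, 0), 0)
  simp [derivForm, adaptedMap] at this
  linarith

lemma DP_ξ (h : j.IsParaContact) (w : E) (β : E →L[ℝ] ℝ) :
    β (j.DP w j.ξ) = j.Dξ w (j.P β) := by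
  have := h.anticomm ((w, 0), 0) ((0, 1), 0) (0, (β, 0))
  simp [derivForm, adaptedMap] at this
  linarith

lemma Dσ_F (h : j.IsParaContact) (w u v : E) :
    j.Dσ w (j.F u) v - j.σ u (j.DF w v) = j.σ v (j.DF w u) + j.Dσ w u (j.F v) := by
  have := h.anticomm ((w, 0), 0) ((u, 0), 0) ((v, 0), 0)
  simp [derivForm, adaptedMap] at this
  linarith

lemma DF_P (h : j.IsParaContact) (w : E) (α β : E →L[ℝ] ℝ) :
    β (j.DF w (j.P α)) - β (j.DP w (α.comp j.F)) = -β (j.F (j.DP w α)) - α (j.DF w (j.P β)) := by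
  have := h.anticomm ((w, 0), 0) (0, (α, 0)) (0, (β, 0))
  simp [derivForm, adaptedMap] at this
  linarith

lemma torsion_ddt_dt_tangent (u : E) :
    j.torsion ((0, 1), 0) (0, (0, 1)) ((u, 0), 0) = j.Dξ j.Z u + j.ξ (j.DZ u) := by
  simp [torsion, derivForm, adaptedMap]

/-- Neither `d/dt`, `dt`, a covector, nor `J d/dt = -ξ` has a component along `E` to differentiate
in, and `DJ` has no block pairing a covector with `d/dt` or `d/dt` with `dt`. Hence no condition
arises; the same holds for `d/dt` with two covectors. -/
lemma torsion_ddt_dt_cotangent (α : E →L[ℝ] ℝ) :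
    j.torsion ((0, 1), 0) (0, (0, 1)) (0, (α, 0)) = 0 := by
  simp [torsion, derivForm, adaptedMap]

lemma torsion_ddt_tangent_tangent (h : j.IsParaContact) (u v : E) :
    j.torsion ((0, 1), 0) ((u, 0), 0) ((v, 0), 0)
      = j.Dξ (j.F u) v + j.ξ (j.DF v u) - (j.Dξ (j.F v) u + j.ξ (j.DF u v)) := by
  simp [torsion, derivForm, adaptedMap]
  linear_combination h.ξ_DF u v

lemma torsion_ddt_tangent_cotangent (h : j.IsParaContact) (u : E) (α : E →L[ℝ] ℝ) :
    j.torsion ((0, 1), 0) ((u, 0), 0) (0, (α, 0)) = - (j.Dξ (j.P α) u + j.ξ (j.DP u α)) := by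
  simp [torsion, derivForm, adaptedMap]
  linear_combination h.DP_skew u α j.ξ - h.DP_ξ u α

lemma torsion_ddt_cotangent_cotangent (α β : E →L[ℝ] ℝ) :
    j.torsion ((0, 1), 0) (0, (α, 0)) (0, (β, 0)) = 0 := by
  simp [torsion, derivForm, adaptedMap]

lemma torsion_dt_tangent_tangent (h : j.IsParaContact) (u v : E) :
    j.torsion (0, (0, 1)) ((u, 0), 0) ((v, 0), 0)
      = j.Dσ j.Z u v + j.σ u (j.DZ v) + j.σ (j.DZ u) v := by
  simp [torsion, derivForm, adaptedMap]
  linear_combination -h.σ_skew v (j.DZ u) + h.Dσ_Z v u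

lemma torsion_dt_tangent_cotangent (u : E) (α : E →L[ℝ] ℝ) :
    j.torsion (0, (0, 1)) ((u, 0), 0) (0, (α, 0))
      = α (j.DF j.Z u - j.DZ (j.F u) + j.F (j.DZ u)) := by
  simp [torsion, derivForm, adaptedMap]
  ring

lemma torsion_dt_cotangent_cotangent (α β : E →L[ℝ] ℝ) :
    j.torsion (0, (0, 1)) (0, (α, 0)) (0, (β, 0))
      = β (j.DP j.Z α) + α (j.DZ (j.P β)) - β (j.DZ (j.P α)) := by
  simp [torsion, derivForm, adaptedMap]
  ring

lemma torsion_tangent_tangent_tangent (h : j.IsParaContact) (u v w : E) :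
    j.torsion ((u, 0), 0) ((v, 0), 0) ((w, 0), 0) =
      ((j.Dσ (j.F u) v w + j.Dσ v w (j.F u) + j.Dσ w (j.F u) v)
      + (j.Dσ u (j.F v) w + j.Dσ (j.F v) w u + j.Dσ w u (j.F v))
      + (j.Dσ u v (j.F w) + j.Dσ v (j.F w) u + j.Dσ (j.F w) u v))
      - ((j.Dσ u (j.F v) w + j.σ (j.DF u v) w) + (j.Dσ v (j.F w) u + j.σ (j.DF v w) u)
      + (j.Dσ w (j.F u) v + j.σ (j.DF w u) v)) := by
  simp [torsion, derivForm, adaptedMap]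
  linear_combination h.Dσ_F v w u + h.Dσ_F w u v + h.σ_skew w (j.DF u v) + h.σ_skew u (j.DF v w)
    + h.σ_skew v (j.DF w u)

lemma torsion_tangent_tangent_cotangent (X Y : E) (γ : E →L[ℝ] ℝ) :
    j.torsion ((X, 0), 0) ((Y, 0), 0) (0, (γ, 0)) =
      γ (j.DF (j.F X) Y) - γ (j.DF (j.F Y) X) + γ (j.F (j.DF Y X)) - γ (j.F (j.DF X Y))
        - (-(j.Dσ X Y (j.P γ) + j.Dσ Y (j.P γ) X + j.Dσ (j.P γ) X Y)
        + (j.Dξ X Y - j.Dξ Y X) * γ j.Z) := by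
  simp [torsion, derivForm, adaptedMap]
  ring

lemma torsion_cotangent_cotangent_tangent (h : j.IsParaContact) (α β : E →L[ℝ] ℝ) (u : E) :
    j.torsion (0, (α, 0)) (0, (β, 0)) ((u, 0), 0) = β (j.DP (j.F u) α)
      - (β (j.DF (j.P α) u) + β (j.F (j.DP u α)) - α (j.DF (j.P β) u)
        + α (j.DF u (j.P β))) := by
  simp [torsion, derivForm, adaptedMap]
  linear_combination h.DF_P u α β

lemma torsion_cotangent_cotangent_cotangent (h : j.IsParaContact) (α β γ : E →L[ℝ] ℝ) :
    j.torsion (0, (α, 0)) (0, (β, 0)) (0, (γ, 0))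
      = γ (j.DP (j.P α) β) - γ (j.DP (j.P β) α) + β (j.DP (j.P γ) α) := by
  simp [torsion, derivForm, adaptedMap]
  linear_combination h.DP_skew (j.P β) γ α

lemma torsion_self_left (h : j.IsParaContact) (a c : SplitVector E) : j.torsion a a c = 0 := by
  linarith [h.torsion_swap a a c]

lemma torsion_self_right (h : j.IsParaContact) (a c : SplitVector E) : j.torsion c a a = 0 := by
  rw [h.torsion_cyclic, h.torsion_self_left]

/-- The torsion vanishes as soon as it vanishes on the summands of `TM ⊕ T*M ⊕ ℝ d/dt ⊕ ℝ dt`. -/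
lemma torsion_eq_zero_of_summands (h : j.IsParaContact)
    (hddt : ∀ b c, j.torsion ((0, 1), 0) b c = 0) (hdt : ∀ b c, j.torsion (0, (0, 1)) b c = 0)
    (hTTT : ∀ u v w, j.torsion ((u, 0), 0) ((v, 0), 0) ((w, 0), 0) = 0)
    (hTTC : ∀ u v γ, j.torsion ((u, 0), 0) ((v, 0), 0) (0, (γ, 0)) = 0)
    (hCCT : ∀ α β u, j.torsion (0, (α, 0)) (0, (β, 0)) ((u, 0), 0) = 0)
    (hCCC : ∀ α β γ, j.torsion (0, (α, 0)) (0, (β, 0)) (0, (γ, 0)) = 0) (a b c : SplitVector E) :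
    j.torsion a b c = 0 := by
  -- Once the `d/dt` and `dt` parts are known to contribute nothing, the first slot splits into its
  -- vector and covector parts. Cyclic rotation then applies this splitting to each slot in turn,
  -- leaving eight terms.
  have key : ∀ a b c, j.torsion a b c
      = j.torsion ((a.1.1, 0), 0) b c + j.torsion (0, (a.2.1, 0)) b c := by
    intro a b c
    have ha : a = ((a.1.1, 0), 0) + (0, (a.2.1, 0)) + ((0, a.1.2), 0) + (0, (0, a.2.2)) := by
      ext <;> simp
    conv_lhs => rw [ha]
    rw [torsion_add_left, torsion_add_left, torsion_add_left, torsion_ddt_smul_left,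
      torsion_dt_smul_left, hddt, hdt]
    ring
  have hTCT : ∀ u β w, j.torsion ((u, 0), 0) (0, (β, 0)) ((w, 0), 0) = 0 := fun u β w ↦ by
    rw [← h.torsion_cyclic, hTTC]
  have hCTT : ∀ α v w, j.torsion (0, (α, 0)) ((v, 0), 0) ((w, 0), 0) = 0 := fun u β w ↦ by
    rw [h.torsion_cyclic, hTTC]
  have hCTC : ∀ α v γ, j.torsion (0, (α, 0)) ((v, 0), 0) (0, (γ, 0)) = 0 := fun u β w ↦ by
    rw [← h.torsion_cyclic, hCCT]
  have hTCC : ∀ u β γ, j.torsion ((u, 0), 0) (0, (β, 0)) (0, (γ, 0)) = 0 := fun u β w ↦ by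
    rw [h.torsion_cyclic, hCCT]
  rw [key]
  simp only [h.torsion_cyclic _ b c]
  rw [key b, key b]
  simp only [h.torsion_cyclic _ c]
  rw [key c, key c, key c, key c]
  simp only [hTTT, hTTC, hCCT, hCCC, hTCT, hCTT, hCTC, hTCC, add_zero]

/-- Expansion of the vanishing of the torsion on a slot filled by `d/dt` or `dt`. -/
lemma torsion_eq_zero_of_summands_right (h : j.IsParaContact) (a : SplitVector E)
    (h₁ : j.torsion a ((0, 1), 0) (0, (0, 1)) = 0)
    (h₂ : ∀ u, j.torsion a ((0, 1), 0) ((u, 0), 0) = 0)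
    (h₃ : ∀ α, j.torsion a ((0, 1), 0) (0, (α, 0)) = 0)
    (h₄ : ∀ u, j.torsion a (0, (0, 1)) ((u, 0), 0) = 0)
    (h₅ : ∀ α, j.torsion a (0, (0, 1)) (0, (α, 0)) = 0)
    (h₆ : ∀ u v, j.torsion a ((u, 0), 0) ((v, 0), 0) = 0)
    (h₇ : ∀ u α, j.torsion a ((u, 0), 0) (0, (α, 0)) = 0)
    (h₈ : ∀ α β, j.torsion a (0, (α, 0)) (0, (β, 0)) = 0) (b c : SplitVector E) :
    j.torsion a b c = 0 := by
  -- Additivity is available in the first slot, so the second slot is rotated there before it is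
  -- expanded.
  have key : ∀ b c, j.torsion a b c = j.torsion a ((b.1.1, 0), 0) c + j.torsion a (0, (b.2.1, 0)) c
      + b.1.2 * j.torsion a ((0, 1), 0) c + b.2.2 * j.torsion a (0, (0, 1)) c := by
    intro b c
    have hb : b = ((b.1.1, 0), 0) + (0, (b.2.1, 0)) + ((0, b.1.2), 0) + (0, (0, b.2.2)) := by
      ext <;> simp
    conv_lhs => rw [hb]
    simp only [h.torsion_cyclic a]
    simp only [torsion_add_left]
    rw [torsion_ddt_smul_left, torsion_dt_smul_left]
  have swap : ∀ b c, j.torsion a b c = -j.torsion a c b := fun b c ↦ by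
    rw [h.torsion_cyclic, h.torsion_swap, ← h.torsion_cyclic, h.torsion_cyclic, ← h.torsion_cyclic]
  have h₉ : ∀ u α, j.torsion a (0, (α, 0)) ((u, 0), 0) = 0 := fun u α ↦ by
    rw [swap, h₇, neg_zero]
  have key' : ∀ b, (j.torsion a b ((0, 1), 0) = 0) → (j.torsion a b (0, (0, 1)) = 0) →
      (∀ u, j.torsion a b ((u, 0), 0) = 0) → (∀ α, j.torsion a b (0, (α, 0)) = 0) →
      ∀ c, j.torsion a b c = 0 := fun b k₁ k₂ k₃ k₄ c ↦ by
    rw [swap, key, swap _ b, swap _ b, swap _ b, swap _ b, k₁, k₂, k₃, k₄]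
    ring
  rw [key, key' _ ?_ ?_ (h₆ _) (h₇ _), key' _ ?_ ?_ (fun u ↦ h₉ u _) (h₈ _),
    key' _ (h.torsion_self_right _ _) h₁ h₂ h₃, key' _ ?_ (h.torsion_self_right _ _) h₄ h₅]
  · ring
  all_goals rw [swap]
  · rw [h₁, neg_zero]
  · rw [h₃, neg_zero]
  · rw [h₅, neg_zero]
  · rw [h₂, neg_zero]
  · rw [h₄, neg_zero]

/-- A totally skew trilinear form vanishes if and only if its components on unordered triples of
summands do; repeated `d/dt` or `dt` gives zero, and the component formulas above identify the rest.
-/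
theorem torsion_eq_zero_iff (h : j.IsParaContact) :
    (∀ a b c, j.torsion a b c = 0) ↔
      j.CondA1 ∧ j.CondA2 ∧ j.CondA3 ∧ j.CondA4ξ ∧ j.CondA4σ ∧ j.CondA5ξ ∧ j.CondA5P ∧ j.CondA5F
        ∧ j.CondA5σ ∧ j.CondA5Pξ := by
  constructor
  · intro H
    refine ⟨fun α β γ ↦ ?_, fun α β u ↦ ?_, fun X Y γ ↦ ?_, fun X Y ↦ ?_, fun u v w ↦ ?_, fun u ↦ ?_,
      fun α β ↦ ?_, fun u ↦ ?_, fun u v ↦ ?_, fun α u ↦ ?_⟩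
    · rw [← h.torsion_cotangent_cotangent_cotangent, H]
    · rw [← sub_eq_zero, ← h.torsion_cotangent_cotangent_tangent, H]
    · rw [← sub_eq_zero, ← torsion_tangent_tangent_cotangent, H]
    · rw [← h.torsion_ddt_tangent_tangent, H]
    · rw [eq_comm, ← sub_eq_zero, ← h.torsion_tangent_tangent_tangent, H]
    · rw [← torsion_ddt_dt_tangent, H]
    · rw [← torsion_dt_cotangent_cotangent, H]
    · refine SeparatingDual.eq_zero_of_forall_dual_eq_zero (R := ℝ) fun α ↦ ?_
      rw [← torsion_dt_tangent_cotangent, H]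
    · rw [← h.torsion_dt_tangent_tangent, H]
    · rw [← neg_eq_zero, ← h.torsion_ddt_tangent_cotangent, H]
  · rintro ⟨h1, h2, h3, h4ξ, h4σ, h5ξ, h5P, h5F, h5σ, h5Pξ⟩
    -- This component occurs both in the expansion with `d/dt` in front and, after a swap, in the
    -- one with `dt` in front.
    have hdd : ∀ u, j.torsion ((0, 1), 0) (0, (0, 1)) ((u, 0), 0) = 0 := fun u ↦ by
      rw [torsion_ddt_dt_tangent, h5ξ]
    apply h.torsion_eq_zero_of_summands
    · apply h.torsion_eq_zero_of_summands_right
      · exact h.torsion_self_left _ _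
      · exact fun u ↦ h.torsion_self_left _ _
      · exact fun u ↦ h.torsion_self_left _ _
      · exact hdd
      · exact torsion_ddt_dt_cotangent
      · exact fun u v ↦ by rw [h.torsion_ddt_tangent_tangent, h4ξ]
      · exact fun u v ↦ by rw [h.torsion_ddt_tangent_cotangent, h5Pξ, neg_zero]
      · exact torsion_ddt_cotangent_cotangent
    · apply h.torsion_eq_zero_of_summands_right
      · rw [h.torsion_swap, h.torsion_self_right, neg_zero]
      · exact fun u ↦ by rw [h.torsion_swap, hdd, neg_zero]
      · exact fun u ↦ by rw [h.torsion_swap, torsion_ddt_dt_cotangent, neg_zero]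
      · exact fun u ↦ h.torsion_self_left _ _
      · exact fun u ↦ h.torsion_self_left _ _
      · exact fun u v ↦ by rw [h.torsion_dt_tangent_tangent, h5σ]
      · exact fun u v ↦ by rw [torsion_dt_tangent_cotangent, h5F, map_zero]
      · exact fun u v ↦ by rw [torsion_dt_cotangent_cotangent, h5P]
    · exact fun u v w ↦ by rw [h.torsion_tangent_tangent_tangent, h4σ, sub_self]
    · exact fun u v w ↦ by rw [torsion_tangent_tangent_cotangent, h3, sub_self]
    · exact fun u v w ↦ by rw [h.torsion_cotangent_cotangent_tangent, h2 u v w, sub_self]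
    · exact fun u v w ↦ by rw [h.torsion_cotangent_cotangent_cotangent, h1]

end IsParaContact

end TensorJet
end Jet

/-! ### The Courant bracket and the torsion on a vector space. -/

section FlatCourant

variable {V : Type*} [NormedAddCommGroup V] [NormedSpace ℝ V]

/-- Twice the natural pairing on `V ⊕ V*`. -/
def dualPairing (a b : V × (V →L[ℝ] ℝ)) : ℝ := b.2 a.1 + a.2 b.1

lemma dualPairing_comm (a b : V × (V →L[ℝ] ℝ)) : dualPairing a b = dualPairing b a :=
  add_comm _ _

lemma dualPairing_add_left (a a' b : V × (V →L[ℝ] ℝ)) :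
    dualPairing (a + a') b = dualPairing a b + dualPairing a' b := by
  simp [dualPairing]
  ring

lemma dualPairing_sub_left (a a' b : V × (V →L[ℝ] ℝ)) :
    dualPairing (a - a') b = dualPairing a b - dualPairing a' b := by
  simp [dualPairing]
  ring

lemma dualPairing_neg_left (a b : V × (V →L[ℝ] ℝ)) : dualPairing (-a) b = -dualPairing a b := by
  simp [dualPairing]
  ring

lemma dualPairing_add_right (a b b' : V × (V →L[ℝ] ℝ)) :
    dualPairing a (b + b') = dualPairing a b + dualPairing a b' := by
  simp [dualPairing]
  ring

lemma dualPairing_neg_right (a b : V × (V →L[ℝ] ℝ)) : dualPairing a (-b) = -dualPairing a b := by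
  simp [dualPairing]
  ring

lemma eq_zero_of_dualPairing {a : V × (V →L[ℝ] ℝ)} (h : ∀ b, dualPairing a b = 0) : a = 0 := by
  refine Prod.ext ?_ ?_
  · refine SeparatingDual.eq_zero_of_forall_dual_eq_zero (R := ℝ) fun β ↦ ?_
    simpa [dualPairing] using h (0, β)
  · ext v
    simpa [dualPairing] using h (v, 0)

/-- The Courant bracket of two sections of `V ⊕ V*` with values `e₁, e₂` and derivatives `D₁, D₂`
at a point, paired with `e₃`. -/
def courantForm (e₁ e₂ : V × (V →L[ℝ] ℝ)) (D₁ D₂ : V →L[ℝ] V × (V →L[ℝ] ℝ))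
    (e₃ : V × (V →L[ℝ] ℝ)) : ℝ :=
  e₃.2 ((D₂ e₁.1).1 - (D₁ e₂.1).1)
    + ((D₂ e₁.1).2 e₃.1 + e₂.2 (D₁ e₃.1).1 - ((D₁ e₂.1).2 e₃.1 + e₁.2 (D₂ e₃.1).1)
      - (1 / 2) * ((D₂ e₃.1).2 e₁.1 + e₂.2 (D₁ e₃.1).1 - ((D₁ e₃.1).2 e₂.1 + e₁.2 (D₂ e₃.1).1)))

/-- Written with the pairing alone, the bracket can be transformed by skewness of `J` without
separating vectors from covectors. -/
lemma courantForm_eq (e₁ e₂ : V × (V →L[ℝ] ℝ)) (D₁ D₂ : V →L[ℝ] V × (V →L[ℝ] ℝ))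
    (e₃ : V × (V →L[ℝ] ℝ)) :
    courantForm e₁ e₂ D₁ D₂ e₃ = dualPairing (D₂ e₁.1) e₃ - dualPairing (D₁ e₂.1) e₃
      + (1 / 2) * (dualPairing (D₁ e₃.1) e₂ - dualPairing e₁ (D₂ e₃.1)) := by
  simp only [courantForm, dualPairing, map_sub]
  ring

/-- The Courant-Nijenhuis torsion of a skew `J` with `J² = 1` is tensorial, and is the cyclic sum
below of the derivative of `J`. -/
lemma courantForm_torsion (J : V × (V →L[ℝ] ℝ) →L[ℝ] V × (V →L[ℝ] ℝ))
    (DJ : V →L[ℝ] V × (V →L[ℝ] ℝ) →L[ℝ] V × (V →L[ℝ] ℝ))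
    (hJJ : ∀ a, J (J a) = a) (hJ : ∀ a b, dualPairing (J a) b = -dualPairing a (J b))
    (hDJJ : ∀ w a, DJ w (J a) = -J (DJ w a))
    (hDJ : ∀ w a b, dualPairing (DJ w a) b = -dualPairing a (DJ w b))
    (e₁ e₂ e₃ : V × (V →L[ℝ] ℝ)) (D₁ D₂ : V →L[ℝ] V × (V →L[ℝ] ℝ)) :
    courantForm (J e₁) (J e₂) (J.comp D₁ + DJ.flip e₁) (J.comp D₂ + DJ.flip e₂) e₃
      + courantForm (J e₁) e₂ (J.comp D₁ + DJ.flip e₁) D₂ (J e₃)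
      + courantForm e₁ (J e₂) D₁ (J.comp D₂ + DJ.flip e₂) (J e₃)
      + courantForm e₁ e₂ D₁ D₂ e₃
    = dualPairing (DJ (J e₁).1 e₂) e₃ + dualPairing (DJ (J e₂).1 e₃) e₁
      + dualPairing (DJ (J e₃).1 e₁) e₂ + dualPairing (DJ e₁.1 e₂) (J e₃)
      + dualPairing (DJ e₂.1 (J e₃)) e₁ + dualPairing (DJ e₃.1 (J e₁)) e₂ := by
  simp only [courantForm_eq, add_apply, ContinuousLinearMap.comp_apply,
    ContinuousLinearMap.flip_apply, map_add, dualPairing_add_left, dualPairing_add_right,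
    dualPairing_neg_left, hJ, hJJ, hDJJ]
  -- The terms in `D₁` and `D₂` cancel in pairs, by `⟨J u, v⟩ = -⟨u, J v⟩` and `⟨J u, J v⟩ = -⟨u,
  -- v⟩`. The surviving terms in `DJ` agree with the right-hand side up to skewness of `DJ`, its
  -- anticommutation with `J` and symmetry of the pairing, supplied by these six instances.
  have h₁ := hDJ (J e₂).1 e₃ e₁
  have h₂ := hDJ (J e₃).1 e₁ e₂
  have h₃ := hDJ e₃.1 e₁ (J e₂)
  have h₄ := hDJ e₂.1 e₁ (J e₃)
  have h₅ := dualPairing_comm e₃ (DJ (J e₂).1 e₁)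
  have h₆ := dualPairing_comm (DJ e₂.1 e₃) (J e₁)
  simp only [hDJJ, hJ, dualPairing_neg_right] at h₁ h₂ h₃ h₄ h₅ h₆
  linarith

end FlatCourant

/-! ### Tensor fields read in the preferred chart. -/

section ChartReading

open Filter Topology

variable {E : Type*} [NormedAddCommGroup E] [NormedSpace ℝ E]
  {H : Type*} [TopologicalSpace H] (I : ModelWithCorners ℝ E H)
  {M : Type*} [TopologicalSpace M] [ChartedSpace H M]

/-- The differential at `z` of the preferred chart at `x₀`. -/
def chartDerivAt (x₀ z : M) : TangentSpace I z →L[ℝ] E :=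
  mfderiv I 𝓘(ℝ, E) (extChartAt I x₀) z

/-- The vector field `X` read in the preferred chart at `x₀`. -/
def chartVectorField (X : Π x : M, TangentSpace I x) (x₀ : M) (y : E) : E :=
  chartDerivAt I x₀ ((extChartAt I x₀).symm y) (X ((extChartAt I x₀).symm y))

/-- The endomorphism `F` read in the preferred chart at `x₀`. -/
def chartEndomorphism (F : Π x : M, TangentSpace I x →L[ℝ] TangentSpace I x) (x₀ : M) (y : E) :
    E →L[ℝ] E :=
  (chartDerivAt I x₀ ((extChartAt I x₀).symm y)).comp
    ((F ((extChartAt I x₀).symm y)).comp (chartSymmDeriv I x₀ y))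

/-- The bundle map `P : T*M → TM` read in the preferred chart at `x₀`. -/
def chartSharp (P : Π x : M, Cotangent I x →L[ℝ] TangentSpace I x) (x₀ : M) (y : E) :
    (E →L[ℝ] ℝ) →L[ℝ] E :=
  (chartDerivAt I x₀ ((extChartAt I x₀).symm y)).comp
    ((P ((extChartAt I x₀).symm y)).comp
      (ContinuousLinearMap.precomp ℝ (chartDerivAt I x₀ ((extChartAt I x₀).symm y))))

variable [IsManifold I ∞ M]

lemma chartDerivAt_chartSymmDeriv {x₀ : M} {y : E} (hy : y ∈ (extChartAt I x₀).target) (v : E) :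
    chartDerivAt I x₀ ((extChartAt I x₀).symm y) (chartSymmDeriv I x₀ y v) = v := by
  have : IsManifold I 1 M := .of_le (n := ∞) (by simp)
  exact congrArg (fun L : E →L[ℝ] E ↦ L v)
    (mfderiv_extChartAt_comp_mfderivWithin_extChartAt_symm (I := I) hy)

lemma chartSymmDeriv_chartDerivAt {x₀ : M} {y : E} (hy : y ∈ (extChartAt I x₀).target)
    (v : TangentSpace I ((extChartAt I x₀).symm y)) :
    chartSymmDeriv I x₀ y (chartDerivAt I x₀ ((extChartAt I x₀).symm y) v) = v := by
  have : IsManifold I 1 M := .of_le (n := ∞) (by simp)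
  exact congrArg (fun L : E →L[ℝ] E ↦ L v)
    (mfderivWithin_extChartAt_symm_comp_mfderiv_extChartAt (I := I) hy)

/-- The tangent space at `x` is the model space `E`, identified through the preferred chart at `x`,
so that chart has identity differential at `x`. For this reason the chart readings below take the
value of the original tensor at the base point. -/
lemma chartDeriv_eq (x : M) (v : E) : chartDeriv I x v = v := by
  have : IsManifold I 1 M := .of_le (n := ∞) (by simp)
  exact congrArg (fun L : E →L[ℝ] E ↦ L v) (mfderiv_extChartAt_self (I := I) (x := x))

lemma chartSymmDeriv_self (x : M) (v : E) :
    chartSymmDeriv I x (extChartAt I x x) v = (v : E) := by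
  have : IsManifold I 1 M := .of_le (n := ∞) (by simp)
  exact congrArg (fun L : E →L[ℝ] E ↦ L v) (mfderivWithin_range_extChartAt_symm (I := I) (x := x))

lemma chartDerivAt_self (x z : M) (hz : z = x) (v : E) : chartDerivAt I x z v = v := by
  subst hz
  exact chartDeriv_eq I z v

lemma chartVectorField_self (X : Π x : M, TangentSpace I x) (x : M) :
    chartVectorField I X x (extChartAt I x x) = X x := by
  -- Going to the chart and back returns `x` only up to a propositional equality, and the fibres
  -- depend on the point. The claim is therefore generalized to a variable `z = x`; the other base
  -- point lemmas do the same.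
  have : ∀ z, z = x → chartDerivAt I x z (X z) = X x := by
    rintro _ rfl
    exact chartDeriv_eq I _ _
  exact this _ (extChartAt_to_inv x)

lemma chartOneForm_self (α : Π x : M, Cotangent I x) (x : M) :
    chartOneForm I α x (extChartAt I x x) = α x := by
  have : ∀ z, z = x → ∀ v : E, α z v = α x v := by
    rintro _ rfl _
    rfl
  ext v
  refine Eq.trans ?_ (this _ (extChartAt_to_inv (I := I) x) v)
  exact congrArg (α _) (chartSymmDeriv_self I x v)

lemma chartEndomorphism_self (F : Π x : M, TangentSpace I x →L[ℝ] TangentSpace I x) (x : M) :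
    chartEndomorphism I F x (extChartAt I x x) = F x := by
  have : ∀ z, z = x → ∀ v : E, chartDerivAt I x z (F z v) = F x v := by
    rintro _ rfl _
    exact chartDeriv_eq I _ _
  ext v
  refine Eq.trans ?_ (this _ (extChartAt_to_inv (I := I) x) v)
  exact congrArg (fun w ↦ chartDerivAt I x _ (F _ w)) (chartSymmDeriv_self I x v)

lemma chartSharp_self (P : Π x : M, Cotangent I x →L[ℝ] TangentSpace I x) (x : M) :
    chartSharp I P x (extChartAt I x x) = P x := by
  have : ∀ z, z = x → ∀ α : E →L[ℝ] ℝ,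
      chartDerivAt I x z (P z (α.comp (chartDerivAt I x z))) = P x α := by
    rintro z rfl α
    refine (chartDeriv_eq I _ _).trans (congrArg (P z) ?_)
    ext v
    exact congrArg α (chartDeriv_eq I z v)
  ext α
  exact this _ (extChartAt_to_inv (I := I) x) α

lemma chartTwoForm_self (σ : Π x : M, TangentSpace I x →L[ℝ] Cotangent I x) (x : M) :
    chartTwoForm I σ x (extChartAt I x x) = σ x := by
  have : ∀ z, z = x → ∀ u v : E, σ z u v = σ x u v := by
    rintro _ rfl _ _
    rfl
  ext u v
  refine Eq.trans ?_ (this _ (extChartAt_to_inv (I := I) x) u v)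
  refine (congrArg (σ _ _) (chartSymmDeriv_self I x v)).trans ?_
  exact congrArg (fun w ↦ σ _ w _) (chartSymmDeriv_self I x u)

/-! ### Readings of contractions -/

lemma chartVectorField_endomorphism {x₀ : M} {y : E} (hy : y ∈ (extChartAt I x₀).target)
    (F : Π x : M, TangentSpace I x →L[ℝ] TangentSpace I x) (X : Π x : M, TangentSpace I x) :
    chartVectorField I (fun z ↦ F z (X z)) x₀ y
      = chartEndomorphism I F x₀ y (chartVectorField I X x₀ y) :=
  congrArg (fun w ↦ chartDerivAt I x₀ _ (F _ w)) (chartSymmDeriv_chartDerivAt I hy (X _)).symm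

lemma chartVectorField_sharp {x₀ : M} {y : E} (hy : y ∈ (extChartAt I x₀).target)
    (P : Π x : M, Cotangent I x →L[ℝ] TangentSpace I x) (α : Π x : M, Cotangent I x) :
    chartVectorField I (fun z ↦ P z (α z)) x₀ y
      = chartSharp I P x₀ y (chartOneForm I α x₀ y) := by
  refine congrArg (fun w ↦ chartDerivAt I x₀ _ (P _ w)) ?_
  ext v
  exact congrArg (α _) (chartSymmDeriv_chartDerivAt I hy v).symm

lemma chartOneForm_flat {x₀ : M} {y : E} (hy : y ∈ (extChartAt I x₀).target)
    (σ : Π x : M, TangentSpace I x →L[ℝ] Cotangent I x) (X : Π x : M, TangentSpace I x) :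
    chartOneForm I (fun z ↦ σ z (X z)) x₀ y
      = chartTwoForm I σ x₀ y (chartVectorField I X x₀ y) := by
  ext v
  exact congrArg (fun w ↦ σ _ w _) (chartSymmDeriv_chartDerivAt I hy (X _)).symm

lemma chartOneForm_comp {x₀ : M} {y : E} (hy : y ∈ (extChartAt I x₀).target)
    (α : Π x : M, Cotangent I x) (F : Π x : M, TangentSpace I x →L[ℝ] TangentSpace I x) :
    chartOneForm I (fun z ↦ (α z).comp (F z)) x₀ y
      = (chartOneForm I α x₀ y).comp (chartEndomorphism I F x₀ y) := by
  ext v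
  exact congrArg (α _) (chartSymmDeriv_chartDerivAt I hy (F _ _)).symm

lemma chartTwoForm_comp {x₀ : M} {y : E} (hy : y ∈ (extChartAt I x₀).target)
    (σ : Π x : M, TangentSpace I x →L[ℝ] Cotangent I x)
    (F : Π x : M, TangentSpace I x →L[ℝ] TangentSpace I x) :
    chartTwoForm I (fun z ↦ (σ z).comp (F z)) x₀ y
      = (chartTwoForm I σ x₀ y).comp (chartEndomorphism I F x₀ y) := by
  ext u v
  exact congrArg (fun w ↦ σ _ w _) (chartSymmDeriv_chartDerivAt I hy (F _ _)).symm

lemma chartOneForm_apply_chartVectorField {x₀ : M} {y : E} (hy : y ∈ (extChartAt I x₀).target)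
    (α : Π x : M, Cotangent I x) (X : Π x : M, TangentSpace I x) :
    α ((extChartAt I x₀).symm y) (X ((extChartAt I x₀).symm y))
      = chartOneForm I α x₀ y (chartVectorField I X x₀ y) :=
  congrArg (α _) (chartSymmDeriv_chartDerivAt I hy (X _)).symm

end ChartReading

/-! ### Lie brackets, Lie derivatives and exterior derivatives in terms of chart derivatives. -/

section ChartDerivative

open Filter Topology

variable {E : Type*} [NormedAddCommGroup E] [NormedSpace ℝ E]
  {H : Type*} [TopologicalSpace H] (I : ModelWithCorners ℝ E H)
  {M : Type*} [TopologicalSpace M] [ChartedSpace H M]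

lemma mvfderiv_eq_of_hasFDerivAt {f : M → ℝ} {x : M} {D : E →L[ℝ] ℝ}
    (hf : HasFDerivAt (fun y ↦ f ((extChartAt I x).symm y)) D (extChartAt I x x)) :
    mvfderiv I f x = D := by
  -- Manifold differentiability includes continuity of `f` itself, which is recovered from that of
  -- its reading by composing with the chart.
  have hc : ContinuousAt f x := by
    have h₁ : ContinuousAt ((fun y ↦ f ((extChartAt I x).symm y)) ∘ extChartAt I x) x :=
      hf.continuousAt.comp (continuousAt_extChartAt x)
    refine h₁.congr ?_
    filter_upwards [extChartAt_source_mem_nhds (I := I) x] with z hz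
    exact congrArg f ((extChartAt I x).left_inv hz)
  have : HasMFDerivAt I 𝓘(ℝ, ℝ) f x D := ⟨hc, hf.hasFDerivWithinAt⟩
  exact this.mfderiv

variable [I.Boundaryless]

lemma extDerivOne_apply_of_hasFDerivAt [IsManifold I ∞ M] {α : Π x : M, Cotangent I x} {x : M}
    {D : E →L[ℝ] E →L[ℝ] ℝ} (hα : HasFDerivAt (chartOneForm I α x) D (extChartAt I x x))
    (u v : E) : extDerivOne I α x u v = D u v - D v u := by
  have h : fderivWithin ℝ (chartOneForm I α x) (Set.range I) (extChartAt I x x) = D := by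
    rw [I.range_eq_univ, fderivWithin_univ, hα.fderiv]
  change (fderivWithin ℝ (chartOneForm I α x) (Set.range I) (extChartAt I x x))
      (chartDeriv I x u) (chartDeriv I x v)
    - (fderivWithin ℝ (chartOneForm I α x) (Set.range I) (extChartAt I x x))
      (chartDeriv I x v) (chartDeriv I x u) = _
  rw [h, chartDeriv_eq, chartDeriv_eq]

lemma extDerivTwo_apply_of_hasFDerivAt [IsManifold I ∞ M]
    {σ : Π x : M, TangentSpace I x →L[ℝ] Cotangent I x} {x : M}
    {D : E →L[ℝ] E →L[ℝ] E →L[ℝ] ℝ} (hσ : HasFDerivAt (chartTwoForm I σ x) D (extChartAt I x x))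
    (u v w : E) : extDerivTwo I σ x u v w = D u v w + D v w u + D w u v := by
  have h : fderivWithin ℝ (chartTwoForm I σ x) (Set.range I) (extChartAt I x x) = D := by
    rw [I.range_eq_univ, fderivWithin_univ, hσ.fderiv]
  change (fderivWithin ℝ (chartTwoForm I σ x) (Set.range I) (extChartAt I x x))
      (chartDeriv I x u) (chartDeriv I x v) (chartDeriv I x w)
    + (fderivWithin ℝ (chartTwoForm I σ x) (Set.range I) (extChartAt I x x))
      (chartDeriv I x v) (chartDeriv I x w) (chartDeriv I x u)
    + (fderivWithin ℝ (chartTwoForm I σ x) (Set.range I) (extChartAt I x x))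
      (chartDeriv I x w) (chartDeriv I x u) (chartDeriv I x v) = _
  rw [h, chartDeriv_eq, chartDeriv_eq, chartDeriv_eq]

variable [IsManifold I ∞ M]

/-- The bracket is the flat bracket of the pullbacks under the inverse chart. These are the chart
readings near the base point because the differentials of the chart and of its inverse are mutually
inverse, and the final pull-back is trivial since the chart has identity differential at `x`. -/
lemma mlieBracket_eq_of_hasFDerivAt {X Y : Π x : M, TangentSpace I x} {x : M} {DX DY : E →L[ℝ] E}
    (hX : HasFDerivAt (chartVectorField I X x) DX (extChartAt I x x))
    (hY : HasFDerivAt (chartVectorField I Y x) DY (extChartAt I x x)) :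
    mlieBracket I X Y x = DY (X x) - DX (Y x) := by
  have : IsManifold I 1 M := .of_le (n := ∞) (by simp)
  have key : ∀ X : Π x : M, TangentSpace I x,
      mpullbackWithin 𝓘(ℝ, E) I (extChartAt I x).symm X (Set.range I)
        =ᶠ[𝓝 (extChartAt I x x)] chartVectorField I X x := by
    intro X
    filter_upwards [extChartAt_target_mem_nhds (I := I) x] with y hy
    have hinv := isInvertible_mfderivWithin_extChartAt_symm (I := I) hy
    obtain ⟨e, he⟩ := hinv
    rw [mpullbackWithin_apply, ← he, ContinuousLinearMap.inverse_equiv]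
    have h₁ := chartSymmDeriv_chartDerivAt I hy (X ((extChartAt I x).symm y))
    exact (ContinuousLinearEquiv.symm_apply_eq e).2
      (h₁.symm.trans (congrArg (fun L : E →L[ℝ] E ↦ L _) he.symm))
  have flat : ∀ (V W V' W' : E → E) (s : Set E) (y : E), s = Set.univ → V =ᶠ[𝓝 y] V' →
      W =ᶠ[𝓝 y] W' → lieBracketWithin ℝ V W s y = fderiv ℝ W' y (V' y) - fderiv ℝ V' y (W' y) := by
    rintro V W V' W' s y rfl hV hW
    rw [lieBracketWithin_univ, hV.lieBracket_vectorField_eq hW, lieBracket_eq]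
  have inv : ∀ L : E →L[ℝ] E, L = ContinuousLinearMap.id ℝ E → ∀ v, L.inverse v = v := by
    rintro L rfl v
    simp
  have h₁ : mlieBracket I X Y x = (mfderiv I 𝓘(ℝ, E) (extChartAt I x) x).inverse
      ((lieBracketWithin ℝ
        (mpullbackWithin 𝓘(ℝ, E) I (extChartAt I x).symm X (Set.range I))
        (mpullbackWithin 𝓘(ℝ, E) I (extChartAt I x).symm Y (Set.range I))
        ((extChartAt I x).symm ⁻¹' Set.univ ∩ Set.range I)) (extChartAt I x x)) :=
    mlieBracketWithin_apply
  have h₂ : (lieBracketWithin ℝ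
        (mpullbackWithin 𝓘(ℝ, E) I (extChartAt I x).symm X (Set.range I))
        (mpullbackWithin 𝓘(ℝ, E) I (extChartAt I x).symm Y (Set.range I))
        ((extChartAt I x).symm ⁻¹' Set.univ ∩ Set.range I)) (extChartAt I x x)
      = DY (X x) - DX (Y x) := by
    refine (flat _ _ _ _ _ _ (by simp [I.range_eq_univ]) (key X) (key Y)).trans ?_
    rw [hX.fderiv, hY.fderiv, chartVectorField_self, chartVectorField_self]
  rw [h₁, h₂]
  exact inv _ mfderiv_extChartAt_self _

variable {I}

/-! ### Derivatives of contractions -/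

variable {x : M} {F : Π x : M, TangentSpace I x →L[ℝ] TangentSpace I x}
  {P : Π x : M, Cotangent I x →L[ℝ] TangentSpace I x}
  {σ : Π x : M, TangentSpace I x →L[ℝ] Cotangent I x} {X : Π x : M, TangentSpace I x}
  {α : Π x : M, Cotangent I x} {DF : E →L[ℝ] E →L[ℝ] E} {DP : E →L[ℝ] (E →L[ℝ] ℝ) →L[ℝ] E}
  {Dσ : E →L[ℝ] E →L[ℝ] E →L[ℝ] ℝ} {DX : E →L[ℝ] E} {Dα : E →L[ℝ] E →L[ℝ] ℝ}

/-- Leibniz rule for a contraction. The value of the tensor enters as `F₀`, typed over the model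
space, so that the derivative is a composition of maps of `E` and not of fibres; `P₀` and `σ₀` play
the same role below. -/
lemma hasFDerivAt_chartVectorField_endomorphism
    {F₀ : E →L[ℝ] E} (h₀ : F₀ = F x)
    (hF : HasFDerivAt (chartEndomorphism I F x) DF (extChartAt I x x))
    (hX : HasFDerivAt (chartVectorField I X x) DX (extChartAt I x x)) :
    HasFDerivAt (chartVectorField I (fun y ↦ F y (X y)) x)
      (F₀.comp DX + DF.flip (X x)) (extChartAt I x x) := by
  subst h₀
  have h := hF.clm_apply hX
  rw [chartEndomorphism_self, chartVectorField_self] at h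
  refine h.congr_of_eventuallyEq ?_
  filter_upwards [extChartAt_target_mem_nhds (I := I) x] with y hy
  exact chartVectorField_endomorphism I hy F X

lemma hasFDerivAt_chartVectorField_sharp
    {P₀ : (E →L[ℝ] ℝ) →L[ℝ] E} (h₀ : P₀ = P x)
    (hP : HasFDerivAt (chartSharp I P x) DP (extChartAt I x x))
    (hα : HasFDerivAt (chartOneForm I α x) Dα (extChartAt I x x)) :
    HasFDerivAt (chartVectorField I (fun y ↦ P y (α y)) x)
      (P₀.comp Dα + DP.flip (α x)) (extChartAt I x x) := by
  subst h₀
  have h := hP.clm_apply hα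
  rw [chartSharp_self, chartOneForm_self] at h
  refine h.congr_of_eventuallyEq ?_
  filter_upwards [extChartAt_target_mem_nhds (I := I) x] with y hy
  exact chartVectorField_sharp I hy P α

lemma hasFDerivAt_chartOneForm_flat
    {σ₀ : E →L[ℝ] E →L[ℝ] ℝ} (h₀ : σ₀ = σ x)
    (hσ : HasFDerivAt (chartTwoForm I σ x) Dσ (extChartAt I x x))
    (hX : HasFDerivAt (chartVectorField I X x) DX (extChartAt I x x)) :
    HasFDerivAt (chartOneForm I (fun y ↦ σ y (X y)) x)
      (σ₀.comp DX + Dσ.flip (X x)) (extChartAt I x x) := by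
  subst h₀
  have h := hσ.clm_apply hX
  rw [chartTwoForm_self, chartVectorField_self] at h
  refine h.congr_of_eventuallyEq ?_
  filter_upwards [extChartAt_target_mem_nhds (I := I) x] with y hy
  exact chartOneForm_flat I hy σ X

lemma hasFDerivAt_chartOneForm_comp
    (hα : HasFDerivAt (chartOneForm I α x) Dα (extChartAt I x x))
    (hF : HasFDerivAt (chartEndomorphism I F x) DF (extChartAt I x x)) :
    HasFDerivAt (chartOneForm I (fun y ↦ (α y).comp (F y)) x)
      ((ContinuousLinearMap.compL ℝ E E ℝ (α x)).comp DF
        + ((ContinuousLinearMap.compL ℝ E E ℝ).flip (F x)).comp Dα) (extChartAt I x x) := by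
  have h := hα.clm_comp hF
  rw [chartEndomorphism_self, chartOneForm_self] at h
  refine h.congr_of_eventuallyEq ?_
  filter_upwards [extChartAt_target_mem_nhds (I := I) x] with y hy
  exact chartOneForm_comp I hy α F

lemma hasFDerivAt_chartTwoForm_comp
    (hσ : HasFDerivAt (chartTwoForm I σ x) Dσ (extChartAt I x x))
    (hF : HasFDerivAt (chartEndomorphism I F x) DF (extChartAt I x x)) :
    HasFDerivAt (chartTwoForm I (fun y ↦ (σ y).comp (F y)) x)
      ((ContinuousLinearMap.compL ℝ E E (E →L[ℝ] ℝ) (σ x)).comp DF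
        + ((ContinuousLinearMap.compL ℝ E E (E →L[ℝ] ℝ)).flip (F x)).comp Dσ)
      (extChartAt I x x) := by
  have h := hσ.clm_comp hF
  rw [chartEndomorphism_self, chartTwoForm_self] at h
  refine h.congr_of_eventuallyEq ?_
  filter_upwards [extChartAt_target_mem_nhds (I := I) x] with y hy
  exact chartTwoForm_comp I hy σ F

lemma mvfderiv_apply_of_hasFDerivAt
    (hα : HasFDerivAt (chartOneForm I α x) Dα (extChartAt I x x))
    (hX : HasFDerivAt (chartVectorField I X x) DX (extChartAt I x x)) (u : E) :
    mvfderiv I (fun y ↦ α y (X y)) x u = Dα u (X x) + α x (DX u) := by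
  have h := hα.clm_apply hX
  rw [chartVectorField_self, chartOneForm_self] at h
  have h' := h.congr_of_eventuallyEq (f₁ := fun y ↦ α ((extChartAt I x).symm y)
    (X ((extChartAt I x).symm y))) (by
      filter_upwards [extChartAt_target_mem_nhds (I := I) x] with y hy
      exact chartOneForm_apply_chartVectorField I hy α X)
  have h'' := mvfderiv_eq_of_hasFDerivAt I (f := fun y ↦ α y (X y)) h'
  exact (congrArg (fun L : E →L[ℝ] ℝ ↦ L u) h'').trans (add_comm _ _)

/-- In Cartan's formula the term `Dα u X` of `d(α(X))` cancels against the one in `dα(X, u)`. -/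
lemma lieOneForm_apply_of_hasFDerivAt
    (hX : HasFDerivAt (chartVectorField I X x) DX (extChartAt I x x))
    (hα : HasFDerivAt (chartOneForm I α x) Dα (extChartAt I x x)) (u : E) :
    lieOneForm I X α x u = Dα (X x) u + α x (DX u) := by
  have h₁ := extDerivOne_apply_of_hasFDerivAt I hα (X x) u
  have h₂ := mvfderiv_apply_of_hasFDerivAt hα hX u
  change extDerivOne I α x (X x) u + mvfderiv I (fun y ↦ α y (X y)) x u = _
  rw [h₁, h₂]
  ring

end ChartDerivative

/-! ### Differentiability of chart readings and extension of vectors to smooth sections. -/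

section Smoothness

open Filter Topology Bundle FiberBundle

variable {E : Type*} [NormedAddCommGroup E] [NormedSpace ℝ E]
  {H : Type*} [TopologicalSpace H] {I : ModelWithCorners ℝ E H}
  {M : Type*} [TopologicalSpace M] [ChartedSpace H M]

lemma differentiableAt_comp_extChartAt_symm [I.Boundaryless] {G : Type*} [NormedAddCommGroup G]
    [NormedSpace ℝ G] {g : M → G} {x : M} (hg : ContMDiffAt I 𝓘(ℝ, G) ∞ g x) :
    DifferentiableAt ℝ (fun y ↦ g ((extChartAt I x).symm y)) (extChartAt I x x) := by
  have h := (hg.mdifferentiableAt (by simp)).differentiableWithinAt_writtenInExtChartAt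
  rw [I.range_eq_univ, differentiableWithinAt_univ] at h
  exact h

lemma eventually_symm_mem_chartAt_source [I.Boundaryless] (x : M) :
    ∀ᶠ y in 𝓝 (extChartAt I x x), y ∈ (extChartAt I x).target ∧
      (extChartAt I x).symm y ∈ (chartAt H x).source := by
  filter_upwards [extChartAt_target_mem_nhds (I := I) x] with y hy
  refine ⟨hy, ?_⟩
  rw [← extChartAt_source I]
  exact (extChartAt I x).map_target hy

variable [IsManifold I ∞ M]

lemma continuousLinearMapAt_eq_chartDerivAt {x z : M} (hz : z ∈ (chartAt H x).source) (v : E) :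
    (trivializationAt E (TangentSpace I) x).continuousLinearMapAt ℝ z v = chartDerivAt I x z v := by
  have : IsManifold I 1 M := .of_le (n := ∞) (by simp)
  exact congrArg (fun L : E →L[ℝ] E ↦ L v) (TangentBundle.continuousLinearMapAt_trivializationAt hz)

lemma symmL_eq_chartSymmDeriv {x : M} {y : E} (hy : y ∈ (extChartAt I x).target) (v : E) :
    (trivializationAt E (TangentSpace I) x).symmL ℝ ((extChartAt I x).symm y) v
      = chartSymmDeriv I x y v := by
  have : IsManifold I 1 M := .of_le (n := ∞) (by simp)
  have hz : (extChartAt I x).symm y ∈ (chartAt H x).source := by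
    rw [← extChartAt_source I]
    exact (extChartAt I x).map_target hy
  have h := TangentBundle.symmL_trivializationAt (I := I) hz
  have h' : ∀ y', y' = y → (mfderivWithin 𝓘(ℝ, E) I (extChartAt I x).symm (Set.range I) y' : E →L[ℝ] E) v
      = (chartSymmDeriv I x y : E →L[ℝ] E) v := by
    rintro _ rfl
    rfl
  exact (congrArg (fun L : E →L[ℝ] E ↦ L v) h).trans (h' _ ((extChartAt I x).right_inv hy))

/-- Smoothness of a section is smoothness of its coordinates in the trivialization at `x`, and for
the tangent bundle that trivialization is the differential of the chart. The coordinates thus agree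
with the chart reading near `x`; the other tensor types go through the hom-bundle in the same way.
-/
lemma SmoothVectorField.differentiableAt [I.Boundaryless] {X : Π x : M, TangentSpace I x}
    (hX : SmoothVectorField I X) (x : M) :
    DifferentiableAt ℝ (chartVectorField I X x) (extChartAt I x x) := by
  have h := (contMDiffAt_section x).1 (hX x)
  refine (differentiableAt_comp_extChartAt_symm h).congr_of_eventuallyEq ?_
  filter_upwards [eventually_symm_mem_chartAt_source (I := I) x] with y hy
  have := continuousLinearMapAt_eq_chartDerivAt (I := I) hy.2 (X ((extChartAt I x).symm y))
  refine this.symm.trans ?_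
  rw [Trivialization.continuousLinearMapAt_apply, Trivialization.linearMapAt_apply]
  exact if_pos hy.2

lemma SmoothEndomorphism.differentiableAt [I.Boundaryless]
    {F : Π x : M, TangentSpace I x →L[ℝ] TangentSpace I x}
    (hF : SmoothEndomorphism I F) (x : M) :
    DifferentiableAt ℝ (chartEndomorphism I F x) (extChartAt I x x) := by
  have h := ((contMDiffAt_hom_bundle _).1 (hF x)).2
  refine (differentiableAt_comp_extChartAt_symm h).congr_of_eventuallyEq ?_
  filter_upwards [eventually_symm_mem_chartAt_source (I := I) x] with y hy
  ext v
  refine (continuousLinearMapAt_eq_chartDerivAt (I := I) hy.2 _).symm.trans ?_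
  exact congrArg (fun w ↦ (trivializationAt E (TangentSpace I) x).continuousLinearMapAt ℝ
    ((extChartAt I x).symm y) (F _ w)) (symmL_eq_chartSymmDeriv hy.1 v).symm

lemma inCoordinates_cotangent {z : M} (a : Cotangent I z) (x : M) (v : E) :
    ContinuousLinearMap.inCoordinates E (TangentSpace I) ℝ (fun _ : M ↦ ℝ) x z x z a v
      = a ((trivializationAt E (TangentSpace I) x).symmL ℝ z v) := by
  simp [ContinuousLinearMap.inCoordinates]

lemma SmoothOneForm.differentiableAt [I.Boundaryless] {α : Π x : M, Cotangent I x}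
    (hα : SmoothOneForm I α) (x : M) :
    DifferentiableAt ℝ (chartOneForm I α x) (extChartAt I x x) := by
  have h := ((contMDiffAt_hom_bundle _).1 (hα x)).2
  refine (differentiableAt_comp_extChartAt_symm h).congr_of_eventuallyEq ?_
  filter_upwards [eventually_symm_mem_chartAt_source (I := I) x] with y hy
  ext v
  have h₁ := inCoordinates_cotangent (α ((extChartAt I x).symm y)) x v
  exact (h₁.trans (congrArg (α _) (symmL_eq_chartSymmDeriv hy.1 v))).symm

lemma SmoothFlat.differentiableAt [I.Boundaryless]
    {σ : Π x : M, TangentSpace I x →L[ℝ] Cotangent I x} (hσ : SmoothFlat I σ) (x : M) :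
    DifferentiableAt ℝ (chartTwoForm I σ x) (extChartAt I x x) := by
  have h := ((contMDiffAt_hom_bundle _).1 (hσ x)).2
  refine (differentiableAt_comp_extChartAt_symm h).congr_of_eventuallyEq ?_
  filter_upwards [eventually_symm_mem_chartAt_source (I := I) x] with y hy
  ext u v
  have hb : (extChartAt I x).symm y ∈ (trivializationAt E (TangentSpace I : M → Type _) x).baseSet := hy.2
  have h₁ := inCoordinates_apply_eq₂ (𝕜 := ℝ) (F₃ := ℝ) (E₃ := fun _ : M ↦ ℝ) (ϕ := σ ((extChartAt I x).symm y)) (v := u) (w := v)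
    hb hb (Set.mem_univ _)
  refine Eq.trans ?_ h₁.symm
  have h₃ : ∀ r : ℝ, (trivializationAt ℝ (fun _ : M ↦ ℝ) x).linearMapAt ℝ
      ((extChartAt I x).symm y) r = r := fun r ↦
    congrArg (fun L : ℝ →ₗ[ℝ] ℝ ↦ L r) (Bundle.Trivial.linearMapAt_trivialization ℝ M ℝ _)
  refine Eq.trans ?_ (h₃ _).symm
  have h₂ : ∀ v : E, chartSymmDeriv I x y v
      = (trivializationAt E (TangentSpace I) x).symm ((extChartAt I x).symm y) v := fun v ↦
    (symmL_eq_chartSymmDeriv hy.1 v).symm.trans (Trivialization.symmL_apply _ hb v)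
  refine (congrArg (σ _ _) (h₂ v)).trans ?_
  exact congrArg (fun w ↦ σ _ w _) (h₂ u)

lemma SmoothSharp.differentiableAt [I.Boundaryless]
    {P : Π x : M, Cotangent I x →L[ℝ] TangentSpace I x} (hP : SmoothSharp I P) (x : M) :
    DifferentiableAt ℝ (chartSharp I P x) (extChartAt I x x) := by
  have h := ((contMDiffAt_hom_bundle _).1 (hP x)).2
  refine (differentiableAt_comp_extChartAt_symm h).congr_of_eventuallyEq ?_
  filter_upwards [eventually_symm_mem_chartAt_source (I := I) x] with y hy
  ext α
  refine (continuousLinearMapAt_eq_chartDerivAt (I := I) hy.2 _).symm.trans ?_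
  refine congrArg (fun w ↦ (trivializationAt E (TangentSpace I) x).continuousLinearMapAt ℝ
    ((extChartAt I x).symm y) (P _ w)) ?_
  have hb : (extChartAt I x).symm y ∈
      (trivializationAt (E →L[ℝ] ℝ) (fun x : M ↦ TangentSpace I x →L[ℝ] ℝ) x).baseSet :=
    ⟨hy.2, Set.mem_univ _⟩
  set β : Cotangent I ((extChartAt I x).symm y) :=
    α.comp (chartDerivAt I x ((extChartAt I x).symm y))
  -- The inverse trivialization of `T*M` should be precomposition with the differential of the
  -- chart. This is checked by trivializing `α ∘ dφ` and finding `α` again.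
  have h₁ : (trivializationAt (E →L[ℝ] ℝ) (fun x : M ↦ TangentSpace I x →L[ℝ] ℝ) x).continuousLinearMapAt
      ℝ _ β = α := by
    rw [Trivialization.continuousLinearMapAt_apply, Trivialization.linearMapAt_apply, if_pos hb]
    ext v
    refine (inCoordinates_cotangent β x v).trans ?_
    refine (congrArg β (symmL_eq_chartSymmDeriv hy.1 v)).trans ?_
    exact congrArg α (chartDerivAt_chartSymmDeriv I hy.1 v)
  have h₂ := (trivializationAt (E →L[ℝ] ℝ) (fun x : M ↦ TangentSpace I x →L[ℝ] ℝ) x).symmL_continuousLinearMapAt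
     (R := ℝ) hb β
  rw [h₁] at h₂
  exact h₂.symm

/-! ### Extension of vectors to smooth sections -/

lemma exists_contMDiff_section_eq [FiniteDimensional ℝ E] [T2Space M] {F : Type*}
    [NormedAddCommGroup F] [NormedSpace ℝ F] {V : M → Type*} [TopologicalSpace (TotalSpace F V)]
    [∀ x, AddCommGroup (V x)] [∀ x, Module ℝ (V x)] [∀ x, TopologicalSpace (V x)]
    [FiberBundle F V] [VectorBundle ℝ F V] [ContMDiffVectorBundle ∞ F V I] {x : M} (v : V x) :
    ∃ s : Π x, V x, ContMDiff I (I.prod 𝓘(ℝ, F)) ∞ (fun x ↦ TotalSpace.mk' F x (s x)) ∧ s x = v := by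
  obtain ⟨u, hu, hs⟩ := exists_contMDiffOn_extend (k := ∞) I F v
  obtain ⟨u', hu', hu'o, hxu'⟩ := mem_nhds_iff.1 hu
  obtain ⟨f, -, hf⟩ := (SmoothBumpFunction.nhds_basis_tsupport (I := I) x).mem_iff.1
    (hu'o.mem_nhds hxu')
  -- A bump function equal to `1` at `x`, with topological support where the local extension is
  -- smooth, makes the extension global.
  refine ⟨(f : M → ℝ) • FiberBundle.extend F v, ?_, ?_⟩
  · exact f.contMDiff.contMDiffOn.smul_section_of_tsupport hu'o hf (hs.mono hu')
  · simp

lemma exists_smoothVectorField_eq [FiniteDimensional ℝ E] [T2Space M] {x : M}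
    (v : TangentSpace I x) : ∃ X : Π x : M, TangentSpace I x, SmoothVectorField I X ∧ X x = v :=
  exists_contMDiff_section_eq v

lemma exists_smoothOneForm_eq [FiniteDimensional ℝ E] [T2Space M] {x : M}
    (a : Cotangent I x) : ∃ α : Π x : M, Cotangent I x, SmoothOneForm I α ∧ α x = a :=
  exists_contMDiff_section_eq (F := E →L[ℝ] ℝ) (V := fun x : M ↦ TangentSpace I x →L[ℝ] ℝ) a

end Smoothness

/-! ### Differentiating skewness and `J² = 1`. -/

section FlatCourantDerivative

open Filter Topology

variable {V : Type*} [NormedAddCommGroup V] [NormedSpace ℝ V]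

/-- `dualPairing` against a fixed second argument, as a continuous linear form. -/
def dualPairingLeft (b : V × (V →L[ℝ] ℝ)) : V × (V →L[ℝ] ℝ) →L[ℝ] ℝ :=
  b.2.comp (ContinuousLinearMap.fst ℝ V (V →L[ℝ] ℝ))
    + (ContinuousLinearMap.apply ℝ ℝ b.1).comp (ContinuousLinearMap.snd ℝ V (V →L[ℝ] ℝ))

@[simp] lemma dualPairingLeft_apply (a b : V × (V →L[ℝ] ℝ)) :
    dualPairingLeft b a = dualPairing a b := rfl

lemma fderiv_anticomm_of_involutive {J : V → V × (V →L[ℝ] ℝ) →L[ℝ] V × (V →L[ℝ] ℝ)} {y : V}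
    {DJ : V →L[ℝ] V × (V →L[ℝ] ℝ) →L[ℝ] V × (V →L[ℝ] ℝ)} (hJ : HasFDerivAt J DJ y)
    (h : ∀ᶠ z in 𝓝 y, ∀ a, J z (J z a) = a) (w : V) (a : V × (V →L[ℝ] ℝ)) :
    DJ w (J y a) = -J y (DJ w a) := by
  have h₁ := hJ.clm_apply (hJ.clm_apply (hasFDerivAt_const a y))
  have h₂ : HasFDerivAt (fun z ↦ J z (J z a)) (0 : V →L[ℝ] V × (V →L[ℝ] ℝ)) y :=
    (hasFDerivAt_const a y).congr_of_eventuallyEq (h.mono fun z hz ↦ hz a)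
  have h₃ := congrArg (fun L ↦ L w) (h₁.unique h₂)
  simp only [add_apply, ContinuousLinearMap.comp_apply, ContinuousLinearMap.flip_apply,
    zero_apply, map_zero, zero_add] at h₃
  exact eq_neg_of_add_eq_zero_right h₃

lemma fderiv_skew_of_skew {J : V → V × (V →L[ℝ] ℝ) →L[ℝ] V × (V →L[ℝ] ℝ)} {y : V}
    {DJ : V →L[ℝ] V × (V →L[ℝ] ℝ) →L[ℝ] V × (V →L[ℝ] ℝ)} (hJ : HasFDerivAt J DJ y)
    (h : ∀ᶠ z in 𝓝 y, ∀ a b, dualPairing (J z a) b = -dualPairing a (J z b)) (w : V)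
    (a b : V × (V →L[ℝ] ℝ)) : dualPairing (DJ w a) b = -dualPairing a (DJ w b) := by
  have h₁ : ∀ a b, HasFDerivAt (fun z ↦ dualPairing (J z a) b)
      ((dualPairingLeft b).comp (DJ.flip a)) y := fun a b ↦ by
    have := (dualPairingLeft b).hasFDerivAt.comp y (hJ.clm_apply (hasFDerivAt_const a y))
    exact this.congr_fderiv (by simp)
  have h₂ := (h₁ b a).neg.congr_of_eventuallyEq (f₁ := fun z ↦ dualPairing (J z a) b)
    (h.mono fun z hz ↦ by simp only [hz a b, dualPairing_comm _ a]; rfl)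
  have h₃ := congrArg (fun L ↦ L w) ((h₁ a b).unique h₂)
  rw [dualPairing_comm a]
  exact h₃

end FlatCourantDerivative

/-! ### Courant integrability as a pointwise condition on a manifold. -/

section ManifoldCourant

open Filter Topology

variable {E : Type*} [NormedAddCommGroup E] [NormedSpace ℝ E]
  {H : Type*} [TopologicalSpace H] {I : ModelWithCorners ℝ E H}
  {M : Type*} [TopologicalSpace M] [ChartedSpace H M]

variable (I) in
/-- The section `e` of `TM ⊕ T*M` read in the preferred chart at `x₀`. -/
def chartSection (e : Π x : M, BigTangent I x) (x₀ : M) (y : E) : E × (E →L[ℝ] ℝ) :=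
  (chartVectorField I (fun z ↦ (e z).1) x₀ y, chartOneForm I (fun z ↦ (e z).2) x₀ y)

variable (I) in
/-- The endomorphism `J` of `TM ⊕ T*M` read in the preferred chart at `x₀`. -/
def chartBigEndomorphism (J : Π x : M, BigTangent I x →L[ℝ] BigTangent I x) (x₀ : M) (y : E) :
    E × (E →L[ℝ] ℝ) →L[ℝ] E × (E →L[ℝ] ℝ) :=
  ((chartDerivAt I x₀ ((extChartAt I x₀).symm y)).prodMap
      (ContinuousLinearMap.precomp ℝ (chartSymmDeriv I x₀ y))).comp
    ((J ((extChartAt I x₀).symm y)).comp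
      ((chartSymmDeriv I x₀ y).prodMap
        (ContinuousLinearMap.precomp ℝ (chartDerivAt I x₀ ((extChartAt I x₀).symm y)))))

/-- The maps used on the two sides of `J` are transposes of each other for the pairing, by
construction. Hence no inverse relation between them is needed, and skewness holds for every `y`,
even outside the chart target, unlike involutivity. -/
lemma chartBigEndomorphism_skew (x₀ : M) (y : E)
    {J : Π x : M, BigTangent I x →L[ℝ] BigTangent I x}
    (hJ : ∀ x e₁ e₂, pairing I (J x e₁) e₂ + pairing I e₁ (J x e₂) = 0)
    (a b : E × (E →L[ℝ] ℝ)) :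
    dualPairing (chartBigEndomorphism I J x₀ y a) b
      = -dualPairing a (chartBigEndomorphism I J x₀ y b) := by
  set z := (extChartAt I x₀).symm y
  set lift : E × (E →L[ℝ] ℝ) → BigTangent I z := fun a ↦
    (chartSymmDeriv I x₀ y a.1, a.2.comp (chartDerivAt I x₀ z)) with hlift
  have h := hJ z (lift a) (lift b)
  have key : ∀ a b, dualPairing (chartBigEndomorphism I J x₀ y a) b
      = 2 * pairing I (J z (lift a)) (lift b) := by
    intro a b
    have : dualPairing (chartBigEndomorphism I J x₀ y a) b
      = (lift b).2 (J z (lift a)).1 + (J z (lift a)).2 (lift b).1 := rfl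
    rw [this, pairing]
    ring
  have comm : pairing I (lift a) (J z (lift b)) = pairing I (J z (lift b)) (lift a) := by
    rw [pairing, pairing, add_comm]
  rw [dualPairing_comm a, key, key]
  linarith

variable [IsManifold I ∞ M]

lemma chartSection_self (e : Π x : M, BigTangent I x) (x : M) :
    chartSection I e x (extChartAt I x x) = e x :=
  Prod.ext (chartVectorField_self I (fun z ↦ (e z).1) x) (chartOneForm_self I (fun z ↦ (e z).2) x)

lemma chartBigEndomorphism_self (J : Π x : M, BigTangent I x →L[ℝ] BigTangent I x) (x : M) :
    chartBigEndomorphism I J x (extChartAt I x x) = J x := by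
  have key : ∀ z, z = x → ∀ a b : E × (E →L[ℝ] ℝ), a = b → (J z a : E × (E →L[ℝ] ℝ)) = J x b := by
    rintro _ rfl _ _ rfl
    rfl
  have hz := extChartAt_to_inv (I := I) x
  refine ContinuousLinearMap.ext fun a ↦ ?_
  have ha : ((chartSymmDeriv I x (extChartAt I x x) a.1 : E),
      (a.2.comp (chartDerivAt I x ((extChartAt I x).symm (extChartAt I x x))) : E →L[ℝ] ℝ)) = a := by
    refine Prod.ext (chartSymmDeriv_self I x a.1) ?_
    ext v
    exact congrArg a.2 (chartDerivAt_self I x _ hz v)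
  refine Eq.trans ?_ (key _ hz _ _ ha)
  refine Prod.ext (chartDerivAt_self I x _ hz _) ?_
  refine ContinuousLinearMap.ext fun v ↦ ?_
  exact congrArg (J _ _).2 (chartSymmDeriv_self I x v)

lemma chartSection_endomorphism {x₀ : M} {y : E} (hy : y ∈ (extChartAt I x₀).target)
    (J : Π x : M, BigTangent I x →L[ℝ] BigTangent I x) (e : Π x : M, BigTangent I x) :
    chartSection I (fun z ↦ J z (e z)) x₀ y
      = chartBigEndomorphism I J x₀ y (chartSection I e x₀ y) := by
  have h : ((chartSymmDeriv I x₀ y (chartVectorField I (fun z ↦ (e z).1) x₀ y)),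
      ((chartOneForm I (fun z ↦ (e z).2) x₀ y).comp
        (chartDerivAt I x₀ ((extChartAt I x₀).symm y)))) = e ((extChartAt I x₀).symm y) := by
    refine Prod.ext (chartSymmDeriv_chartDerivAt I hy _) ?_
    refine ContinuousLinearMap.ext fun v ↦ ?_
    exact congrArg (e _).2 (chartSymmDeriv_chartDerivAt I hy v)
  have h' := congrArg (J ((extChartAt I x₀).symm y)) h
  refine Prod.ext ?_ ?_
  · exact congrArg (fun w ↦ chartDerivAt I x₀ _ (Prod.fst w)) h'.symm
  · refine ContinuousLinearMap.ext fun v ↦ ?_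
    exact congrArg (fun w ↦ (Prod.snd w) (chartSymmDeriv I x₀ y v)) h'.symm

lemma chartBigEndomorphism_involutive {x₀ : M} {y : E} (hy : y ∈ (extChartAt I x₀).target)
    {J : Π x : M, BigTangent I x →L[ℝ] BigTangent I x} (hJ : ∀ x e, J x (J x e) = e)
    (a : E × (E →L[ℝ] ℝ)) :
    chartBigEndomorphism I J x₀ y (chartBigEndomorphism I J x₀ y a) = a := by
  set z := (extChartAt I x₀).symm y
  set b : BigTangent I z := (chartSymmDeriv I x₀ y a.1, a.2.comp (chartDerivAt I x₀ z))
  have h : ((chartSymmDeriv I x₀ y (chartDerivAt I x₀ z (J z b).1)),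
      ((J z b).2.comp (chartSymmDeriv I x₀ y)).comp (chartDerivAt I x₀ z)) = J z b := by
    refine Prod.ext (chartSymmDeriv_chartDerivAt I hy _) ?_
    refine ContinuousLinearMap.ext fun v ↦ ?_
    exact congrArg (J z b).2 (chartSymmDeriv_chartDerivAt I hy v)
  have h' : J z _ = b := (congrArg (J z) h).trans (hJ z b)
  refine Prod.ext ?_ ?_
  · exact (congrArg (fun w ↦ chartDerivAt I x₀ z (Prod.fst w)) h').trans
      (chartDerivAt_chartSymmDeriv I hy a.1)
  · refine ContinuousLinearMap.ext fun v ↦ ?_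
    exact (congrArg (fun w ↦ (Prod.snd w) (chartSymmDeriv I x₀ y v)) h').trans
      (congrArg a.2 (chartDerivAt_chartSymmDeriv I hy v))

lemma exists_smoothSection_eq [FiniteDimensional ℝ E] [T2Space M] {x : M} (a : BigTangent I x) :
    ∃ e : Π x : M, BigTangent I x, SmoothSection I e ∧ e x = a := by
  obtain ⟨X, hX, hXx⟩ := exists_smoothVectorField_eq (I := I) a.1
  obtain ⟨α, hα, hαx⟩ := exists_smoothOneForm_eq (I := I) a.2
  exact ⟨fun x ↦ (X x, α x), ⟨hX, hα⟩, Prod.ext hXx hαx⟩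

variable [I.Boundaryless]

lemma dualPairing_courantBracket {e₁ e₂ : Π x : M, BigTangent I x} {x : M}
    {D₁ D₂ : E →L[ℝ] E × (E →L[ℝ] ℝ)}
    (h₁ : HasFDerivAt (chartSection I e₁ x) D₁ (extChartAt I x x))
    (h₂ : HasFDerivAt (chartSection I e₂ x) D₂ (extChartAt I x x)) {a b : E × (E →L[ℝ] ℝ)}
    (ha : a = e₁ x) (hb : b = e₂ x) (e₃ : E × (E →L[ℝ] ℝ)) :
    dualPairing (V := E) (courantBracket I e₁ e₂ x) e₃ = courantForm a b D₁ D₂ e₃ := by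
  subst ha hb
  have h₁X : HasFDerivAt (chartVectorField I (fun z ↦ (e₁ z).1) x) _ (extChartAt I x x) := h₁.fst
  have h₂X : HasFDerivAt (chartVectorField I (fun z ↦ (e₂ z).1) x) _ (extChartAt I x x) := h₂.fst
  have h₁α : HasFDerivAt (chartOneForm I (fun z ↦ (e₁ z).2) x) _ (extChartAt I x x) := h₁.snd
  have h₂α : HasFDerivAt (chartOneForm I (fun z ↦ (e₂ z).2) x) _ (extChartAt I x x) := h₂.snd
  have hb := mlieBracket_eq_of_hasFDerivAt I h₁X h₂X
  have hl₁ := lieOneForm_apply_of_hasFDerivAt h₁X h₂α e₃.1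
  have hl₂ := lieOneForm_apply_of_hasFDerivAt h₂X h₁α e₃.1
  have hd := (h₂α.clm_apply h₁X).sub (h₁α.clm_apply h₂X)
  rw [chartVectorField_self, chartVectorField_self, chartOneForm_self, chartOneForm_self] at hd
  have hd' := hd.congr_of_eventuallyEq (f₁ := fun y ↦
    (fun z ↦ (e₂ z).2 (e₁ z).1 - (e₁ z).2 (e₂ z).1) ((extChartAt I x).symm y)) (by
      filter_upwards [extChartAt_target_mem_nhds (I := I) x] with y hy
      exact congrArg₂ (· - ·)
        (chartOneForm_apply_chartVectorField I hy (fun z ↦ (e₂ z).2) (fun z ↦ (e₁ z).1))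
        (chartOneForm_apply_chartVectorField I hy (fun z ↦ (e₁ z).2) (fun z ↦ (e₂ z).1)))
  have hm := congrArg (fun L : E →L[ℝ] ℝ ↦ L e₃.1) (mvfderiv_eq_of_hasFDerivAt I
    (f := fun z ↦ (e₂ z).2 (e₁ z).1 - (e₁ z).2 (e₂ z).1) (x := x) hd')
  have hb' := congrArg e₃.2 hb
  change e₃.2 (mlieBracket I (fun y ↦ (e₁ y).1) (fun y ↦ (e₂ y).1) x)
    + (lieOneForm I (fun y ↦ (e₁ y).1) (fun y ↦ (e₂ y).2) x e₃.1
      - lieOneForm I (fun y ↦ (e₂ y).1) (fun y ↦ (e₁ y).2) x e₃.1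
      - (1 / 2 : ℝ) * mvfderiv I (fun y ↦ (e₂ y).2 (e₁ y).1 - (e₁ y).2 (e₂ y).1) x e₃.1) = _
  refine (congrArg₂ (· + ·) hb' (congrArg₂ (· - ·) (congrArg₂ (· - ·) hl₁ hl₂)
    (congrArg (fun r ↦ (1 / 2 : ℝ) * r) hm))).trans ?_
  have flat : ∀ a b : E × (E →L[ℝ] ℝ),
      e₃.2 ((D₂ a.1).1 - (D₁ b.1).1) + ((D₂ a.1).2 e₃.1 + b.2 (D₁ e₃.1).1
        - ((D₁ b.1).2 e₃.1 + a.2 (D₂ e₃.1).1)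
        - (1 / 2 : ℝ) * (b.2 (D₁ e₃.1).1 + (D₂ e₃.1).2 a.1
          - (a.2 (D₂ e₃.1).1 + (D₁ e₃.1).2 b.1))) = courantForm a b D₁ D₂ e₃ := by
    intro a b
    simp only [courantForm]
    ring
  exact flat (e₁ x) (e₂ x)

lemma dualPairing_courantBracket_torsion
    {J : Π x : M, BigTangent I x →L[ℝ] BigTangent I x} (hJJ : ∀ x e, J x (J x e) = e)
    (hJ : ∀ x e₁ e₂, pairing I (J x e₁) e₂ + pairing I e₁ (J x e₂) = 0)
    {e₁ e₂ : Π x : M, BigTangent I x} {x : M} {D₁ D₂ : E →L[ℝ] E × (E →L[ℝ] ℝ)}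
    {J₀ : E × (E →L[ℝ] ℝ) →L[ℝ] E × (E →L[ℝ] ℝ)} (hJ₀ : J₀ = J x)
    {DJ : E →L[ℝ] E × (E →L[ℝ] ℝ) →L[ℝ] E × (E →L[ℝ] ℝ)}
    (hDJ : HasFDerivAt (chartBigEndomorphism I J x) DJ (extChartAt I x x))
    (h₁ : HasFDerivAt (chartSection I e₁ x) D₁ (extChartAt I x x))
    (h₂ : HasFDerivAt (chartSection I e₂ x) D₂ (extChartAt I x x)) (a b e₃ : E × (E →L[ℝ] ℝ))
    (ha : a = e₁ x) (hb : b = e₂ x) :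
    dualPairing (V := E) (courantBracket I (fun y ↦ J y (e₁ y)) (fun y ↦ J y (e₂ y)) x
      - J x (courantBracket I (fun y ↦ J y (e₁ y)) e₂ x
          + courantBracket I e₁ (fun y ↦ J y (e₂ y)) x)
      + courantBracket I e₁ e₂ x) e₃
    = dualPairing (DJ (J₀ a).1 b) e₃ + dualPairing (DJ (J₀ b).1 e₃) a
      + dualPairing (DJ (J₀ e₃).1 a) b + dualPairing (DJ a.1 b) (J₀ e₃)
      + dualPairing (DJ b.1 (J₀ e₃)) a + dualPairing (DJ e₃.1 (J₀ a)) b := by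
  have hself : chartBigEndomorphism I J x (extChartAt I x x) = J₀ :=
    (chartBigEndomorphism_self J x).trans hJ₀.symm
  have hinv : ∀ᶠ y in 𝓝 (extChartAt I x x), ∀ a,
      chartBigEndomorphism I J x y (chartBigEndomorphism I J x y a) = a := by
    filter_upwards [extChartAt_target_mem_nhds (I := I) x] with y hy
    exact chartBigEndomorphism_involutive hy hJJ
  have hskew : ∀ᶠ y in 𝓝 (extChartAt I x x), ∀ a b,
      dualPairing (chartBigEndomorphism I J x y a) b
        = -dualPairing a (chartBigEndomorphism I J x y b) :=
    .of_forall fun y ↦ chartBigEndomorphism_skew x y hJ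
  have hDJJ := fderiv_anticomm_of_involutive hDJ hinv
  have hDskew := fderiv_skew_of_skew hDJ hskew
  have hJJ₀ := hinv.self_of_nhds
  have hJskew₀ := hskew.self_of_nhds
  rw [hself] at hDJJ hJJ₀ hJskew₀
  have app : ∀ {e : Π x : M, BigTangent I x} {D : E →L[ℝ] E × (E →L[ℝ] ℝ)} (c : E × (E →L[ℝ] ℝ)),
      c = e x → HasFDerivAt (chartSection I e x) D (extChartAt I x x) →
      HasFDerivAt (chartSection I (fun y ↦ J y (e y)) x) (J₀.comp D + DJ.flip c)
        (extChartAt I x x) := by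
    intro e D c hc he
    have h := hDJ.clm_apply he
    rw [hself, chartSection_self, ← hc] at h
    refine h.congr_of_eventuallyEq ?_
    filter_upwards [extChartAt_target_mem_nhds (I := I) x] with y hy
    exact chartSection_endomorphism hy J e
  have k := courantForm_torsion J₀ DJ hJJ₀ hJskew₀ hDJJ hDskew a b e₃ D₁ D₂
  have hJa : J₀ a = J x (e₁ x) := by subst hJ₀ ha; rfl
  have hJb : J₀ b = J x (e₂ x) := by subst hJ₀ hb; rfl
  have q₁ := dualPairing_courantBracket (app a ha h₁) (app b hb h₂) hJa hJb e₃
  have q₂ := dualPairing_courantBracket (app a ha h₁) h₂ hJa hb (J₀ e₃)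
  have q₃ := dualPairing_courantBracket h₁ (app b hb h₂) ha hJb (J₀ e₃)
  have q₄ := dualPairing_courantBracket h₁ h₂ ha hb e₃
  -- Moving `J₀` onto `e₃` by skewness turns the minus sign into a plus, which gives the four terms
  -- of `courantForm_torsion`.
  have final : ∀ n₁ n₂ n₃ n₄ : E × (E →L[ℝ] ℝ), dualPairing (n₁ - J₀ (n₂ + n₃) + n₄) e₃
      = dualPairing n₁ e₃ + dualPairing n₂ (J₀ e₃) + dualPairing n₃ (J₀ e₃)
        + dualPairing n₄ e₃ := by
    intro n₁ n₂ n₃ n₄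
    simp only [dualPairing_add_left, dualPairing_sub_left, hJskew₀]
    ring
  subst hJ₀
  exact (final _ _ _ _).trans ((congrArg₂ (· + ·) (congrArg₂ (· + ·)
    (congrArg₂ (· + ·) q₁ q₂) q₃) q₄).trans k)

/-- The cyclic sum of derivatives of `J` expressing its Courant-Nijenhuis torsion. -/
def torsionForm {V : Type*} [NormedAddCommGroup V] [NormedSpace ℝ V]
    (J : V × (V →L[ℝ] ℝ) →L[ℝ] V × (V →L[ℝ] ℝ))
    (DJ : V →L[ℝ] V × (V →L[ℝ] ℝ) →L[ℝ] V × (V →L[ℝ] ℝ)) (a b c : V × (V →L[ℝ] ℝ)) : ℝ :=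
  dualPairing (DJ (J a).1 b) c + dualPairing (DJ (J b).1 c) a
    + dualPairing (DJ (J c).1 a) b + dualPairing (DJ a.1 b) (J c)
    + dualPairing (DJ b.1 (J c)) a + dualPairing (DJ c.1 (J a)) b

lemma SmoothSection.differentiableAt {e : Π x : M, BigTangent I x} (he : SmoothSection I e)
    (x : M) : DifferentiableAt ℝ (chartSection I e x) (extChartAt I x x) :=
  (SmoothVectorField.differentiableAt he.1 x).prodMk (SmoothOneForm.differentiableAt he.2 x)

/-- By tensoriality the torsion of two sections at `x` depends only on their values there. Arbitrary
values are realized by smooth sections, and nondegeneracy of the pairing recovers the bracket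
identity. -/
theorem courantIntegrable_iff_torsionForm_eq_zero [FiniteDimensional ℝ E] [T2Space M]
    {J : Π x : M, BigTangent I x →L[ℝ] BigTangent I x} (hJJ : ∀ x e, J x (J x e) = e)
    (hJ : ∀ x e₁ e₂, pairing I (J x e₁) e₂ + pairing I e₁ (J x e₂) = 0)
    (hd : ∀ x, DifferentiableAt ℝ (chartBigEndomorphism I J x) (extChartAt I x x)) :
    CourantIntegrable I J ↔ ∀ x, ∀ a b c : E × (E →L[ℝ] ℝ),
      torsionForm (V := E) (J x) (fderiv ℝ (chartBigEndomorphism I J x) (extChartAt I x x))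
        a b c = 0 := by
  constructor
  · intro h x a b c
    obtain ⟨e₁, he₁, ha⟩ := exists_smoothSection_eq (I := I) (x := x) a
    obtain ⟨e₂, he₂, hb⟩ := exists_smoothSection_eq (I := I) (x := x) b
    refine (dualPairing_courantBracket_torsion hJJ hJ rfl (hd x).hasFDerivAt
      (he₁.differentiableAt x).hasFDerivAt (he₂.differentiableAt x).hasFDerivAt a b c
      ha.symm hb.symm).symm.trans ?_
    refine (congrArg (fun d ↦ dualPairing (V := E) d c) (h e₁ e₂ he₁ he₂ x)).trans ?_
    have : ∀ c : E × (E →L[ℝ] ℝ), dualPairing 0 c = 0 := fun c ↦ by simp [dualPairing]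
    exact this c
  · intro h e₁ e₂ he₁ he₂ x
    refine eq_zero_of_dualPairing (V := E) fun c ↦ ?_
    exact (dualPairing_courantBracket_torsion hJJ hJ rfl (hd x).hasFDerivAt
      (he₁.differentiableAt x).hasFDerivAt (he₂.differentiableAt x).hasFDerivAt (e₁ x) (e₂ x) c
      rfl rfl).trans (h x _ _ _)

end ManifoldCourant

/-! ### The preferred chart of the product with the line. -/

section ProductChart

open Filter Topology

variable {E : Type*} [NormedAddCommGroup E] [NormedSpace ℝ E]
  {H : Type*} [TopologicalSpace H] {I : ModelWithCorners ℝ E H}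
  {M : Type*} [TopologicalSpace M] [ChartedSpace H M]

lemma fst_mem_extChartAt_target {p : M × ℝ} {y : E × ℝ}
    (hy : y ∈ (extChartAt (I.prod 𝓘(ℝ, ℝ)) p).target) : y.1 ∈ (extChartAt I p.1).target := by
  rw [extChartAt_prod] at hy
  exact hy.1

variable [IsManifold I ∞ M]

lemma chartDerivAt_prod {p z : M × ℝ} (hz : z.1 ∈ (extChartAt I p.1).source) (v : E × ℝ) :
    chartDerivAt (I.prod 𝓘(ℝ, ℝ)) p z v = ((chartDerivAt I p.1 z.1 v.1 : E), v.2) := by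
  have : IsManifold I 1 M := .of_le (n := ∞) (by simp)
  rw [extChartAt_source] at hz
  have h₁ : HasMFDerivAt I 𝓘(ℝ, E) (extChartAt I p.1) z.1 (chartDerivAt I p.1 z.1) :=
    (mdifferentiableAt_extChartAt hz).hasMFDerivAt
  have h₂ := h₁.prodMap (p := z) (hasMFDerivAt_id (I := 𝓘(ℝ, ℝ)) z.2)
  have h₃ : HasMFDerivAt (I.prod 𝓘(ℝ, ℝ)) 𝓘(ℝ, E × ℝ) (extChartAt (I.prod 𝓘(ℝ, ℝ)) p) z
      ((chartDerivAt I p.1 z.1).prodMap (.id ℝ ℝ)) := by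
    have h : (mfderiv I 𝓘(ℝ, E) (extChartAt I p.1) z.1).prodMap (mfderiv 𝓘(ℝ, ℝ) 𝓘(ℝ, ℝ) id z.2)
        = (chartDerivAt I p.1 z.1).prodMap (.id ℝ ℝ) :=
      congrArg (ContinuousLinearMap.prodMap _) mfderiv_id
    exact ⟨h₂.1, (h₂.2.congr_fderiv h).congr (fun _ _ ↦ rfl) rfl⟩
  exact congrArg (fun L : E × ℝ →L[ℝ] E × ℝ ↦ L v) h₃.mfderiv

/-- The differential of the inverse chart is determined as the inverse of the differential of the
product chart, already known to be that of `M` times the identity. -/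
lemma chartSymmDeriv_prod {p : M × ℝ} {y : E × ℝ}
    (hy : y ∈ (extChartAt (I.prod 𝓘(ℝ, ℝ)) p).target) (v : E × ℝ) :
    chartSymmDeriv (I.prod 𝓘(ℝ, ℝ)) p y v = ((chartSymmDeriv I p.1 y.1 v.1 : E), v.2) := by
  have hy₁ := fst_mem_extChartAt_target hy
  have h := chartSymmDeriv_chartDerivAt (I.prod 𝓘(ℝ, ℝ)) hy
    ((chartSymmDeriv I p.1 y.1 v.1 : E), v.2)
  refine Eq.trans (congrArg (chartSymmDeriv (I.prod 𝓘(ℝ, ℝ)) p y) ?_) h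
  refine Eq.symm ((chartDerivAt_prod ((extChartAt I p.1).map_target hy₁) _).trans ?_)
  exact Prod.ext (chartDerivAt_chartSymmDeriv I hy₁ v.1) rfl

end ProductChart

/-! ### The torsion of the adapted structure as a function of the 1-jet on the base. -/

section AdaptedJet

open Filter Topology

variable {E : Type*} [NormedAddCommGroup E] [NormedSpace ℝ E]

/-- The generalized tangent vector of `E × ℝ` with components `((X, f), (α, g))`. -/
def SplitVector.merge (a : SplitVector E) : (E × ℝ) × (E × ℝ →L[ℝ] ℝ) :=
  (a.1, a.2.1.comp (ContinuousLinearMap.fst ℝ E ℝ) + a.2.2 • ContinuousLinearMap.snd ℝ E ℝ)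

lemma SplitVector.merge_surjective : Function.Surjective (SplitVector.merge (E := E)) := by
  rintro ⟨v, γ⟩
  refine ⟨(v, (γ.comp (ContinuousLinearMap.inl ℝ E ℝ), γ (0, 1))), Prod.ext rfl ?_⟩
  ext v
  · simp [SplitVector.merge]
  · simp only [SplitVector.merge, ContinuousLinearMap.comp_apply, add_apply, smul_apply,
      ContinuousLinearMap.inr_apply, ContinuousLinearMap.coe_fst',
      ContinuousLinearMap.coe_snd', smul_eq_mul, mul_one, map_zero, zero_add]

lemma SplitVector.dualPairing_merge (a b : SplitVector E) :
    dualPairing a.merge b.merge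
      = b.2.1 a.1.1 + b.2.2 * a.1.2 + (a.2.1 b.1.1 + a.2.2 * b.1.2) := by
  simp [dualPairing, SplitVector.merge]

variable {H : Type*} [TopologicalSpace H] {I : ModelWithCorners ℝ E H}
  {M : Type*} [TopologicalSpace M] [ChartedSpace H M] [IsManifold I ∞ M]

namespace GenAlmostParaContact

variable (S : GenAlmostParaContact I M)

/-- The 1-jet at `x` of the tensors of `S` in the preferred chart at `x`. -/
def jet (x : M) : TensorJet E where
  F := S.F x
  P := S.P x
  σ := S.σ x
  Z := S.Z x
  ξ := S.ξ x
  DF := fderiv ℝ (chartEndomorphism I S.F x) (extChartAt I x x)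
  DP := fderiv ℝ (chartSharp I S.P x) (extChartAt I x x)
  Dσ := fderiv ℝ (chartTwoForm I S.σ x) (extChartAt I x x)
  DZ := fderiv ℝ (chartVectorField I S.Z x) (extChartAt I x x)
  Dξ := fderiv ℝ (chartOneForm I S.ξ x) (extChartAt I x x)

lemma adapted_merge (p : M × ℝ) (a : SplitVector E) :
    (S.adapted p a.merge : (E × ℝ) × (E × ℝ →L[ℝ] ℝ)) = ((S.jet p.1).adaptedMap a).merge := by
  -- The identity is proved for plain linear maps on `E × ℝ` known only through their values, so
  -- that rewriting is not obstructed by the dependent tangent spaces. The later `flat` statements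
  -- serve the same purpose.
  have flat : ∀ (j : TensorJet E) (pr : E × ℝ →L[ℝ] E) (ic : E →L[ℝ] E × ℝ) (d : E × ℝ →L[ℝ] ℝ)
      (e : E × ℝ), (∀ v, pr v = v.1) → (∀ u, ic u = (u, 0)) → (∀ v, d v = v.2) → e = (0, 1) →
      (ic (j.F (pr a.merge.1) + j.P (a.merge.2.comp ic) + a.merge.2 e • j.Z)
        - a.merge.2 (ic j.Z) • e,
        (j.σ (pr a.merge.1) - (a.merge.2.comp ic).comp j.F - d a.merge.1 • j.ξ).comp pr
          + j.ξ (pr a.merge.1) • d) = (j.adaptedMap a).merge := by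
    intro j pr ic d e hpr hic hd he
    have h : a.merge.2.comp ic = a.2.1 := by
      ext u
      simp [SplitVector.merge, hic]
    have h' : a.merge.2 e = a.2.2 := by simp [SplitVector.merge, he]
    have h'' : a.merge.2 (ic j.Z) = a.2.1 j.Z := congrArg (fun L ↦ L j.Z) h
    rw [h, h', h'', hpr, hic, hd, he]
    refine Prod.ext ?_ (ContinuousLinearMap.ext fun v ↦ ?_)
    · simp [SplitVector.merge, TensorJet.adaptedMap]
    · simp [SplitVector.merge, TensorJet.adaptedMap, hpr, hd]
  exact (adapted_apply S p a.merge).trans (flat (S.jet p.1) (projM I p) (inclM I p) (dt I p)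
    (ddt I p) (projM_apply p) (inclM_apply p) (dt_apply p) (ddt_eq p))

/-- The values of the tensors of `S` read in the preferred chart at `x`; the derivatives are
left zero. -/
def chartValues (x : M) (y : E) : TensorJet E where
  F := chartEndomorphism I S.F x y
  P := chartSharp I S.P x y
  σ := chartTwoForm I S.σ x y
  Z := chartVectorField I S.Z x y
  ξ := chartOneForm I S.ξ x y
  DF := 0
  DP := 0
  Dσ := 0
  DZ := 0
  Dξ := 0

/-- The construction of `J` from the tensors commutes with the change of coordinates, because the
chart of `M × ℝ` is the identity on the line. The right-hand side involves only `y.1`: this is where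
independence of `t` enters. -/
lemma chartBigEndomorphism_adapted_merge {p : M × ℝ} {y : E × ℝ}
    (hy : y ∈ (extChartAt (I.prod 𝓘(ℝ, ℝ)) p).target) (a : SplitVector E) :
    chartBigEndomorphism (I.prod 𝓘(ℝ, ℝ)) S.adapted p y a.merge
      = ((S.chartValues p.1 y.1).adaptedMap a).merge := by
  have hy₁ := fst_mem_extChartAt_target hy
  set z := (extChartAt I p.1).symm y.1 with hz
  have hD := fun v ↦ chartDerivAt_prod (z := (z, y.2)) ((extChartAt I p.1).map_target hy₁) v
  have hA := chartSymmDeriv_prod hy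
  let a' : SplitVector E := ((chartSymmDeriv I p.1 y.1 a.1.1, a.1.2),
    (a.2.1.comp (chartDerivAt I p.1 z), a.2.2))
  have ha : ((chartSymmDeriv (I.prod 𝓘(ℝ, ℝ)) p y a.merge.1,
      a.merge.2.comp (chartDerivAt (I.prod 𝓘(ℝ, ℝ)) p (z, y.2))) :
        (E × ℝ) × (E × ℝ →L[ℝ] ℝ)) = a'.merge := by
    refine Prod.ext (hA a.1) (ContinuousLinearMap.ext fun v ↦ ?_)
    exact congrArg a.merge.2 (hD v)
  have h := (congrArg (S.adapted (z, y.2)) ha).trans (S.adapted_merge (z, y.2) a')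
  have h₁ : chartBigEndomorphism (I.prod 𝓘(ℝ, ℝ)) S.adapted p y a.merge
      = ((chartDerivAt (I.prod 𝓘(ℝ, ℝ)) p (z, y.2)
          ((S.jet z).adaptedMap a').merge.1 : E × ℝ),
        (((S.jet z).adaptedMap a').merge.2.comp (chartSymmDeriv (I.prod 𝓘(ℝ, ℝ)) p y) :
          E × ℝ →L[ℝ] ℝ)) :=
    congrArg (fun b : (E × ℝ) × (E × ℝ →L[ℝ] ℝ) ↦
      ((chartDerivAt (I.prod 𝓘(ℝ, ℝ)) p (z, y.2) b.1 : E × ℝ),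
        (b.2.comp (chartSymmDeriv (I.prod 𝓘(ℝ, ℝ)) p y) : E × ℝ →L[ℝ] ℝ))) h
  refine h₁.trans (Prod.ext ((hD _).trans (Prod.ext ?_ rfl)) ?_)
  · have lin : ∀ (L : E →L[ℝ] E) (u v w : E) (r : ℝ),
        L (u + v + r • w) = L u + L v + r • L w := by simp
    exact lin _ _ _ _ _
  · refine ContinuousLinearMap.ext fun v ↦ ?_
    exact congrArg ((S.jet z).adaptedMap a').merge.2 (hA v)

lemma differentiableAt_chartValues_adaptedMap_merge [I.Boundaryless] (x : M) (a : SplitVector E) :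
    DifferentiableAt ℝ (fun y ↦ ((S.chartValues x y).adaptedMap a).merge) (extChartAt I x x) := by
  have hF := S.smooth_F.differentiableAt x
  have hP := S.smooth_P.differentiableAt x
  have hσ := S.smooth_σ.differentiableAt x
  have hZ := S.smooth_Z.differentiableAt x
  have hξ := S.smooth_ξ.differentiableAt x
  simp only [SplitVector.merge, TensorJet.adaptedMap, chartValues]
  fun_prop

/-- Expanding `⟨J b, c⟩` with `b`, `c` constant gives a sum of contractions of the five tensors; its
termwise derivative is the defining expression of `derivForm`. -/
lemma fderiv_dualPairing_adaptedMap_merge [I.Boundaryless] (x : M) (a b c : SplitVector E) :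
    fderiv ℝ (fun y ↦ dualPairing ((S.chartValues x y).adaptedMap b).merge c.merge)
      (extChartAt I x x) a.1.1 = (S.jet x).derivForm a b c := by
  have hF := (S.smooth_F.differentiableAt x).hasFDerivAt
  have hP := (S.smooth_P.differentiableAt x).hasFDerivAt
  have hσ := (S.smooth_σ.differentiableAt x).hasFDerivAt
  have hZ := (S.smooth_Z.differentiableAt x).hasFDerivAt
  have hξ := (S.smooth_ξ.differentiableAt x).hasFDerivAt
  have const : ∀ {G : Type _} [NormedAddCommGroup G] [NormedSpace ℝ G] (g : G),
      HasFDerivAt (fun _ : E ↦ g) (0 : E →L[ℝ] G) (extChartAt I x x) :=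
    fun g ↦ hasFDerivAt_const g _
  have hFb := c.2.1.hasFDerivAt.comp _ (hF.clm_apply (const b.1.1))
  have hPb := c.2.1.hasFDerivAt.comp _ (hP.clm_apply (const b.2.1))
  have hZc := c.2.1.hasFDerivAt.comp _ hZ
  have hZb := b.2.1.hasFDerivAt.comp _ hZ
  have hσb := (hσ.clm_apply (const b.1.1)).clm_apply (const c.1.1)
  have hFc := b.2.1.hasFDerivAt.comp _ (hF.clm_apply (const c.1.1))
  have hξc := hξ.clm_apply (const c.1.1)
  have hξb := hξ.clm_apply (const b.1.1)
  have h := (((((((hFb.add hPb).add (hZc.const_mul b.2.2)).sub (hZb.const_mul c.2.2)).add hσb).sub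
    hFc).sub (hξc.const_mul b.1.2)).add (hξb.const_mul c.1.2))
  have h' := h.congr_of_eventuallyEq (f₁ := fun y ↦
    dualPairing ((S.chartValues x y).adaptedMap b).merge c.merge) (.of_forall fun y ↦ by
      simp only [SplitVector.dualPairing_merge, TensorJet.adaptedMap, chartValues, map_add,
        map_smul, smul_eq_mul, sub_apply, smul_apply, ContinuousLinearMap.comp_apply, Pi.add_apply,
        Pi.sub_apply, Function.comp_apply]
      ring)
  rw [h'.fderiv]
  simp [TensorJet.derivForm, jet]

/-- In finite dimension an operator is given by its values on a basis, so differentiability can be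
tested vector by vector. This applies to `J`, whose chart reading is known through its values on
split vectors. -/
lemma differentiableAt_of_clm_apply {V W G : Type*} [NormedAddCommGroup V] [NormedSpace ℝ V]
    [NormedAddCommGroup W] [NormedSpace ℝ W] [FiniteDimensional ℝ W] [NormedAddCommGroup G]
    [NormedSpace ℝ G] {f : V → W →L[ℝ] G} {x : V}
    (h : ∀ w, DifferentiableAt ℝ (fun y ↦ f y w) x) : DifferentiableAt ℝ f x := by
  let e₁ := ContinuousLinearEquiv.ofFinrankEq (Module.finrank_fin_fun ℝ (n := Module.finrank ℝ W)).symm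
  let e₂ := (e₁.arrowCongr (1 : G ≃L[ℝ] G)).trans
    (ContinuousLinearEquiv.piRing (Fin (Module.finrank ℝ W)))
  rw [← Function.id_comp f, ← e₂.symm_comp_self]
  exact e₂.symm.differentiableAt.comp x (differentiableAt_pi.2 fun i ↦ h _)

lemma hasFDerivAt_comp_fst {V W G : Type*} [NormedAddCommGroup V] [NormedSpace ℝ V]
    [NormedAddCommGroup W] [NormedSpace ℝ W] [NormedAddCommGroup G] [NormedSpace ℝ G]
    {f : V → G} {D : V →L[ℝ] G} {y : V × W} (h : HasFDerivAt f D y.1) :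
    HasFDerivAt (f ∘ Prod.fst) (D.comp (ContinuousLinearMap.fst ℝ V W)) y :=
  h.comp y hasFDerivAt_fst

variable [I.Boundaryless]

lemma eventuallyEq_chartBigEndomorphism_adapted_merge (p : M × ℝ) (a : SplitVector E) :
    (fun y ↦ chartBigEndomorphism (I.prod 𝓘(ℝ, ℝ)) S.adapted p y a.merge)
      =ᶠ[𝓝 (extChartAt (I.prod 𝓘(ℝ, ℝ)) p p)]
        (fun y ↦ ((S.chartValues p.1 y).adaptedMap a).merge) ∘ Prod.fst := by
  filter_upwards [extChartAt_target_mem_nhds (I := I.prod 𝓘(ℝ, ℝ)) p] with y hy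
  exact S.chartBigEndomorphism_adapted_merge hy a

variable [FiniteDimensional ℝ E]

lemma differentiableAt_chartBigEndomorphism_adapted (p : M × ℝ) :
    DifferentiableAt ℝ (chartBigEndomorphism (I.prod 𝓘(ℝ, ℝ)) S.adapted p)
      (extChartAt (I.prod 𝓘(ℝ, ℝ)) p p) := by
  refine differentiableAt_of_clm_apply fun w ↦ ?_
  obtain ⟨a, rfl⟩ := SplitVector.merge_surjective w
  refine DifferentiableAt.congr_of_eventuallyEq ?_
    (S.eventuallyEq_chartBigEndomorphism_adapted_merge p a)
  exact (hasFDerivAt_comp_fst (y := extChartAt (I.prod 𝓘(ℝ, ℝ)) p p)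
    (S.differentiableAt_chartValues_adaptedMap_merge p.1 a).hasFDerivAt).differentiableAt

lemma dualPairing_fderiv_chartBigEndomorphism_adapted (p : M × ℝ) (a b c : SplitVector E) :
    dualPairing (fderiv ℝ (chartBigEndomorphism (I.prod 𝓘(ℝ, ℝ)) S.adapted p)
      (extChartAt (I.prod 𝓘(ℝ, ℝ)) p p) a.merge.1 b.merge) c.merge
      = (S.jet p.1).derivForm a b c := by
  have h₁ := (dualPairingLeft c.merge).hasFDerivAt.comp _
    ((S.differentiableAt_chartBigEndomorphism_adapted p).hasFDerivAt.clm_apply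
      (hasFDerivAt_const b.merge _))
  have h₂ : DifferentiableAt ℝ
      (fun y ↦ dualPairing ((S.chartValues p.1 y).adaptedMap b).merge c.merge)
      (extChartAt I p.1 p.1) :=
    (dualPairingLeft c.merge).differentiableAt.comp _
      (S.differentiableAt_chartValues_adaptedMap_merge p.1 b)
  have h₃ := (hasFDerivAt_comp_fst (y := extChartAt (I.prod 𝓘(ℝ, ℝ)) p p) h₂.hasFDerivAt).congr_of_eventuallyEq
      ((S.eventuallyEq_chartBigEndomorphism_adapted_merge p b).fun_comp (dualPairingLeft c.merge))
  -- The derivative of `⟨J b, c⟩` is computed once through `J` on the product and once through the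
  -- tensors on `M`; uniqueness of the derivative equates the two.
  have h₄ := congrArg (fun L ↦ L a.merge.1) (h₁.unique h₃)
  simp only [ContinuousLinearMap.comp_apply, add_apply, zero_apply, map_zero, zero_add,
    ContinuousLinearMap.flip_apply, dualPairingLeft_apply] at h₄
  exact h₄.trans (S.fderiv_dualPairing_adaptedMap_merge p.1 a b c)

lemma torsionForm_adapted (p : M × ℝ) (a b c : SplitVector E) :
    torsionForm (V := E × ℝ) (S.adapted p)
      (fderiv ℝ (chartBigEndomorphism (I.prod 𝓘(ℝ, ℝ)) S.adapted p)
        (extChartAt (I.prod 𝓘(ℝ, ℝ)) p p)) a.merge b.merge c.merge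
      = (S.jet p.1).torsion a b c := by
  have flat : ∀ J : (E × ℝ) × (E × ℝ →L[ℝ] ℝ) →L[ℝ] (E × ℝ) × (E × ℝ →L[ℝ] ℝ),
      (∀ a : SplitVector E, J a.merge = ((S.jet p.1).adaptedMap a).merge) →
      torsionForm J (fderiv ℝ (chartBigEndomorphism (I.prod 𝓘(ℝ, ℝ)) S.adapted p)
        (extChartAt (I.prod 𝓘(ℝ, ℝ)) p p)) a.merge b.merge c.merge
      = (S.jet p.1).torsion a b c := by
    intro J hJ
    simp only [torsionForm, hJ, dualPairing_fderiv_chartBigEndomorphism_adapted,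
      TensorJet.torsion]
  exact flat _ (S.adapted_merge p)

lemma derivForm_jet_skew (x : M) (a b c : SplitVector E) :
    (S.jet x).derivForm a b c = -(S.jet x).derivForm a c b := by
  -- The structure does not depend on `t`, so the point `t = 0` above `x` is as good as any.
  have h := fderiv_skew_of_skew
    (S.differentiableAt_chartBigEndomorphism_adapted (x, (0 : ℝ))).hasFDerivAt
    (.of_forall fun y ↦ chartBigEndomorphism_skew (x, (0 : ℝ)) y S.adapted_skew) a.merge.1 b.merge c.merge
  rw [dualPairing_comm b.merge] at h
  simpa only [dualPairing_fderiv_chartBigEndomorphism_adapted] using h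

lemma derivForm_jet_anticomm (x : M) (a b c : SplitVector E) :
    (S.jet x).derivForm a ((S.jet x).adaptedMap b) c
      = (S.jet x).derivForm a b ((S.jet x).adaptedMap c) := by
  have h := fderiv_anticomm_of_involutive
    (S.differentiableAt_chartBigEndomorphism_adapted (x, (0 : ℝ))).hasFDerivAt (by
      filter_upwards [extChartAt_target_mem_nhds (I := I.prod 𝓘(ℝ, ℝ)) (x, (0 : ℝ))] with y hy
      exact chartBigEndomorphism_involutive hy S.adapted_adapted) a.merge.1 b.merge
  have hs := chartBigEndomorphism_skew (x, (0 : ℝ)) (extChartAt (I.prod 𝓘(ℝ, ℝ)) (x, (0 : ℝ)) (x, (0 : ℝ)))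
    S.adapted_skew
  have hJ : ∀ a : SplitVector E, chartBigEndomorphism (I.prod 𝓘(ℝ, ℝ)) S.adapted (x, (0 : ℝ))
      (extChartAt (I.prod 𝓘(ℝ, ℝ)) (x, (0 : ℝ)) (x, (0 : ℝ))) a.merge = ((S.jet x).adaptedMap a).merge :=
    fun a ↦ (congrArg (fun L : (E × ℝ) × (E × ℝ →L[ℝ] ℝ) →L[ℝ] (E × ℝ) × (E × ℝ →L[ℝ] ℝ) ↦
      L a.merge) (chartBigEndomorphism_self S.adapted (x, (0 : ℝ)))).trans (S.adapted_merge (x, (0 : ℝ)) a)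
  have h' := congrArg (fun d ↦ dualPairing d c.merge) h
  simp only [dualPairing_neg_left, hs, neg_neg, hJ,
    dualPairing_fderiv_chartBigEndomorphism_adapted] at h'
  exact h'

/-- The algebraic identities are the blocks of the axioms `map_ξ`, `map_Z` and `sq`, together with
skewness. The differentiated ones are read off from the derivatives of skewness and of `J² = 1` on
`M × ℝ`. -/
lemma jet_isParaContact (x : M) : (S.jet x).IsParaContact := by
  have h₁ := S.map_ξ x
  have h₂ := S.map_Z x
  simp only [blockMap_apply, Prod.mk_eq_zero, map_zero, zero_add, zero_sub, neg_eq_zero, add_zero,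
    sub_zero, ContinuousLinearMap.zero_comp] at h₁ h₂
  have h₃ : ∀ (u : TangentSpace I x) (α : Cotangent I x), _ := fun u α ↦ S.sq x (u, α)
  simp only [blockMap_apply, Prod.ext_iff, Prod.fst_sub, Prod.snd_sub] at h₃
  have hF : ∀ u : TangentSpace I x,
      S.F x (S.F x u) + S.P x (S.σ x u) = u - S.ξ x u • S.Z x := fun u ↦ by
    simpa using (h₃ u 0).1
  have hP : ∀ α : Cotangent I x, S.F x (S.P x α) = S.P x (α.comp (S.F x)) := fun α ↦ by
    have := (h₃ 0 α).1
    simp only [map_zero, zero_add, zero_sub, map_neg, zero_smul, sub_zero, add_neg_eq_zero] at this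
    exact this
  have hσ : ∀ u : TangentSpace I x, S.σ x (S.F x u) = (S.σ x u).comp (S.F x) := fun u ↦ by
    have := (h₃ u 0).2
    simp only [map_zero, add_zero, ContinuousLinearMap.zero_comp, sub_zero,
      zero_apply, zero_smul, sub_eq_zero] at this
    exact this
  exact
  { P_skew := S.P_skew x
    σ_skew := S.σ_skew x
    ξ_Z := S.ξ_Z x
    F_Z := h₂.1
    ξ_F := fun u ↦ congrArg (fun L : E →L[ℝ] ℝ ↦ L u) h₁.2
    P_ξ := h₁.1
    σ_Z := h₂.2
    F_P := hP
    σ_F := fun u v ↦ congrArg (fun L : E →L[ℝ] ℝ ↦ L v) (hσ u)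
    F_F := fun u ↦ by
      have flat : ∀ a b c d : E, a + b = c - d → a = c - b - d := fun a b c d h ↦ by
        rw [sub_right_comm, ← h, add_sub_cancel_right]
      exact flat _ _ _ _ (hF u)
    DP_skew := fun w α β ↦ by
      have := S.derivForm_jet_skew x ((w, 0), 0) (0, (α, 0)) (0, (β, 0))
      simpa [TensorJet.derivForm] using this
    Dσ_skew := fun w u v ↦ by
      have := S.derivForm_jet_skew x ((w, 0), 0) ((u, 0), 0) ((v, 0), 0)
      simpa [TensorJet.derivForm] using this
    anticomm := S.derivForm_jet_anticomm x }

theorem isNormal_iff_torsion_jet_eq_zero [T2Space M] :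
    S.IsNormal ↔ ∀ x, ∀ a b c, (S.jet x).torsion a b c = 0 := by
  refine (courantIntegrable_iff_torsionForm_eq_zero S.adapted_adapted S.adapted_skew
    S.differentiableAt_chartBigEndomorphism_adapted).trans ⟨fun h x a b c ↦ ?_, fun h p a b c ↦ ?_⟩
  · exact (S.torsionForm_adapted (x, (0 : ℝ)) a b c).symm.trans (h (x, (0 : ℝ)) _ _ _)
  · obtain ⟨a, rfl⟩ := SplitVector.merge_surjective a
    obtain ⟨b, rfl⟩ := SplitVector.merge_surjective b
    obtain ⟨c, rfl⟩ := SplitVector.merge_surjective c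
    exact (S.torsionForm_adapted p a b c).trans (h p.1 a b c)

end GenAlmostParaContact

end AdaptedJet

/-! ### The differential conditions computed in a chart. -/

section Conditions

open Filter Topology

/-- A condition on sections which at each point depends only on the value there may be tested on
vectors, since every vector extends to an admissible section. -/
lemma forall_section_iff {M : Type*} {V : M → Type*} {Sm : (Π x, V x) → Prop}
    (ext : ∀ x (v : V x), ∃ s, Sm s ∧ s x = v) {C : (Π x, V x) → M → Prop} {Q : ∀ x, V x → Prop}
    (h : ∀ s, Sm s → ∀ x, C s x ↔ Q x (s x)) :
    (∀ s, Sm s → ∀ x, C s x) ↔ ∀ x v, Q x v := by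
  refine ⟨fun hC x v ↦ ?_, fun hQ s hs x ↦ (h s hs x).2 (hQ x _)⟩
  obtain ⟨s, hs, rfl⟩ := ext x v
  exact (h s hs x).1 (hC s hs x)

lemma forall_section₂_iff {M : Type*} {V : M → Type*} {Sm : (Π x, V x) → Prop}
    (ext : ∀ x (v : V x), ∃ s, Sm s ∧ s x = v) {C : (Π x, V x) → (Π x, V x) → M → Prop}
    {Q : ∀ x, V x → V x → Prop}
    (h : ∀ s s', Sm s → Sm s' → ∀ x, C s s' x ↔ Q x (s x) (s' x)) :
    (∀ s s', Sm s → Sm s' → ∀ x, C s s' x) ↔ ∀ x v v', Q x v v' := by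
  refine ⟨fun hC x v v' ↦ ?_, fun hQ s s' hs hs' x ↦ (h s s' hs hs' x).2 (hQ x _ _)⟩
  obtain ⟨s, hs, rfl⟩ := ext x v
  obtain ⟨s', hs', rfl⟩ := ext x v'
  exact (h s s' hs hs' x).1 (hC s s' hs hs' x)

variable {E : Type*} [NormedAddCommGroup E] [NormedSpace ℝ E]
  {H : Type*} [TopologicalSpace H] {I : ModelWithCorners ℝ E H}
  {M : Type*} [TopologicalSpace M] [ChartedSpace H M] [IsManifold I ∞ M] [I.Boundaryless]

lemma eq_iff_forall_dual_eq {u v : E} : u = v ↔ ∀ γ : E →L[ℝ] ℝ, γ u = γ v :=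
  ⟨fun h _ ↦ h ▸ rfl, fun h ↦ sub_eq_zero.1 <|
    SeparatingDual.eq_zero_of_forall_dual_eq_zero (R := ℝ) fun γ ↦ by rw [map_sub, h, sub_self]⟩

namespace GenAlmostParaContact

variable (S : GenAlmostParaContact I M)

lemma hasFDerivAt_F (x : M) :
    HasFDerivAt (chartEndomorphism I S.F x) (S.jet x).DF (extChartAt I x x) :=
  (S.smooth_F.differentiableAt x).hasFDerivAt

lemma hasFDerivAt_P (x : M) :
    HasFDerivAt (chartSharp I S.P x) (S.jet x).DP (extChartAt I x x) :=
  (S.smooth_P.differentiableAt x).hasFDerivAt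

lemma hasFDerivAt_σ (x : M) :
    HasFDerivAt (chartTwoForm I S.σ x) (S.jet x).Dσ (extChartAt I x x) :=
  (S.smooth_σ.differentiableAt x).hasFDerivAt

lemma hasFDerivAt_Z (x : M) :
    HasFDerivAt (chartVectorField I S.Z x) (S.jet x).DZ (extChartAt I x x) :=
  (S.smooth_Z.differentiableAt x).hasFDerivAt

lemma hasFDerivAt_ξ (x : M) :
    HasFDerivAt (chartOneForm I S.ξ x) (S.jet x).Dξ (extChartAt I x x) :=
  (S.smooth_ξ.differentiableAt x).hasFDerivAt

variable {X Y : Π x : M, TangentSpace I x} {α β : Π x : M, Cotangent I x} {x : M}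
  {DX DY : E →L[ℝ] E} {Dα Dβ : E →L[ℝ] E →L[ℝ] ℝ}

lemma hasFDerivAt_F_apply (hX : HasFDerivAt (chartVectorField I X x) DX (extChartAt I x x)) :
    HasFDerivAt (chartVectorField I (fun y ↦ S.F y (X y)) x)
      ((S.jet x).F.comp DX + (S.jet x).DF.flip (X x)) (extChartAt I x x) :=
  hasFDerivAt_chartVectorField_endomorphism (F₀ := (S.jet x).F) rfl (S.hasFDerivAt_F x) hX

lemma hasFDerivAt_P_apply (hα : HasFDerivAt (chartOneForm I α x) Dα (extChartAt I x x)) :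
    HasFDerivAt (chartVectorField I (fun y ↦ S.P y (α y)) x)
      ((S.jet x).P.comp Dα + (S.jet x).DP.flip (α x)) (extChartAt I x x) :=
  hasFDerivAt_chartVectorField_sharp (P₀ := (S.jet x).P) rfl (S.hasFDerivAt_P x) hα

lemma hasFDerivAt_σ_apply (hX : HasFDerivAt (chartVectorField I X x) DX (extChartAt I x x)) :
    HasFDerivAt (chartOneForm I (fun y ↦ S.σ y (X y)) x)
      ((S.jet x).σ.comp DX + (S.jet x).Dσ.flip (X x)) (extChartAt I x x) :=
  hasFDerivAt_chartOneForm_flat (σ₀ := (S.jet x).σ) rfl (S.hasFDerivAt_σ x) hX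

variable {S}

lemma lieOneForm_Z_ξ_apply (u : E) :
    lieOneForm I S.Z S.ξ x u = (S.jet x).Dξ (S.jet x).Z u + (S.jet x).ξ ((S.jet x).DZ u) :=
  lieOneForm_apply_of_hasFDerivAt (S.hasFDerivAt_Z x) (S.hasFDerivAt_ξ x) u

lemma lieOneForm_Z_ξ_eq_zero_iff : lieOneForm I S.Z S.ξ x = 0 ↔ (S.jet x).CondA5ξ := by
  have h := lieOneForm_Z_ξ_apply (S := S) (x := x)
  exact ⟨fun h₀ u ↦ (h u).symm.trans (congrArg (fun L : E →L[ℝ] ℝ ↦ L u) h₀),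
    fun h₀ ↦ ContinuousLinearMap.ext fun u ↦ (h u).trans (h₀ u)⟩

section VectorFields

/-- The derivative `DX` occurs as `F (DX Z)` in both brackets and drops out. The same kind of
cancellation makes the other expressions pointwise, except `formBracket_apply`, where derivatives of
the 1-forms remain. -/
lemma lieEndomorphism_Z_F_eq
    (hX : HasFDerivAt (chartVectorField I X x) DX (extChartAt I x x))
    {u : E} (hu : u = X x) :
    lieEndomorphism I S.Z S.F X x = (S.jet x).DF (S.jet x).Z u - (S.jet x).DZ ((S.jet x).F u)
      + (S.jet x).F ((S.jet x).DZ u) := by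
  subst hu
  have h₁ := mlieBracket_eq_of_hasFDerivAt I (S.hasFDerivAt_Z x) (hasFDerivAt_F_apply S hX)
  have h₂ := mlieBracket_eq_of_hasFDerivAt I (S.hasFDerivAt_Z x) hX
  have flat : ∀ (j : TensorJet E) (u : E),
      (j.F.comp DX + j.DF.flip u) j.Z - j.DZ (j.F u) - j.F (DX j.Z - j.DZ u)
        = j.DF j.Z u - j.DZ (j.F u) + j.F (j.DZ u) := by
    intro j u
    simp only [add_apply, ContinuousLinearMap.comp_apply, ContinuousLinearMap.flip_apply, map_sub]
    abel
  exact (congrArg₂ (fun v w : E ↦ v - w) h₁ (congrArg (S.jet x).F h₂)).trans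
    (flat (S.jet x) (X x))

lemma lieFlat_Z_σ_apply
    (hX : HasFDerivAt (chartVectorField I X x) DX (extChartAt I x x))
    {u : E} (hu : u = X x) (v : E) :
    lieFlat I S.Z S.σ X x v = (S.jet x).Dσ (S.jet x).Z u v + (S.jet x).σ u ((S.jet x).DZ v)
      + (S.jet x).σ ((S.jet x).DZ u) v := by
  subst hu
  have h₁ := lieOneForm_apply_of_hasFDerivAt (S.hasFDerivAt_Z x) (hasFDerivAt_σ_apply S hX) v
  have h₂ := mlieBracket_eq_of_hasFDerivAt I (S.hasFDerivAt_Z x) hX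
  have flat : ∀ (j : TensorJet E) (u : E),
      (j.σ.comp DX + j.Dσ.flip u) j.Z v + j.σ u (j.DZ v) - j.σ (DX j.Z - j.DZ u) v
        = j.Dσ j.Z u v + j.σ u (j.DZ v) + j.σ (j.DZ u) v := by
    intro j u
    simp only [add_apply, ContinuousLinearMap.comp_apply, ContinuousLinearMap.flip_apply, map_sub,
      sub_apply]
    ring
  exact (congrArg₂ (· - ·) h₁ (congrArg (fun w ↦ (S.jet x).σ w v) h₂)).trans (flat (S.jet x) (X x))

/-- The term `ξ (F (DX v))` vanishes because `ξ ∘ F = 0`; in `lieOneForm_P_ξ_apply` the identity `ξ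
∘ P = 0`, from `P ξ = 0` and skewness, does the same. -/
lemma lieOneForm_F_ξ_apply [FiniteDimensional ℝ E]
    (hX : HasFDerivAt (chartVectorField I X x) DX (extChartAt I x x))
    {u : E} (hu : u = X x) (v : E) :
    lieOneForm I (fun y ↦ S.F y (X y)) S.ξ x v
      = (S.jet x).Dξ ((S.jet x).F u) v + (S.jet x).ξ ((S.jet x).DF v u) := by
  subst hu
  have h₁ := lieOneForm_apply_of_hasFDerivAt (hasFDerivAt_F_apply S hX) (S.hasFDerivAt_ξ x) v
  have flat : ∀ (j : TensorJet E), (∀ u, j.ξ (j.F u) = 0) → ∀ u : E,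
      j.Dξ (j.F u) v + j.ξ ((j.F.comp DX + j.DF.flip u) v)
        = j.Dξ (j.F u) v + j.ξ (j.DF v u) := by
    intro j hj u
    simp [hj]
  exact h₁.trans (flat (S.jet x) (S.jet_isParaContact x).ξ_F (X x))

lemma nijenhuis_F_eq
    (hX : HasFDerivAt (chartVectorField I X x) DX (extChartAt I x x))
    (hY : HasFDerivAt (chartVectorField I Y x) DY (extChartAt I x x))
    {u v : E} (hu : u = X x) (hv : v = Y x) :
    nijenhuis I S.F X Y x = (S.jet x).DF ((S.jet x).F u) v - (S.jet x).DF ((S.jet x).F v) u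
      + (S.jet x).F ((S.jet x).DF v u) - (S.jet x).F ((S.jet x).DF u v) := by
  subst hu hv
  have h₁ := mlieBracket_eq_of_hasFDerivAt I (hasFDerivAt_F_apply S hX)
    (hasFDerivAt_F_apply S hY)
  have h₂ := mlieBracket_eq_of_hasFDerivAt I hX hY
  have h₃ := mlieBracket_eq_of_hasFDerivAt I (hasFDerivAt_F_apply S hX) hY
  have h₄ := mlieBracket_eq_of_hasFDerivAt I hX (hasFDerivAt_F_apply S hY)
  have flat : ∀ (j : TensorJet E) (u v : E),
      (j.F.comp DY + j.DF.flip v) (j.F u) - (j.F.comp DX + j.DF.flip u) (j.F v)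
        + j.F (j.F (DY u - DX v)) - j.F (DY (j.F u) - (j.F.comp DX + j.DF.flip u) v)
        - j.F ((j.F.comp DY + j.DF.flip v) u - DX (j.F v))
      = j.DF (j.F u) v - j.DF (j.F v) u + j.F (j.DF v u) - j.F (j.DF u v) := by
    intro j u v
    simp only [add_apply, ContinuousLinearMap.comp_apply, ContinuousLinearMap.flip_apply, map_sub,
      map_add]
    abel
  exact (congrArg₂ (fun v w : E ↦ v - w) (congrArg₂ (fun v w : E ↦ v - w)
    (congrArg₂ (fun v w : E ↦ v + w) h₁
    (congrArg (fun w ↦ (S.jet x).F ((S.jet x).F w)) h₂)) (congrArg (S.jet x).F h₃))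
    (congrArg (S.jet x).F h₄)).trans (flat (S.jet x) (X x) (Y x))

end VectorFields

section Forms

variable [FiniteDimensional ℝ E]

lemma lieOneForm_P_ξ_apply
    (hα : HasFDerivAt (chartOneForm I α x) Dα (extChartAt I x x))
    {a : E →L[ℝ] ℝ} (ha : a = α x) (u : E) :
    lieOneForm I (fun y ↦ S.P y (α y)) S.ξ x u
      = (S.jet x).Dξ ((S.jet x).P a) u + (S.jet x).ξ ((S.jet x).DP u a) := by
  subst ha
  have h₁ := lieOneForm_apply_of_hasFDerivAt (hasFDerivAt_P_apply S hα) (S.hasFDerivAt_ξ x) u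
  have flat : ∀ j : TensorJet E, j.IsParaContact → ∀ a : E →L[ℝ] ℝ,
      j.Dξ (j.P a) u + j.ξ ((j.P.comp Dα + j.DP.flip a) u)
        = j.Dξ (j.P a) u + j.ξ (j.DP u a) := by
    intro j hj a
    have : ∀ b, j.ξ (j.P b) = 0 := fun b ↦ by rw [hj.P_skew, hj.P_ξ, map_zero, neg_zero]
    simp [this]
  exact h₁.trans (flat (S.jet x) (S.jet_isParaContact x) (α x))

/-- The derivatives of `α` and `β` in the direction `u` cancel, those of `β` by skewness of `P`.
Those along `P b` and `P a` survive, so the bracket becomes tensorial only inside the two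
equivalences that use it. -/
lemma formBracket_apply
    (hα : HasFDerivAt (chartOneForm I α x) Dα (extChartAt I x x))
    (hβ : HasFDerivAt (chartOneForm I β x) Dβ (extChartAt I x x))
    {a b : E →L[ℝ] ℝ} (ha : a = α x) (hb : b = β x) (u : E) :
    formBracket I S.P α β x u
      = Dβ ((S.jet x).P a) u - Dα ((S.jet x).P b) u + b ((S.jet x).DP u a) := by
  subst ha hb
  have h₁ := lieOneForm_apply_of_hasFDerivAt (hasFDerivAt_P_apply S hα) hβ u
  have h₂ := lieOneForm_apply_of_hasFDerivAt (hasFDerivAt_P_apply S hβ) hα u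
  have h₃ := mvfderiv_apply_of_hasFDerivAt hβ (hasFDerivAt_P_apply S hα) u
  have flat : ∀ j : TensorJet E, j.IsParaContact → ∀ a b : E →L[ℝ] ℝ,
      Dβ (j.P a) u + b ((j.P.comp Dα + j.DP.flip a) u)
        - (Dα (j.P b) u + a ((j.P.comp Dβ + j.DP.flip b) u))
        - (Dβ u (j.P a) + b ((j.P.comp Dα + j.DP.flip a) u))
      = Dβ (j.P a) u - Dα (j.P b) u + b (j.DP u a) := by
    intro j hj a b
    simp only [add_apply, ContinuousLinearMap.comp_apply, ContinuousLinearMap.flip_apply, map_add]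
    rw [hj.P_skew (Dβ u) a, hj.DP_skew u b a]
    ring
  exact (congrArg₂ (· - ·) (congrArg₂ (· - ·) h₁ h₂) h₃).trans
    (flat (S.jet x) (S.jet_isParaContact x) (α x) (β x))

lemma lieBivector_Z_P_eq
    (hα : HasFDerivAt (chartOneForm I α x) Dα (extChartAt I x x))
    (hβ : HasFDerivAt (chartOneForm I β x) Dβ (extChartAt I x x))
    {a b : E →L[ℝ] ℝ} (ha : a = α x) (hb : b = β x) :
    lieBivector I S.Z S.P α β x = b ((S.jet x).DP (S.jet x).Z a)
      + a ((S.jet x).DZ ((S.jet x).P b)) - b ((S.jet x).DZ ((S.jet x).P a)) := by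
  subst ha hb
  have h₁ := mvfderiv_apply_of_hasFDerivAt hβ (hasFDerivAt_P_apply S hα) (S.Z x)
  have h₂ := lieOneForm_apply_of_hasFDerivAt (S.hasFDerivAt_Z x) hα (S.P x (β x))
  have h₃ := lieOneForm_apply_of_hasFDerivAt (S.hasFDerivAt_Z x) hβ (S.P x (α x))
  have h₄ := (S.P_skew x (lieOneForm I S.Z α x) (β x)).trans (congrArg Neg.neg h₂)
  have flat : ∀ j : TensorJet E, j.IsParaContact → ∀ a b : E →L[ℝ] ℝ,
      Dβ j.Z (j.P a) + b ((j.P.comp Dα + j.DP.flip a) j.Z)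
        - -(Dα j.Z (j.P b) + a (j.DZ (j.P b))) - (Dβ j.Z (j.P a) + b (j.DZ (j.P a)))
      = b (j.DP j.Z a) + a (j.DZ (j.P b)) - b (j.DZ (j.P a)) := by
    intro j hj a b
    simp only [add_apply, ContinuousLinearMap.comp_apply, ContinuousLinearMap.flip_apply, map_add]
    rw [hj.P_skew (Dα j.Z) b]
    ring
  exact (congrArg₂ (· - ·) (congrArg₂ (· - ·) h₁ h₄) h₃).trans
    (flat (S.jet x) (S.jet_isParaContact x) (α x) (β x))

lemma mlieBracket_P_eq_iff
    (hα : HasFDerivAt (chartOneForm I α x) Dα (extChartAt I x x))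
    (hβ : HasFDerivAt (chartOneForm I β x) Dβ (extChartAt I x x))
    {a b : E →L[ℝ] ℝ} (ha : a = α x) (hb : b = β x) :
    mlieBracket I (fun y ↦ S.P y (α y)) (fun y ↦ S.P y (β y)) x
        = S.P x (formBracket I S.P α β x) ↔
      ∀ γ : E →L[ℝ] ℝ, γ ((S.jet x).DP ((S.jet x).P a) b) - γ ((S.jet x).DP ((S.jet x).P b) a)
        + b ((S.jet x).DP ((S.jet x).P γ) a) = 0 := by
  refine (eq_iff_forall_dual_eq (E := E)).trans (forall_congr' fun γ ↦ ?_)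
  have h₁ := congrArg γ (mlieBracket_eq_of_hasFDerivAt I (hasFDerivAt_P_apply S hα)
    (hasFDerivAt_P_apply S hβ))
  have h₂ := (S.P_skew x (formBracket I S.P α β x) γ).trans
    (congrArg Neg.neg (formBracket_apply (S := S) hα hβ ha hb (S.P x γ)))
  refine (Eq.congr h₁ h₂).trans ?_
  have flat : ∀ j : TensorJet E, j.IsParaContact → ∀ a b : E →L[ℝ] ℝ,
      (γ ((j.P.comp Dβ + j.DP.flip b) (j.P a) - (j.P.comp Dα + j.DP.flip a) (j.P b))
        = -(Dβ (j.P a) (j.P γ) - Dα (j.P b) (j.P γ) + b (j.DP (j.P γ) a))) ↔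
      γ (j.DP (j.P a) b) - γ (j.DP (j.P b) a) + b (j.DP (j.P γ) a) = 0 := by
    intro j hj a b
    simp only [add_apply, ContinuousLinearMap.comp_apply, ContinuousLinearMap.flip_apply, map_add,
      map_sub]
    -- Skewness identifies the derivatives of the 1-forms on the two sides, so only the terms in
    -- `DP` remain.
    rw [hj.P_skew (Dβ (j.P a)) γ, hj.P_skew (Dα (j.P b)) γ]
    constructor <;> intro h <;> linarith
  subst ha hb
  exact flat (S.jet x) (S.jet_isParaContact x) (α x) (β x)

lemma formBracket_comp_F_eq_iff
    (hα : HasFDerivAt (chartOneForm I α x) Dα (extChartAt I x x))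
    (hβ : HasFDerivAt (chartOneForm I β x) Dβ (extChartAt I x x))
    {a b : E →L[ℝ] ℝ} (ha : a = α x) (hb : b = β x) :
    (formBracket I S.P α β x).comp (S.F x)
        = lieOneForm I (fun y ↦ S.P y (α y)) (fun y ↦ (β y).comp (S.F y)) x
          - lieOneForm I (fun y ↦ S.P y (β y)) (fun y ↦ (α y).comp (S.F y)) x
          + mvfderiv I (fun y ↦ ((α y).comp (S.F y)) (S.P y (β y))) x ↔
      ∀ u : E, b ((S.jet x).DP ((S.jet x).F u) a) = b ((S.jet x).DF ((S.jet x).P a) u)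
        + b ((S.jet x).F ((S.jet x).DP u a)) - a ((S.jet x).DF ((S.jet x).P b) u)
        + a ((S.jet x).DF u ((S.jet x).P b)) := by
  refine ContinuousLinearMap.ext_iff.trans (forall_congr' fun u ↦ ?_)
  have hα' := hasFDerivAt_chartOneForm_comp hα (S.hasFDerivAt_F x)
  have hβ' := hasFDerivAt_chartOneForm_comp hβ (S.hasFDerivAt_F x)
  have h₁ := formBracket_apply (S := S) hα hβ ha hb (S.F x u)
  have h₂ := lieOneForm_apply_of_hasFDerivAt (hasFDerivAt_P_apply S hα) hβ' u
  have h₃ := lieOneForm_apply_of_hasFDerivAt (hasFDerivAt_P_apply S hβ) hα' u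
  have h₄ := mvfderiv_apply_of_hasFDerivAt hα' (hasFDerivAt_P_apply S hβ) u
  refine (Eq.congr h₁ (congrArg₂ (· + ·) (congrArg₂ (· - ·) h₂ h₃) h₄)).trans ?_
  have flat : ∀ j : TensorJet E, j.IsParaContact → ∀ (a b : E →L[ℝ] ℝ) (u : E),
      (Dβ (j.P a) (j.F u) - Dα (j.P b) (j.F u) + b (j.DP (j.F u) a)
        = b (j.DF (j.P a) u) + Dβ (j.P a) (j.F u) + b (j.F ((j.P.comp Dα + j.DP.flip a) u))
          - (a (j.DF (j.P b) u) + Dα (j.P b) (j.F u) + a (j.F ((j.P.comp Dβ + j.DP.flip b) u)))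
          + (a (j.DF u (j.P b)) + Dα u (j.F (j.P b))
            + a (j.F ((j.P.comp Dβ + j.DP.flip b) u)))) ↔
      b (j.DP (j.F u) a) = b (j.DF (j.P a) u) + b (j.F (j.DP u a)) - a (j.DF (j.P b) u)
        + a (j.DF u (j.P b)) := by
    intro j hj a b u
    simp only [add_apply, ContinuousLinearMap.comp_apply, ContinuousLinearMap.flip_apply, map_add]
    -- The last derivative of `α`, in `b (F (P (Dα u)))`, cancels against the differential term only
    -- because `F P = P F*` and `P` is skew.
    rw [hj.F_P (Dα u), hj.P_skew ((Dα u).comp j.F) b, ContinuousLinearMap.comp_apply]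
    constructor <;> intro h <;> linarith
  subst ha hb
  exact flat (S.jet x) (S.jet_isParaContact x) (α x) (β x) u

end Forms

end GenAlmostParaContact

end Conditions

/-! ### From pointwise conditions on the jets to conditions on smooth fields. -/

namespace GenAlmostParaContact

variable {E : Type*} [NormedAddCommGroup E] [NormedSpace ℝ E]
  {H : Type*} [TopologicalSpace H] {I : ModelWithCorners ℝ E H}
  {M : Type*} [TopologicalSpace M] [ChartedSpace H M] [IsManifold I ∞ M] [I.Boundaryless]
  (S : GenAlmostParaContact I M)

/-- Exterior derivatives are already tensors, so no extension of vectors is involved: the product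
rule for `σ ∘ F` gives the left-hand side. -/
lemma forall_condA4σ_iff : (∀ x, (S.jet x).CondA4σ) ↔ ∀ (x : M) (u v w : TangentSpace I x),
    extDerivTwo I (fun y ↦ (S.σ y).comp (S.F y)) x u v w
      = extDerivTwo I S.σ x (S.F x u) v w + extDerivTwo I S.σ x u (S.F x v) w
        + extDerivTwo I S.σ x u v (S.F x w) := by
  refine forall_congr' fun x ↦ Iff.symm (forall₃_congr fun u v w ↦ ?_)
  have hσ := S.hasFDerivAt_σ x
  have h₀ := extDerivTwo_apply_of_hasFDerivAt I
    (hasFDerivAt_chartTwoForm_comp hσ (S.hasFDerivAt_F x)) u v w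
  have flat : ∀ (j : TensorJet E) (u v w : E), ((j.Dσ u (j.F v) w + j.σ (j.DF u v) w)
        + (j.Dσ v (j.F w) u + j.σ (j.DF v w) u) + (j.Dσ w (j.F u) v + j.σ (j.DF w u) v))
      = (j.σ (j.DF u v) w + j.Dσ u (j.F v) w) + (j.σ (j.DF v w) u + j.Dσ v (j.F w) u)
        + (j.σ (j.DF w u) v + j.Dσ w (j.F u) v) := by
    intro j u v w
    ring
  exact iff_of_eq (congrArg₂ (fun r s : ℝ ↦ r = s) (h₀.trans (flat (S.jet x) u v w).symm)
    (congrArg₂ (· + ·) (congrArg₂ (· + ·)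
      (extDerivTwo_apply_of_hasFDerivAt I hσ (S.F x u) v w)
      (extDerivTwo_apply_of_hasFDerivAt I hσ u (S.F x v) w))
      (extDerivTwo_apply_of_hasFDerivAt I hσ u v (S.F x w))))

variable [FiniteDimensional ℝ E] [T2Space M]

lemma forall_condA1_iff : (∀ x, (S.jet x).CondA1) ↔ ∀ α β : Π x : M, Cotangent I x,
    SmoothOneForm I α → SmoothOneForm I β → ∀ x : M,
      mlieBracket I (fun y ↦ S.P y (α y)) (fun y ↦ S.P y (β y)) x
        = S.P x (formBracket I S.P α β x) :=
  (forall_section₂_iff (Sm := SmoothOneForm I) (fun _ ↦ exists_smoothOneForm_eq)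
    (fun _ _ hα hβ x ↦ mlieBracket_P_eq_iff (hα.differentiableAt x).hasFDerivAt
      (hβ.differentiableAt x).hasFDerivAt rfl rfl)).symm

lemma forall_condA2_iff : (∀ x, (S.jet x).CondA2) ↔ ∀ α β : Π x : M, Cotangent I x,
    SmoothOneForm I α → SmoothOneForm I β → ∀ x : M,
      (formBracket I S.P α β x).comp (S.F x)
        = lieOneForm I (fun y ↦ S.P y (α y)) (fun y ↦ (β y).comp (S.F y)) x
          - lieOneForm I (fun y ↦ S.P y (β y)) (fun y ↦ (α y).comp (S.F y)) x
          + mvfderiv I (fun y ↦ ((α y).comp (S.F y)) (S.P y (β y))) x :=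
  (forall_section₂_iff (Sm := SmoothOneForm I) (fun _ ↦ exists_smoothOneForm_eq)
    (fun _ _ hα hβ x ↦ formBracket_comp_F_eq_iff (hα.differentiableAt x).hasFDerivAt
      (hβ.differentiableAt x).hasFDerivAt rfl rfl)).symm

lemma forall_condA3_iff : (∀ x, (S.jet x).CondA3) ↔ ∀ X Y : Π x : M, TangentSpace I x,
    SmoothVectorField I X → SmoothVectorField I Y → ∀ x : M,
      nijenhuis I S.F X Y x = S.P x (extDerivTwo I S.σ x (X x) (Y x))
        + extDerivOne I S.ξ x (X x) (Y x) • S.Z x := by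
  refine (forall_section₂_iff (Sm := SmoothVectorField I) (fun _ ↦ exists_smoothVectorField_eq)
    (fun X Y hX hY x ↦ ?_)).symm
  refine (eq_iff_forall_dual_eq (E := E)).trans (forall_congr' fun γ ↦ ?_)
  have h₁ := congrArg γ (nijenhuis_F_eq (S := S) (hX.differentiableAt x).hasFDerivAt
    (hY.differentiableAt x).hasFDerivAt rfl rfl)
  -- Pairing `P♯(i_{X∧Y} dσ)` with `γ` gives `-dσ(X, Y, P♯γ)` by skewness, the form in which it
  -- appears in the torsion.
  have h₂ := (S.P_skew x (extDerivTwo I S.σ x (X x) (Y x)) γ).trans (congrArg Neg.neg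
    (extDerivTwo_apply_of_hasFDerivAt I (S.hasFDerivAt_σ x) (X x) (Y x) (S.P x γ)))
  have h₃ := extDerivOne_apply_of_hasFDerivAt I (S.hasFDerivAt_ξ x) (X x) (Y x)
  have flat : ∀ (j : TensorJet E) (u v w w' : E) (r : ℝ),
      γ (j.DF (j.F u) v - j.DF (j.F v) u + j.F (j.DF v u) - j.F (j.DF u v)) = γ w →
      γ w' = -(j.Dσ u v (j.P γ) + j.Dσ v (j.P γ) u + j.Dσ (j.P γ) u v) →
      r = j.Dξ u v - j.Dξ v u →
      (γ (j.DF (j.F u) v - j.DF (j.F v) u + j.F (j.DF v u) - j.F (j.DF u v)) = γ (w' + r • j.Z) ↔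
        γ (j.DF (j.F u) v) - γ (j.DF (j.F v) u) + γ (j.F (j.DF v u)) - γ (j.F (j.DF u v))
          = -(j.Dσ u v (j.P γ) + j.Dσ v (j.P γ) u + j.Dσ (j.P γ) u v)
            + (j.Dξ u v - j.Dξ v u) * γ j.Z) := by
    intro j u v w w' r _ hw' hr
    rw [map_add, hw', hr]
    simp only [map_add, map_sub, map_smul, smul_eq_mul]
  exact (iff_of_eq (congrArg (fun s : ℝ ↦ s = _) h₁)).trans
    (flat (S.jet x) (X x) (Y x) _ _ _ h₁.symm h₂ h₃)

lemma forall_condA4ξ_iff : (∀ x, (S.jet x).CondA4ξ) ↔ ∀ X Y : Π x : M, TangentSpace I x,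
    SmoothVectorField I X → SmoothVectorField I Y → ∀ x : M,
      lieOneForm I (fun y ↦ S.F y (X y)) S.ξ x (Y x)
        - lieOneForm I (fun y ↦ S.F y (Y y)) S.ξ x (X x) = 0 :=
  (forall_section₂_iff (Sm := SmoothVectorField I) (fun _ ↦ exists_smoothVectorField_eq)
    (fun X Y hX hY x ↦ iff_of_eq (congrArg₂ (fun r s : ℝ ↦ r - s = 0)
      (lieOneForm_F_ξ_apply (S := S) (hX.differentiableAt x).hasFDerivAt rfl (Y x))
      (lieOneForm_F_ξ_apply (S := S) (hY.differentiableAt x).hasFDerivAt rfl (X x))))).symm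

lemma forall_condA5P_iff : (∀ x, (S.jet x).CondA5P) ↔ ∀ α β : Π x : M, Cotangent I x,
    SmoothOneForm I α → SmoothOneForm I β → ∀ x : M, lieBivector I S.Z S.P α β x = 0 :=
  (forall_section₂_iff (Sm := SmoothOneForm I) (fun _ ↦ exists_smoothOneForm_eq)
    (fun _ _ hα hβ x ↦ iff_of_eq (congrArg (fun r : ℝ ↦ r = 0)
      (lieBivector_Z_P_eq (S := S) (hα.differentiableAt x).hasFDerivAt
        (hβ.differentiableAt x).hasFDerivAt rfl rfl)))).symm

lemma forall_condA5F_iff : (∀ x, (S.jet x).CondA5F) ↔ ∀ X : Π x : M, TangentSpace I x,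
    SmoothVectorField I X → ∀ x : M, lieEndomorphism I S.Z S.F X x = 0 :=
  (forall_section_iff (Sm := SmoothVectorField I) (fun _ ↦ exists_smoothVectorField_eq)
    (fun _ hX x ↦ iff_of_eq (congrArg (fun r : E ↦ r = 0)
      (lieEndomorphism_Z_F_eq (S := S) (hX.differentiableAt x).hasFDerivAt rfl)))).symm

lemma forall_condA5σ_iff : (∀ x, (S.jet x).CondA5σ) ↔ ∀ X : Π x : M, TangentSpace I x,
    SmoothVectorField I X → ∀ x : M, lieFlat I S.Z S.σ X x = 0 :=
  (forall_section_iff (Sm := SmoothVectorField I) (fun _ ↦ exists_smoothVectorField_eq)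
    (fun _ hX x ↦ ContinuousLinearMap.ext_iff.trans (forall_congr' fun v ↦
      iff_of_eq (congrArg (fun r : ℝ ↦ r = 0)
        (lieFlat_Z_σ_apply (S := S) (hX.differentiableAt x).hasFDerivAt rfl v))))).symm

lemma forall_condA5Pξ_iff : (∀ x, (S.jet x).CondA5Pξ) ↔ ∀ α : Π x : M, Cotangent I x,
    SmoothOneForm I α → ∀ x : M, lieOneForm I (fun y ↦ S.P y (α y)) S.ξ x = 0 :=
  (forall_section_iff (Sm := SmoothOneForm I) (fun _ ↦ exists_smoothOneForm_eq)
    (fun _ hα x ↦ ContinuousLinearMap.ext_iff.trans (forall_congr' fun v ↦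
      iff_of_eq (congrArg (fun r : ℝ ↦ r = 0)
        (lieOneForm_P_ξ_apply (S := S) (hα.differentiableAt x).hasFDerivAt rfl v))))).symm

theorem isNormal_iff_forall_cond : S.IsNormal ↔
    (∀ x, (S.jet x).CondA1) ∧ (∀ x, (S.jet x).CondA2) ∧ (∀ x, (S.jet x).CondA3) ∧
      (∀ x, (S.jet x).CondA4ξ) ∧ (∀ x, (S.jet x).CondA4σ) ∧ (∀ x, (S.jet x).CondA5ξ) ∧
      (∀ x, (S.jet x).CondA5P) ∧ (∀ x, (S.jet x).CondA5F) ∧ (∀ x, (S.jet x).CondA5σ) ∧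
      (∀ x, (S.jet x).CondA5Pξ) := by
  rw [isNormal_iff_torsion_jet_eq_zero]
  simp only [← forall_and, (S.jet_isParaContact _).torsion_eq_zero_iff]

end GenAlmostParaContact

end ParaContact

end

/-! ### The characterization of normality. -/

open ParaContact in
theorem theorem3p1
    {E : Type*} [NormedAddCommGroup E] [NormedSpace ℝ E] [FiniteDimensional ℝ E]
    (hE : Odd (Module.finrank ℝ E))
    {M : Type*} [TopologicalSpace M] [T2Space M] [SecondCountableTopology M]
    [ChartedSpace E M] [IsManifold 𝓘(ℝ, E) ∞ M]
    (S : GenAlmostParaContact 𝓘(ℝ, E) M) :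
    S.IsNormal ↔
      -- (A1)
      (∀ α β : Π x : M, Cotangent 𝓘(ℝ, E) x,
        SmoothOneForm 𝓘(ℝ, E) α → SmoothOneForm 𝓘(ℝ, E) β → ∀ x : M,
        mlieBracket 𝓘(ℝ, E) (fun y ↦ S.P y (α y)) (fun y ↦ S.P y (β y)) x
          = S.P x (formBracket 𝓘(ℝ, E) S.P α β x)) ∧
      -- (A2)
      ((∀ (x : M) (α : Cotangent 𝓘(ℝ, E) x), S.F x (S.P x α) = S.P x (α.comp (S.F x))) ∧
       (∀ α β : Π x : M, Cotangent 𝓘(ℝ, E) x,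
        SmoothOneForm 𝓘(ℝ, E) α → SmoothOneForm 𝓘(ℝ, E) β → ∀ x : M,
        (formBracket 𝓘(ℝ, E) S.P α β x).comp (S.F x)
          = lieOneForm 𝓘(ℝ, E) (fun y ↦ S.P y (α y)) (fun y ↦ (β y).comp (S.F y)) x
            - lieOneForm 𝓘(ℝ, E) (fun y ↦ S.P y (β y)) (fun y ↦ (α y).comp (S.F y)) x
            + mvfderiv 𝓘(ℝ, E) (fun y ↦ ((α y).comp (S.F y)) (S.P y (β y))) x)) ∧
      -- (A3)
      ((∀ x : M, S.σ x (S.Z x) = 0) ∧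
       (∀ x : M, S.P x (S.ξ x) = 0) ∧
       (∀ (x : M) (u : TangentSpace 𝓘(ℝ, E) x),
        S.F x (S.F x u) = u - S.P x (S.σ x u) - S.ξ x u • S.Z x) ∧
       (∀ X Y : Π x : M, TangentSpace 𝓘(ℝ, E) x,
        SmoothVectorField 𝓘(ℝ, E) X → SmoothVectorField 𝓘(ℝ, E) Y → ∀ x : M,
        nijenhuis 𝓘(ℝ, E) S.F X Y x
          = S.P x (extDerivTwo 𝓘(ℝ, E) S.σ x (X x) (Y x))
            + extDerivOne 𝓘(ℝ, E) S.ξ x (X x) (Y x) • S.Z x)) ∧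
      -- (A4)
      ((∀ x : M, S.F x (S.Z x) = 0) ∧
       (∀ x : M, (S.ξ x).comp (S.F x) = 0) ∧
       (∀ X Y : Π x : M, TangentSpace 𝓘(ℝ, E) x,
        SmoothVectorField 𝓘(ℝ, E) X → SmoothVectorField 𝓘(ℝ, E) Y → ∀ x : M,
        lieOneForm 𝓘(ℝ, E) (fun y ↦ S.F y (X y)) S.ξ x (Y x)
          - lieOneForm 𝓘(ℝ, E) (fun y ↦ S.F y (Y y)) S.ξ x (X x) = 0) ∧
       (∀ (x : M) (u v w : TangentSpace 𝓘(ℝ, E) x),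
        extDerivTwo 𝓘(ℝ, E) (fun y ↦ (S.σ y).comp (S.F y)) x u v w
          = extDerivTwo 𝓘(ℝ, E) S.σ x (S.F x u) v w
            + extDerivTwo 𝓘(ℝ, E) S.σ x u (S.F x v) w
            + extDerivTwo 𝓘(ℝ, E) S.σ x u v (S.F x w))) ∧
      -- (A5)
      ((∀ x : M, lieOneForm 𝓘(ℝ, E) S.Z S.ξ x = 0) ∧
       (∀ α β : Π x : M, Cotangent 𝓘(ℝ, E) x,
        SmoothOneForm 𝓘(ℝ, E) α → SmoothOneForm 𝓘(ℝ, E) β → ∀ x : M,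
        lieBivector 𝓘(ℝ, E) S.Z S.P α β x = 0) ∧
       (∀ X : Π x : M, TangentSpace 𝓘(ℝ, E) x, SmoothVectorField 𝓘(ℝ, E) X → ∀ x : M,
        lieEndomorphism 𝓘(ℝ, E) S.Z S.F X x = 0) ∧
       (∀ X : Π x : M, TangentSpace 𝓘(ℝ, E) x, SmoothVectorField 𝓘(ℝ, E) X → ∀ x : M,
        lieFlat 𝓘(ℝ, E) S.Z S.σ X x = 0) ∧
       (∀ α : Π x : M, Cotangent 𝓘(ℝ, E) x, SmoothOneForm 𝓘(ℝ, E) α → ∀ x : M,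
        lieOneForm 𝓘(ℝ, E) (fun y ↦ S.P y (α y)) S.ξ x = 0)) := by
  have hj := S.jet_isParaContact
  rw [S.isNormal_iff_forall_cond, S.forall_condA1_iff, S.forall_condA2_iff, S.forall_condA3_iff,
    S.forall_condA4ξ_iff, S.forall_condA4σ_iff, S.forall_condA5P_iff, S.forall_condA5F_iff,
    S.forall_condA5σ_iff, S.forall_condA5Pξ_iff,
    forall_congr' fun x ↦ (GenAlmostParaContact.lieOneForm_Z_ξ_eq_zero_iff (S := S) (x := x)).symm]
  -- Only the differential conditions carry information: the algebraic ones hold for every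
  -- structure, so they are supplied by `hj` in one direction and discarded in the other.
  constructor
  · rintro ⟨h₁, h₂, h₃, h₄, h₄', h₅, h₆, h₇, h₈, h₉⟩
    exact ⟨h₁, ⟨fun x ↦ (hj x).F_P, h₂⟩,
      ⟨fun x ↦ (hj x).σ_Z, fun x ↦ (hj x).P_ξ, fun x ↦ (hj x).F_F, h₃⟩,
      ⟨fun x ↦ (hj x).F_Z, fun x ↦ ContinuousLinearMap.ext (hj x).ξ_F, h₄, h₄'⟩,
      h₅, h₆, h₇, h₈, h₉⟩
  · rintro ⟨h₁, ⟨-, h₂⟩, ⟨-, -, -, h₃⟩, ⟨-, -, h₄, h₄'⟩, h₅, h₆, h₇, h₈, h₉⟩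
    exact ⟨h₁, h₂, h₃, h₄, h₄', h₅, h₆, h₇, h₈, h₉⟩
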